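/- **Theorem (DUQ-OT security).** All algorithms (adversaries, simulators, distinguishers) are non-uniform probabilistic polynomial time (PPT) in the security parameter $\lambda$, modelled as families of polynomial-size probabilistic Boolean circuits that may toss coins and sample uniformly below a given integer; in the random-oracle model they may also query the oracle. "Negligible" means negligible in $\lambda$. *Setting.* A group-generation scheme draws a uniform seed of polynomial length and from it efficiently produces a description of a group $\mathbb G$ of prime order $p$ together with a generator $g$; elements of $\mathbb G$ have unique polynomial-length encodings, and multiplication and inversion are efficient. The *DL assumption* says that every PPT algorithm, given $(\mathbb G,p,g,g^{a})$ with $a$ uniform in $\mathbb Z_p$, outputs $a$ with negligible probability; the *CDH assumption* says that every PPT algorithm, given $(\mathbb G,p,g,g^{a_1},g^{a_2})$ with $a_1,a_2$ uniform and independent in $\mathbb Z_p$, outputs $g^{a_1a_2}$ with negligible probability. Messages are strings in $\{0,1\}^{\sigma}$, where $\sigma=\sigma(\lambda)$ is polynomially bounded. The function $G:\{0,1\}^*\to\{0,1\}^{\sigma+\lambda}$ is a random oracle. The random permutation $\pi$ of a pair (its law may depend on $\lambda$, but it is chosen independently of the entries of the pair) is *secure* if, for each position in the permuted pair, each guess of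 the original position of the entry found there is right with probability at most $\tfrac12$ plus a negligible function. *Functionality.* $\mathcal F\big((m_0,m_1),\epsilon,\epsilon,\epsilon,s\big)=(\epsilon,\epsilon,\epsilon,m_s,\epsilon)$ for the parties $S,P_1,P_2,R,T$ (sender, two proxies, receiver, query issuer), with $m_0,m_1\in\{0,1\}^\sigma$ and $s\in\{0,1\}$. *Protocol DUQ-OT.* 1. $S$ generates $(\mathbb G,p,g)$, picks a uniform $a\in\mathbb Z_p$, sets $C=g^a$ and publishes $pk=(\mathbb G,C,p,g)$. 2. $R$ picks uniform $r_1,r_2\in\mathbb Z_p$ and sends $r_i$ to $P_i$. 3. $T$ splits $s=s_1\oplus s_2$ with $s_1$ a uniform bit, picks a uniform $r_3\in\{0,1\}^\lambda$, and sends $s_1$ to $P_1$, $s_2$ to $P_2$, $r_3$ to $S$ and $(s_2,r_3)$ to $R$. 4. $P_2$ sets $\delta_{s_2}=g^{r_2}$, $\delta_{1-s_2}=C/g^{r_2}$ and sends $(\delta_0,\delta_1)$ to $P_1$. 5. $P_1$ sets $\beta_{s_1}=\delta_0\cdot g^{r_1}$, $\beta_{1-s_1}=\delta_1/g^{r_1}$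 and sends $(\beta_0,\beta_1)$ to $S$. 6. $S$ aborts if $C\ne\beta_0\beta_1$. Otherwise it picks uniform $y_0,y_1\in\mathbb Z_p$, computes $e_i=\big(g^{y_i},\,G(\beta_i^{y_i})\oplus(m_i\|r_3)\big)$ for $i=0,1$, and sends $(e'_0,e'_1)=\pi(e_0,e_1)$ to $R$. 7. $R$ sets $x=r_2+r_1(-1)^{s_2}$; for $i=0$ and then $i=1$ it computes $G\big((e'_{i,0})^{x}\big)\oplus e'_{i,1}=u_1\|u_2$ with $|u_2|=\lambda$ and, if $u_2=r_3$, sets its output to $u_1$. *Claim.* If the DL and CDH assumptions hold for the group-generation scheme, $G$ is a random oracle and $\pi$ is secure, then DUQ-OT securely computes $\mathcal F$ in the presence of (non-colluding) semi-honest adversaries: for each party $X\in\{S,P_1,P_2,R,T\}$ there is a PPT simulator $\mathsf{Sim}_X$ with oracle access to $G$ such that, with $x_X$ and $\mathcal F_X$ denoting $X$'s input and its output under $\mathcal F$, $$\big\{\mathsf{Sim}_X(x_X,\mathcal F_X)\big\}_{m_0,m_1,s}\ \stackrel{c}{\equiv}\ \big\{\mathsf{View}_X\big((m_0,m_1),\epsilon,\epsilon,\epsilon,s\big)\big\}_{m_0,m_1,s},$$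 that is, for every PPT distinguisher with oracle access to the same $G$ the distinguishing advantage is bounded by a negligible function of $\lambda$ that does not depend on $m_0,m_1,s$. Here $\mathsf{View}_X$ consists of $X$'s input, its coins, and all messages it receives (including $pk$), and for $X=R$ also the message that $R$ extracts. Moreover, $R$'s output equals $m_s$ except with negligible probability, uniformly in $m_0,m_1,s$. -/

import Mathlib

open MeasureTheory

/-! ## Bit strings, polynomial bounds, negligible functions -/

/-- Bit strings of length `k`. -/
abbrev Bits (k : ℕ) : Type := Fin k → Bool

/-- The `k`-bit binary representation of `x` (least significant bit first). -/
def natBits (k x : ℕ) : Bits k := fun i => x.testBit i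

/-- Side-by-side placement of two blocks of wires. -/
infixr:65 " ⧺ " => Sum.elim

def PolyBounded (f : ℕ → ℕ) : Prop := ∃ P : Polynomial ℕ, ∀ n, f n ≤ P.eval n

/-- `μ n → 0` faster than every inverse polynomial in `n`. -/
def Negligible (μ : ℕ → ℝ) : Prop :=
  Asymptotics.SuperpolynomialDecay Filter.atTop (fun n : ℕ => (n : ℝ)) μ

/-! ## Probabilistic oracle circuits -/

/-- Which oracle gates a circuit may use: gate `q` maps `inLen q` bits to `outLen q` bits. -/
structure OracleSig where
  Q : Type
  inLen : Q → ℕ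
  outLen : Q → ℕ

abbrev OracleSig.Oracle (S : OracleSig) : Type := ∀ q : S.Q, Bits (S.inLen q) → Bits (S.outLen q)

/-- No oracle at all. -/
def plainSig : OracleSig := ⟨Empty, fun q => q.elim, fun q => q.elim⟩

/-- The unique oracle of the empty signature. -/
def noOracle : plainSig.Oracle := fun q => Empty.elim q

/-- An oracle `{0,1}^* → {0,1}^L`: for each length `k` there is a gate taking `k`-bit queries. -/
def roSig (L : ℕ) : OracleSig := ⟨ℕ, fun k => k, fun _ => L⟩

/-- A hash function `{0,1}^* → {0,1}^L` seen as an oracle for circuits. -/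
def roOracle {L : ℕ} (H : List Bool → Bits L) : (roSig L).Oracle := fun _ x => H (List.ofFn x)

/-- The uniform distribution on `{0, …, N - 1}` written with `k` bits, where `N` is the number
whose binary representation is the input (the all-zero string if `N = 0`). -/
noncomputable def uniformBelow (k : ℕ) (x : Bits k) : PMF (Bits k) :=
  if h : Nat.ofBits x = 0 then PMF.pure (fun _ => false)
  else
    haveI : NeZero (Nat.ofBits x) := ⟨h⟩
    (PMF.uniformOfFintype (Fin (Nat.ofBits x))).map (fun i => natBits k i)

/-- Probabilistic Boolean circuits with input wires `α` and output wires `β`. Gates are Boolean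
constants, NAND, fair coins, sampling of a uniform number below a given bound, and oracle gates;
`wire` selects, copies and reorders wires. -/
inductive Circ (S : OracleSig) : Type → Type → Type 1
  | wire {α β : Type} (f : β → α) : Circ S α β
  | const (b : Bool) : Circ S Empty Unit
  | nand : Circ S (Unit ⊕ Unit) Unit
  | coin : Circ S Empty Unit
  | unif (k : ℕ) : Circ S (Fin k) (Fin k)
  | query (q : S.Q) : Circ S (Fin (S.inLen q)) (Fin (S.outLen q))
  | seq {α β γ : Type} (c : Circ S α β) (d : Circ S β γ) : Circ S α γ
  | par {α β γ δ : Type} (c : Circ S α β) (d : Circ S γ δ) : Circ S (α ⊕ γ) (β ⊕ δ)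

namespace Circ

/-- The size of a circuit: the number of its gates, a gate with several wires being charged for
all of them. -/
def size {S : OracleSig} : {α β : Type} → Circ S α β → ℕ
  | _, _, wire _ => 0
  | _, _, const _ => 1
  | _, _, nand => 1
  | _, _, coin => 1
  | _, _, unif k => k + 1
  | _, _, query q => S.inLen q + S.outLen q + 1
  | _, _, seq c d => c.size + d.size
  | _, _, par c d => c.size + d.size

/-- The output distribution of a circuit on a given input, with access to the oracle `O`. -/
noncomputable def eval {S : OracleSig} (O : S.Oracle) :
    {α β : Type} → Circ S α β → (α → Bool) → PMF (β → Bool)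
  | _, _, wire f, x => PMF.pure (fun i => x (f i))
  | _, _, const b, _ => PMF.pure (fun _ => b)
  | _, _, nand, x => PMF.pure (fun _ => !(x (Sum.inl ()) && x (Sum.inr ())))
  | _, _, coin, _ => (PMF.uniformOfFintype Bool).map (fun b _ => b)
  | _, _, unif k, x => uniformBelow k x
  | _, _, query q, x => PMF.pure (O q x)
  | _, _, seq c d, x => (c.eval O x).bind (fun y => d.eval O y)
  | _, _, par c d, x =>
      (c.eval O (fun i => x (Sum.inl i))).bind fun y =>
        (d.eval O (fun i => x (Sum.inr i))).map fun z => y ⧺ z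

end Circ

/-- A non-uniform probabilistic polynomial-time algorithm: a family of probabilistic circuits, one
for each value of the security parameter, of polynomially bounded size. -/
structure PPT (S : ℕ → OracleSig) (α β : ℕ → Type) where
  circ : ∀ n, Circ (S n) (α n) (β n)
  poly : PolyBounded fun n => (circ n).size

/-- Oracle-free non-uniform PPT algorithms. -/
abbrev PlainPPT (α β : ℕ → Type) := PPT (fun _ => plainSig) α β

/-- The output distribution of an oracle-free algorithm. -/
noncomputable def PPT.run {α β : ℕ → Type} (A : PlainPPT α β) (n : ℕ) (x : α n → Bool) :
    PMF (β n → Bool) := (A.circ n).eval noOracle x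

/-! ## Group generation and the discrete-logarithm and Diffie–Hellman assumptions -/

/-- A group-generation scheme. For security parameter `n` it draws a uniform seed `ω`, which
determines a group of prime order with a generator. The published parameters are a description
`desc` of the group, the order and the encoded generator; group elements are represented by bit
strings. Parameter generation, multiplication and inversion are efficient. -/
structure GroupGen where
  seedLen : ℕ → ℕ
  descLen : ℕ → ℕ
  expLen : ℕ → ℕ
  eltLen : ℕ → ℕ
  seedLen_poly : PolyBounded seedLen
  descLen_poly : PolyBounded descLen
  expLen_poly : PolyBounded expLen
  eltLen_poly : PolyBounded eltLen
  Carrier : (n : ℕ) → Bits (seedLen n) → Type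
  group : ∀ n ω, CommGroup (Carrier n ω)
  order : (n : ℕ) → Bits (seedLen n) → ℕ
  order_prime : ∀ n ω, (order n ω).Prime
  order_lt : ∀ n ω, order n ω < 2 ^ expLen n
  card_eq : ∀ n ω, Nat.card (Carrier n ω) = order n ω
  gen : ∀ n ω, Carrier n ω
  gen_generates : ∀ n ω (x : Carrier n ω), x ∈ Subgroup.zpowers (gen n ω)
  desc : ∀ n, Bits (seedLen n) → Bits (descLen n)
  enc : ∀ n ω, Carrier n ω → Bits (eltLen n)
  enc_injective : ∀ n ω, Function.Injective (enc n ω)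
  genAlg : PlainPPT (fun n => Fin (seedLen n))
    (fun n => Fin (descLen n) ⊕ Fin (expLen n) ⊕ Fin (eltLen n))
  genAlg_spec : ∀ n ω, genAlg.run n ω =
    PMF.pure (desc n ω ⧺ natBits (expLen n) (order n ω) ⧺ enc n ω (gen n ω))
  mulAlg : PlainPPT
    (fun n => (Fin (descLen n) ⊕ Fin (expLen n) ⊕ Fin (eltLen n)) ⊕
      Fin (eltLen n) ⊕ Fin (eltLen n))
    (fun n => Fin (eltLen n))
  mulAlg_spec : ∀ n ω (x y : Carrier n ω),
    mulAlg.run n ((desc n ω ⧺ natBits (expLen n) (order n ω) ⧺ enc n ω (gen n ω)) ⧺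
      enc n ω x ⧺ enc n ω y) = PMF.pure (enc n ω (x * y))
  invAlg : PlainPPT
    (fun n => (Fin (descLen n) ⊕ Fin (expLen n) ⊕ Fin (eltLen n)) ⊕ Fin (eltLen n))
    (fun n => Fin (eltLen n))
  invAlg_spec : ∀ n ω (x : Carrier n ω),
    invAlg.run n ((desc n ω ⧺ natBits (expLen n) (order n ω) ⧺ enc n ω (gen n ω)) ⧺
      enc n ω x) = PMF.pure (enc n ω x⁻¹)

namespace GroupGen

instance (𝒢 : GroupGen) (n : ℕ) (ω : Bits (𝒢.seedLen n)) : CommGroup (𝒢.Carrier n ω) :=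
  𝒢.group n ω

instance (𝒢 : GroupGen) (n : ℕ) (ω : Bits (𝒢.seedLen n)) : NeZero (𝒢.order n ω) :=
  ⟨(𝒢.order_prime n ω).ne_zero⟩

/-- Exponents, i.e. integers modulo the order of the group. -/
abbrev Exp (𝒢 : GroupGen) (n : ℕ) (ω : Bits (𝒢.seedLen n)) : Type := ZMod (𝒢.order n ω)

/-- `g ^ a`. -/
def pow (𝒢 : GroupGen) {n : ℕ} {ω : Bits (𝒢.seedLen n)} (g : 𝒢.Carrier n ω)
    (a : 𝒢.Exp n ω) : 𝒢.Carrier n ω := g ^ a.val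

/-- The binary representation of an exponent. -/
def encExp (𝒢 : GroupGen) {n : ℕ} {ω : Bits (𝒢.seedLen n)} (a : 𝒢.Exp n ω) :
    Bits (𝒢.expLen n) := natBits (𝒢.expLen n) a.val

/-- Wires carrying the group parameters. -/
abbrev ParamWires (𝒢 : GroupGen) (n : ℕ) : Type :=
  Fin (𝒢.descLen n) ⊕ Fin (𝒢.expLen n) ⊕ Fin (𝒢.eltLen n)

/-- The group parameters: description, order, generator. -/
def params (𝒢 : GroupGen) (n : ℕ) (ω : Bits (𝒢.seedLen n)) : 𝒢.ParamWires n → Bool :=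
  𝒢.desc n ω ⧺ natBits (𝒢.expLen n) (𝒢.order n ω) ⧺ 𝒢.enc n ω (𝒢.gen n ω)

/-- The probability that `A`, given the group parameters and `g ^ a`, outputs `a`. -/
noncomputable def dlAdvantage (𝒢 : GroupGen)
    (A : PlainPPT (fun n => 𝒢.ParamWires n ⊕ Fin (𝒢.eltLen n)) (fun n => Fin (𝒢.expLen n)))
    (n : ℕ) : ℝ :=
  ((do
    let ω ← PMF.uniformOfFintype (Bits (𝒢.seedLen n))
    let a ← PMF.uniformOfFintype (𝒢.Exp n ω)
    let out ← A.run n (𝒢.params n ω ⧺ 𝒢.enc n ω (𝒢.pow (𝒢.gen n ω) a))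
    pure (decide (out = 𝒢.encExp a)) : PMF Bool) true).toReal

/-- The discrete-logarithm assumption. -/
def DLHard (𝒢 : GroupGen) : Prop := ∀ A, Negligible (𝒢.dlAdvantage A)

/-- The probability that `A`, given the group parameters, `g ^ a₁` and `g ^ a₂`, outputs
`g ^ (a₁ * a₂)`. -/
noncomputable def cdhAdvantage (𝒢 : GroupGen)
    (A : PlainPPT (fun n => 𝒢.ParamWires n ⊕ Fin (𝒢.eltLen n) ⊕ Fin (𝒢.eltLen n))
      (fun n => Fin (𝒢.eltLen n)))
    (n : ℕ) : ℝ :=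
  ((do
    let ω ← PMF.uniformOfFintype (Bits (𝒢.seedLen n))
    let a₁ ← PMF.uniformOfFintype (𝒢.Exp n ω)
    let a₂ ← PMF.uniformOfFintype (𝒢.Exp n ω)
    let out ← A.run n (𝒢.params n ω ⧺ 𝒢.enc n ω (𝒢.pow (𝒢.gen n ω) a₁) ⧺
      𝒢.enc n ω (𝒢.pow (𝒢.gen n ω) a₂))
    pure (decide (out = 𝒢.enc n ω (𝒢.pow (𝒢.gen n ω) (a₁ * a₂)))) : PMF Bool) true).toReal

/-- The computational Diffie–Hellman assumption. -/
def CDHHard (𝒢 : GroupGen) : Prop := ∀ A, Negligible (𝒢.cdhAdvantage A)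

end GroupGen

/-! ## The random oracle -/

/-- The law of a random oracle `{0,1}^* → {0,1}^L`: independent uniform values. -/
noncomputable def roMeasure (L : ℕ) : Measure (List Bool → Bits L) :=
  Measure.infinitePi fun _ => (PMF.uniformOfFintype (Bits L)).toMeasure

/-- The probability that an experiment returns `true`, over the random oracle and the
experiment's own coins. -/
noncomputable def roProb {L : ℕ} (E : (List Bool → Bits L) → PMF Bool) : ℝ :=
  (∫⁻ H, E H true ∂(roMeasure L)).toReal

/-! ## Random permutations of a pair -/

/-- `π n` is the law of the permutation `τ` of the two positions used for security parameter `n`;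
the entry in position `j` after permuting is the one that was in position `τ j`. It is secure if
the original position of an entry is guessed with probability at most `1 / 2`, up to a negligible
error. -/
def SecurePermutation (π : ℕ → PMF (Equiv.Perm Bool)) : Prop :=
  ∃ μ, Negligible μ ∧ ∀ n (i j : Bool), ((π n).map (fun τ => τ j) i).toReal ≤ 1 / 2 + μ n

/-! ## Five-party protocols and the delegated-unknown-query OT functionality -/

/-- Sender, the two proxies, receiver, query issuer. -/
inductive Party
  | S | P₁ | P₂ | R | T

/-- Wires of a party's input, for messages of length `ℓ`: the sender holds two messages, the query
issuer a bit, the others the empty string. -/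
def inWires (ℓ : ℕ) : Party → Type
  | .S => Fin ℓ ⊕ Fin ℓ
  | .T => Unit
  | _ => Empty

/-- Wires of a party's output: a message for the receiver, the empty string for the others. -/
def outWires (ℓ : ℕ) : Party → Type
  | .R => Fin ℓ
  | _ => Empty

/-- The input of each party: `(m₀, m₁)` for the sender and `s` for the query issuer. -/
def partyInput {ℓ : ℕ} (m : Bool → Bits ℓ) (s : Bool) : (i : Party) → inWires ℓ i → Bool
  | .S => (m false ⧺ m true : Fin ℓ ⊕ Fin ℓ → Bool)
  | .T => (fun _ => s : Unit → Bool)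
  | .P₁ => (Empty.elim : Empty → Bool)
  | .P₂ => (Empty.elim : Empty → Bool)
  | .R => (Empty.elim : Empty → Bool)

/-- The functionality `((m₀, m₁), ε, ε, ε, s) ↦ (ε, ε, ε, m_s, ε)`. -/
def functionality {ℓ : ℕ} (m : Bool → Bits ℓ) (s : Bool) : (i : Party) → outWires ℓ i → Bool
  | .R => (m s : Fin ℓ → Bool)
  | .S => (Empty.elim : Empty → Bool)
  | .P₁ => (Empty.elim : Empty → Bool)
  | .P₂ => (Empty.elim : Empty → Bool)
  | .T => (Empty.elim : Empty → Bool)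

/-- A protocol in the random-oracle model for five parties: the joint behaviour of the parties
enters security only through the view of each of them and the receiver's output, both depending on
the oracle `H : {0,1}^* → {0,1}^{L n}` and on the inputs. Messages have `σ n` bits. -/
structure Protocol (σ L : ℕ → ℕ) where
  ViewWires : Party → ℕ → Type
  view : ∀ n, (List Bool → Bits (L n)) → (Bool → Bits (σ n)) → Bool →
    (i : Party) → PMF (ViewWires i n → Bool)
  output : ∀ n, (List Bool → Bits (L n)) → (Bool → Bits (σ n)) → Bool →
    PMF (Option (Bits (σ n)))

namespace Protocol

variable {σ L : ℕ → ℕ}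

/-- Simulators for party `i`: from the party's input and output they produce a view. -/
abbrev Simulator (Γ : Protocol σ L) (i : Party) :=
  PPT (fun n => roSig (L n)) (fun n => inWires (σ n) i ⊕ outWires (σ n) i) (Γ.ViewWires i)

/-- Distinguishers for views of party `i`. -/
abbrev Distinguisher (Γ : Protocol σ L) (i : Party) :=
  PPT (fun n => roSig (L n)) (Γ.ViewWires i) (fun _ => Unit)

/-- The probability that `D` outputs 1 on the view of party `i` in an execution of `Γ`. -/
noncomputable def realProb (Γ : Protocol σ L) (i : Party) (D : Γ.Distinguisher i)
    (n : ℕ) (m : Bool → Bits (σ n)) (s : Bool) : ℝ :=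
  roProb fun H : List Bool → Bits (L n) => do
    let v ← Γ.view n H m s i
    let b ← (D.circ n).eval (roOracle H) v
    pure (b ())

/-- The probability that `D` outputs 1 on the view that the simulator produces from the input of
party `i` and the output that the functionality assigns to it. -/
noncomputable def idealProb (Γ : Protocol σ L) (i : Party) (Sim : Γ.Simulator i)
    (D : Γ.Distinguisher i) (n : ℕ) (m : Bool → Bits (σ n)) (s : Bool) : ℝ :=
  roProb fun H : List Bool → Bits (L n) => do
    let v ← (Sim.circ n).eval (roOracle H) (partyInput m s i ⧺ functionality m s i)
    let b ← (D.circ n).eval (roOracle H) v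
    pure (b ())

/-- `Γ` realizes the functionality in the presence of (non-colluding) passive adversaries: for each
party the ensembles, indexed by `m₀`, `m₁` and `s`, of simulated and of real views are
computationally indistinguishable. -/
def Realizes (Γ : Protocol σ L) : Prop :=
  ∀ i : Party, ∃ Sim : Γ.Simulator i, ∀ D : Γ.Distinguisher i, ∃ μ, Negligible μ ∧
    ∀ n m s, |Γ.idealProb i Sim D n m s - Γ.realProb i D n m s| ≤ μ n

open Classical in
/-- The receiver outputs `m_s`, except with negligible probability. -/
def Correct (Γ : Protocol σ L) : Prop :=
  ∃ μ, Negligible μ ∧ ∀ n m s,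
    1 - μ n ≤ roProb fun H : List Bool → Bits (L n) =>
      (Γ.output n H m s).map fun o => decide (o = some (m s))

end Protocol

/-! ## The protocol DUQ-OT -/

namespace DUQOT

section Algorithms

variable {G : Type} [CommGroup G] {p : ℕ}

/-- Query generation of `P₂`: `δ_{s₂} = g ^ r₂` and `δ_{1 - s₂} = C / g ^ r₂`. -/
def genQuery₂ (g C : G) (s₂ : Bool) (r₂ : ZMod p) : Bool → G :=
  fun i => if i = s₂ then g ^ r₂.val else C / g ^ r₂.val

/-- Query generation of `P₁`: `β_{s₁} = δ₀ * g ^ r₁` and `β_{1 - s₁} = δ₁ / g ^ r₁`. -/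
def genQuery₁ (g : G) (s₁ : Bool) (r₁ : ZMod p) (δ : Bool → G) : Bool → G :=
  fun i => if i = s₁ then δ false * g ^ r₁.val else δ true / g ^ r₁.val

/-- Bitwise exclusive or. -/
def xorBits {k : ℕ} (x y : Bits k) : Bits k := fun i => xor (x i) (y i)

open Classical in
/-- Response generation of the sender: abort if `C ≠ β₀ * β₁`, otherwise compute
`e_i = (g ^ y_i, H (β_i ^ y_i) ⊕ (m_i ‖ r₃))` and permute the pair `(e₀, e₁)`. -/
noncomputable def genRes {ℓ k len : ℕ} (H : List Bool → Bits (ℓ + k)) (enc : G → Bits len)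
    (g C : G) (β : Bool → G) (m : Bool → Bits ℓ) (r₃ : Bits k) (y : Bool → ZMod p)
    (τ : Equiv.Perm Bool) : Option (Bool → G × Bits (ℓ + k)) :=
  if C = β false * β true then
    some fun j =>
      let i := τ j
      (g ^ (y i).val,
        xorBits (H (List.ofFn (enc (β i ^ (y i).val)))) (Fin.append (m i) r₃))
  else none

/-- The decryption of a ciphertext under exponent `x`, parsed into its first `ℓ` bits and its last
`k` bits. -/
def decrypt {ℓ k len : ℕ} (H : List Bool → Bits (ℓ + k)) (enc : G → Bits len) (x : ZMod p)
    (e : G × Bits (ℓ + k)) : Bits ℓ × Bits k :=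
  let w := xorBits (H (List.ofFn (enc (e.1 ^ x.val)))) e.2
  (fun i => w (Fin.castAdd k i), fun i => w (Fin.natAdd ℓ i))

/-- Message extraction of the receiver: with `x = r₂ + r₁ * (-1) ^ s₂`, decrypt the two elements
of the response one after the other, and set the output to each result that carries the tag
`r₃` (so that the later one prevails if both do). -/
def retrieve {ℓ k len : ℕ} (H : List Bool → Bits (ℓ + k)) (enc : G → Bits len)
    (r₁ r₂ : ZMod p) (s₂ : Bool) (r₃ : Bits k) :
    Option (Bool → G × Bits (ℓ + k)) → Option (Bits ℓ)
  | none => none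
  | some e =>
    let x := r₂ + r₁ * (-1) ^ s₂.toNat
    [false, true].foldl (fun out i =>
      if (decrypt H enc x (e i)).2 = r₃ then some (decrypt H enc x (e i)).1 else out) none

end Algorithms

/-- All the coins of one execution. The sender's coins are the seed of the group parameters, the
exponent `a` with `C = g ^ a`, the exponents `y₀`, `y₁`, and the permutation `τ`; the receiver's
are `r₁`, `r₂`; those of the query issuer are the share `s₁` and the tag `r₃`. -/
structure Coins (𝒢 : GroupGen) (n : ℕ) where
  seed : Bits (𝒢.seedLen n)
  a : 𝒢.Exp n seed
  y : Bool → 𝒢.Exp n seed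
  τ : Equiv.Perm Bool
  r₁ : 𝒢.Exp n seed
  r₂ : 𝒢.Exp n seed
  s₁ : Bool
  r₃ : Bits n

/-- Independent coins, uniform except for the permutation, which has law `π n`. -/
noncomputable def sampleCoins (𝒢 : GroupGen) (π : ℕ → PMF (Equiv.Perm Bool)) (n : ℕ) :
    PMF (Coins 𝒢 n) := do
  let seed ← PMF.uniformOfFintype (Bits (𝒢.seedLen n))
  let a ← PMF.uniformOfFintype (𝒢.Exp n seed)
  let y₀ ← PMF.uniformOfFintype (𝒢.Exp n seed)
  let y₁ ← PMF.uniformOfFintype (𝒢.Exp n seed)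
  let τ ← π n
  let r₁ ← PMF.uniformOfFintype (𝒢.Exp n seed)
  let r₂ ← PMF.uniformOfFintype (𝒢.Exp n seed)
  let s₁ ← PMF.uniformOfFintype Bool
  let r₃ ← PMF.uniformOfFintype (Bits n)
  pure ⟨seed, a, fun i => if i then y₁ else y₀, τ, r₁, r₂, s₁, r₃⟩

namespace Coins

variable {𝒢 : GroupGen} {n : ℕ} (c : Coins 𝒢 n)

/-- The generator. -/
def g : 𝒢.Carrier n c.seed := 𝒢.gen n c.seed

/-- The public random group element. -/
def C : 𝒢.Carrier n c.seed := 𝒢.pow c.g c.a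

/-- The second share of the index, `s = s₁ ⊕ s₂`. -/
def s₂ (s : Bool) : Bool := xor c.s₁ s

/-- The message from `P₂` to `P₁`. -/
def δ (s : Bool) : Bool → 𝒢.Carrier n c.seed := genQuery₂ c.g c.C (c.s₂ s) c.r₂

/-- The message from `P₁` to the sender. -/
def β (s : Bool) : Bool → 𝒢.Carrier n c.seed := genQuery₁ c.g c.s₁ c.r₁ (c.δ s)

/-- The message from the sender to the receiver (`none` if the sender aborts). -/
noncomputable def res {ℓ : ℕ} (H : List Bool → Bits (ℓ + n)) (m : Bool → Bits ℓ) (s : Bool) :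
    Option (Bool → 𝒢.Carrier n c.seed × Bits (ℓ + n)) :=
  genRes H (𝒢.enc n c.seed) c.g c.C (c.β s) m c.r₃ c.y c.τ

/-- The receiver's output. -/
noncomputable def out {ℓ : ℕ} (H : List Bool → Bits (ℓ + n)) (m : Bool → Bits ℓ) (s : Bool) :
    Option (Bits ℓ) :=
  retrieve H (𝒢.enc n c.seed) c.r₁ c.r₂ (c.s₂ s) c.r₃ (c.res H m s)

/-- The encoded public key `(C, p, g)`, together with the description of the group. -/
def pk : 𝒢.ParamWires n ⊕ Fin (𝒢.eltLen n) → Bool :=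
  𝒢.params n c.seed ⧺ 𝒢.enc n c.seed c.C

end Coins

/-- One wire. -/
def bit (b : Bool) : Unit → Bool := fun _ => b

/-- An optional value as one flag wire followed by the value (zeros if there is none). -/
def encOption {X W : Type} (f : X → W → Bool) : Option X → Unit ⊕ W → Bool
  | none => bit false ⧺ fun _ => false
  | some x => bit true ⧺ f x

/-- The encoding of a pair of ciphertexts. -/
def encCiphers {G : Type} {len k : ℕ} (enc : G → Bits len) (e : Bool → G × Bits k) :
    (Fin len ⊕ Fin k) ⊕ (Fin len ⊕ Fin k) → Bool :=
  (enc (e false).1 ⧺ (e false).2) ⧺ (enc (e true).1 ⧺ (e true).2)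

variable (𝒢 : GroupGen) (σ : ℕ → ℕ)

/-- Wires of the public key. -/
abbrev PkWires (n : ℕ) : Type := 𝒢.ParamWires n ⊕ Fin (𝒢.eltLen n)

/-- Wires of the parties' views. -/
def ViewWires : Party → ℕ → Type
  | .S, n => (Fin (σ n) ⊕ Fin (σ n)) ⊕
      (Fin (𝒢.seedLen n) ⊕ Fin (𝒢.expLen n) ⊕ Fin (𝒢.expLen n) ⊕ Fin (𝒢.expLen n) ⊕ Unit) ⊕
      PkWires 𝒢 n ⊕ Fin n ⊕ Fin (𝒢.eltLen n) ⊕ Fin (𝒢.eltLen n)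
  | .P₁, n => PkWires 𝒢 n ⊕ Unit ⊕ Fin (𝒢.expLen n) ⊕ Fin (𝒢.eltLen n) ⊕ Fin (𝒢.eltLen n)
  | .P₂, n => PkWires 𝒢 n ⊕ Unit ⊕ Fin (𝒢.expLen n)
  | .R, n => (Fin (𝒢.expLen n) ⊕ Fin (𝒢.expLen n)) ⊕ PkWires 𝒢 n ⊕ Fin n ⊕ Unit ⊕
      (Unit ⊕ (Fin (𝒢.eltLen n) ⊕ Fin (σ n + n)) ⊕ (Fin (𝒢.eltLen n) ⊕ Fin (σ n + n))) ⊕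
      (Unit ⊕ Fin (σ n))
  | .T, n => Unit ⊕ (Unit ⊕ Fin n) ⊕ PkWires 𝒢 n

/-- The view of each party: its input, its coins, the messages it receives, and (for the receiver)
its output.
* `S`: `(m₀, m₁)`, coins (seed, `a`, `y₀`, `y₁`, whether the pair is swapped), `pk`, `r₃`,
  `β₀`, `β₁`;
* `P₁`: `pk`, `s₁`, `r₁`, `δ₀`, `δ₁`;
* `P₂`: `pk`, `s₂`, `r₂`;
* `R`: coins `r₁`, `r₂`; `pk`, `r₃`, `s₂`, the response, and the extracted message;
* `T`: `s`, coins `s₁`, `r₃`; `pk`. -/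
noncomputable def partyView {n : ℕ} (H : List Bool → Bits (σ n + n)) (m : Bool → Bits (σ n))
    (s : Bool) (c : Coins 𝒢 n) : (i : Party) → ViewWires 𝒢 σ i n → Bool
  | .S => (m false ⧺ m true) ⧺
      (c.seed ⧺ 𝒢.encExp c.a ⧺ 𝒢.encExp (c.y false) ⧺ 𝒢.encExp (c.y true) ⧺ bit (c.τ false)) ⧺
      c.pk ⧺ c.r₃ ⧺ 𝒢.enc n c.seed (c.β s false) ⧺ 𝒢.enc n c.seed (c.β s true)
  | .P₁ => c.pk ⧺ bit c.s₁ ⧺ 𝒢.encExp c.r₁ ⧺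
      𝒢.enc n c.seed (c.δ s false) ⧺ 𝒢.enc n c.seed (c.δ s true)
  | .P₂ => c.pk ⧺ bit (c.s₂ s) ⧺ 𝒢.encExp c.r₂
  | .R => (𝒢.encExp c.r₁ ⧺ 𝒢.encExp c.r₂) ⧺ c.pk ⧺ c.r₃ ⧺ bit (c.s₂ s) ⧺
      encOption (encCiphers (𝒢.enc n c.seed)) (c.res H m s) ⧺
      encOption (fun x : Bits (σ n) => x) (c.out H m s)
  | .T => bit s ⧺ (bit c.s₁ ⧺ c.r₃) ⧺ c.pk

end DUQOT

/-- The protocol DUQ-OT over the group-generation scheme `𝒢`, for messages of `σ n` bits, a tag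
of `n` bits, a random oracle with values in `{0,1}^{σ n + n}`, and the random permutation `π`. -/
noncomputable def duqOT (𝒢 : GroupGen) (σ : ℕ → ℕ) (π : ℕ → PMF (Equiv.Perm Bool)) :
    Protocol σ (fun n => σ n + n) where
  ViewWires := DUQOT.ViewWires 𝒢 σ
  view n H m s i := (DUQOT.sampleCoins 𝒢 π n).map fun c => DUQOT.partyView 𝒢 σ H m s c i
  output n H m s := (DUQOT.sampleCoins 𝒢 π n).map fun c => c.out H m s

/-!
The sender, the proxies and the query issuer see nothing that depends on the inputs of others. The
elements `δ₀, δ₁` sent to `P₁` multiply to `C`, and so do `β₀, β₁`; the discrete logarithm of the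
first one is an affine function, with slope `±1`, of a uniform exponent that the party does not
know. So these views are perfectly simulated by `g ^ b, C / g ^ b` with a fresh `b`
(`simulator_S`, `simulator_P₁`, `simulator_P₂`, `simulator_T`), apart from the bit that describes
the permutation in the sender's view, which `SecurePermutation` makes negligibly close to a coin.

The receiver knows the discrete logarithm `x` of `β_s`, so that the ciphertext of `m_s` decrypts
properly. The ciphertext of the other message is encrypted under the oracle's value at the *hidden
key* `(C / g ^ x) ^ y`, where `y` is the sender's exponent for that message.

* Correctness (`correct`). The receiver decrypts the other ciphertext with the oracle's value at
  `g ^ (y * x)`. If this differs from the hidden key, then the tags agree with probability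
  `2 ^ (-n)`. If not, then `y = 0` or the exponent of `C` is `2 * x`; each of these has a
  probability that the DL assumption makes negligible (`negligible_zeroExp`).
* Simulation (`simulator_R`). The simulator runs the protocol by itself, encrypts `m_s`, and takes
  uniform bits in place of the other masked message. Since the oracle's value at the hidden key is a
  one-time pad, the simulation is good until the hidden key is queried (`one_time_pad`), up to the
  bias of the permutation. The product of the hidden key and `(g ^ y) ^ x` is the Diffie–Hellman
  value of `C` and `g ^ y`, and the second factor can be computed from the receiver's coins. Hence
  a distinguisher whose oracle is sampled lazily, one of whose queries is then singled out, solves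
  the CDH problem (`exists_cdh_solver`); the best choices of the query and of the message `m_s` are
  built into the non-uniform circuit.

A random oracle on strings of bounded length is a finite random function (`roProb_eq`), which brings
all experiments into the realm of probability mass functions. Lazy sampling has to be carried out by
an oracle-free circuit: the log of an oracle circuit is laid out on wires, one slot for each of its
oracle gates, and a query is compared with all the slots before it (`exists_lazy_circuit`).
-/

/-! ### Probability mass functions -/

section PMFTools

open scoped ENNReal

variable {A B C : Type}

theorem pmf_bind_def (p : PMF A) (f : A → PMF B) : (p >>= f) = p.bind f := rfl

theorem pmf_pure_def (a : A) : (pure a : PMF A) = PMF.pure a := rfl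

theorem PMF.map_eq_bind (p : PMF A) (f : A → B) : p.map f = p.bind fun a => PMF.pure (f a) := rfl

theorem PMF.bind_map_apply (p : PMF A) (f : A → B) (q : B → PMF C) :
    (p.map f).bind q = p.bind fun a => q (f a) := PMF.bind_map p f q

theorem PMF.bind_congr' (p : PMF A) {f g : A → PMF B} (h : ∀ a, f a = g a) :
    p.bind f = p.bind g := by rw [funext h]

/-- Bounds of this form add up the errors of the steps of a hybrid argument; the error is again
the probability of an event. -/
theorem PMF.bind_true_le (p : PMF A) {f g e : A → PMF Bool}
    (h : ∀ a, f a true ≤ g a true + e a true) :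
    (p.bind f) true ≤ (p.bind g) true + (p.bind e) true := by
  simp only [PMF.bind_apply]
  rw [← ENNReal.tsum_add]
  refine ENNReal.tsum_le_tsum fun a => ?_
  rw [← mul_add]
  exact mul_le_mul_right (h a) _

theorem PMF.bind_true_le_const (p : PMF A) {f g : A → PMF Bool} {ε : ℝ≥0∞}
    (h : ∀ a, f a true ≤ g a true + ε) :
    (p.bind f) true ≤ (p.bind g) true + ε := by
  simp only [PMF.bind_apply]
  calc ∑' a, p a * f a true ≤ ∑' a, (p a * g a true + p a * ε) :=
        ENNReal.tsum_le_tsum fun a => by rw [← mul_add]; exact mul_le_mul_right (h a) _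
    _ = _ := by rw [ENNReal.tsum_add, ENNReal.tsum_mul_right, p.tsum_coe, one_mul]

theorem PMF.bind_true_mono (p : PMF A) {f g : A → PMF Bool}
    (h : ∀ a, f a true ≤ g a true) : (p.bind f) true ≤ (p.bind g) true :=
  ENNReal.tsum_le_tsum fun a => mul_le_mul_right (h a) _

theorem PMF.bind_true_le_of_le (p : PMF A) {f : A → PMF Bool} {ε : ℝ≥0∞}
    (h : ∀ a, f a true ≤ ε) : (p.bind f) true ≤ ε := by
  calc ∑' a, p a * f a true ≤ ∑' a, p a * ε :=
        ENNReal.tsum_le_tsum fun a => mul_le_mul_right (h a) _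
    _ = _ := by rw [ENNReal.tsum_mul_right, p.tsum_coe, one_mul]

theorem PMF.bool_sum (p : PMF Bool) : p true + p false = 1 := by
  have := p.tsum_coe
  rwa [tsum_fintype, Fintype.sum_bool] at this

/-- Replacing a biased bit by another one whose probabilities are no smaller, up to `ε`, raises
no probability by more than `ε`. -/
theorem PMF.bool_bind_true_le (p q : PMF Bool) {f : Bool → PMF Bool} {ε : ℝ≥0∞}
    (h : ∀ b, p b ≤ q b + ε) : (p.bind f) true ≤ (q.bind f) true + ε := by
  simp only [PMF.bind_apply, tsum_fintype, Fintype.sum_bool]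
  -- The claim in real numbers: as `a - c = d - b`, the two sides differ by `(a - c) * (x - y)` with
  -- `|a - c| ≤ e` and `|x - y| ≤ 1`.
  have key : ∀ a b c d x y : ℝ, 0 ≤ x → x ≤ 1 → 0 ≤ y → y ≤ 1 → ∀ e, 0 ≤ e → a + b = 1 →
      c + d = 1 → a ≤ c + e → b ≤ d + e → a * x + b * y ≤ c * x + d * y + e := by
    intro a b c d x y hx hx1 hy hy1 e he h1 h2 h3 h4
    obtain rfl : b = 1 - a := by linarith
    obtain rfl : d = 1 - c := by linarith
    rcases le_total x y with hxy | hxy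
    · nlinarith [mul_nonneg (sub_nonneg.2 hxy) (by linarith : 0 ≤ e + (a - c)),
        mul_nonneg he (by linarith : 0 ≤ 1 - (y - x))]
    · nlinarith [mul_nonneg (sub_nonneg.2 hxy) (by linarith : 0 ≤ e - (a - c)),
        mul_nonneg he (by linarith : 0 ≤ 1 - (x - y))]
  by_cases hε : ε = ∞
  · simp [hε]
  have ne : ∀ (r : PMF Bool) b, r b ≠ ∞ := fun r b => r.apply_ne_top b
  have total : ∀ r : PMF Bool, (r true).toReal + (r false).toReal = 1 := fun r => by
    rw [← ENNReal.toReal_add (ne r _) (ne r _), r.bool_sum, ENNReal.toReal_one]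
  have le1 : ∀ (r : PMF Bool) b, (r b).toReal ≤ 1 := fun r b => by
    rw [← ENNReal.toReal_one]; exact ENNReal.toReal_mono ENNReal.one_ne_top (r.coe_le_one b)
  have hh : ∀ b, (p b).toReal ≤ (q b).toReal + ε.toReal := fun b => by
    rw [← ENNReal.toReal_add (ne q b) hε]
    exact ENNReal.toReal_mono (ENNReal.add_ne_top.2 ⟨ne q b, hε⟩) (h b)
  have t1 : ∀ r : PMF Bool, r true * f true true + r false * f false true ≠ ∞ := fun r =>
    ENNReal.add_ne_top.2
      ⟨ENNReal.mul_ne_top (ne _ _) (ne _ _), ENNReal.mul_ne_top (ne _ _) (ne _ _)⟩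
  rw [← ENNReal.toReal_le_toReal (t1 p) (ENNReal.add_ne_top.2 ⟨t1 q, hε⟩),
    ENNReal.toReal_add (t1 q) hε]
  simp only [ENNReal.toReal_add (ENNReal.mul_ne_top (ne _ _) (ne _ _))
    (ENNReal.mul_ne_top (ne _ _) (ne _ _)), ENNReal.toReal_mul]
  exact key _ _ _ _ _ _ ENNReal.toReal_nonneg (le1 _ _) ENNReal.toReal_nonneg (le1 _ _) _
    ENNReal.toReal_nonneg (total p) (total q) (hh true) (hh false)

theorem uniform_bind_equiv [Fintype A] [Nonempty A] [Fintype B] [Nonempty B] (e : A ≃ B)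
    (f : B → PMF C) :
    ((PMF.uniformOfFintype A).bind fun a => f (e a)) = (PMF.uniformOfFintype B).bind f := by
  ext c
  simp only [PMF.bind_apply, PMF.uniformOfFintype_apply, Fintype.card_congr e]
  exact e.tsum_eq (fun b => (Fintype.card B : ℝ≥0∞)⁻¹ * f b c)

theorem uniform_prod_bind [Fintype A] [Nonempty A] [Fintype B] [Nonempty B]
    (f : A × B → PMF C) :
    (PMF.uniformOfFintype (A × B)).bind f =
      (PMF.uniformOfFintype A).bind fun a => (PMF.uniformOfFintype B).bind fun b => f (a, b) := by
  ext c
  simp only [PMF.bind_apply, PMF.uniformOfFintype_apply, Fintype.card_prod, Nat.cast_mul]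
  rw [ENNReal.tsum_prod' (f := fun x : A × B => _ * f x c)]
  refine tsum_congr fun a => ?_
  rw [ENNReal.tsum_mul_left, ENNReal.tsum_mul_left, ← mul_assoc,
    ENNReal.mul_inv (Or.inr (ENNReal.natCast_ne_top _)) (Or.inl (ENNReal.natCast_ne_top _))]

/-- Resampling one value of a uniform function leaves it uniform. -/
theorem uniform_fun_resample [Fintype A] [DecidableEq A] [Fintype B] [Nonempty B] (q : A)
    (f : (A → B) → PMF C) :
    ((PMF.uniformOfFintype (A → B)).bind fun h => (PMF.uniformOfFintype B).bind fun v =>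
      f (Function.update h q v)) = (PMF.uniformOfFintype (A → B)).bind f := by
  let e := (Equiv.funSplitAt q B).symm
  rw [← uniform_bind_equiv e, ← uniform_bind_equiv e, uniform_prod_bind, uniform_prod_bind]
  have : ∀ (v w : B) (r : {j // j ≠ q} → B), Function.update (e (v, r)) q w = e (w, r) := by
    intro v w r
    ext j
    by_cases h : j = q
    · subst h; simp [e, Equiv.funSplitAt, Equiv.piSplitAt]
    · simp [e, Equiv.funSplitAt, Equiv.piSplitAt, h]
  simp only [this, PMF.bind_const]
  exact PMF.bind_comm _ _ _

/-- A uniform vector is a uniform entry followed by a uniform shorter vector. -/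
theorem uniform_bits_succ (k : ℕ) (f : Bits (k + 1) → PMF C) :
    (PMF.uniformOfFintype (Bits (k + 1))).bind f =
      (PMF.uniformOfFintype Bool).bind fun b => (PMF.uniformOfFintype (Bits k)).bind fun x =>
        f (Fin.cons b x) := by
  rw [← uniform_bind_equiv (Fin.consEquiv fun _ : Fin (k + 1) => Bool), uniform_prod_bind]
  rfl

theorem PMF.map_true_apply (p : PMF A) (f : A → Bool) :
    (p.map f) true = ∑' a, p a * if f a then 1 else 0 := by
  rw [PMF.map_apply]
  refine tsum_congr fun a => ?_
  cases f a <;> simp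

/-- The event that `f` holds of a sample is monotone in the event. -/
theorem PMF.map_true_mono (p : PMF A) {f g : A → Bool} (h : ∀ a, f a = true → g a = true) :
    (p.map f) true ≤ (p.map g) true := by
  refine p.bind_true_mono fun a => ?_
  cases hf : f a
  · simp [hf]
  · simp [hf, h a hf]

end PMFTools

/-! ### Polynomial bounds and negligible functions -/

section Growth

theorem PolyBounded.mono {f g : ℕ → ℕ} (hg : PolyBounded g) (h : ∀ n, f n ≤ g n) :
    PolyBounded f := by
  obtain ⟨P, hP⟩ := hg
  exact ⟨P, fun n => (h n).trans (hP n)⟩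

theorem PolyBounded.const (c : ℕ) : PolyBounded fun _ => c := ⟨Polynomial.C c, by simp⟩

theorem PolyBounded.id : PolyBounded fun n => n := ⟨Polynomial.X, by simp⟩

theorem PolyBounded.add {f g : ℕ → ℕ} (hf : PolyBounded f) (hg : PolyBounded g) :
    PolyBounded fun n => f n + g n := by
  obtain ⟨P, hP⟩ := hf
  obtain ⟨Q, hQ⟩ := hg
  exact ⟨P + Q, fun n => by simpa using add_le_add (hP n) (hQ n)⟩

theorem PolyBounded.mul {f g : ℕ → ℕ} (hf : PolyBounded f) (hg : PolyBounded g) :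
    PolyBounded fun n => f n * g n := by
  obtain ⟨P, hP⟩ := hf
  obtain ⟨Q, hQ⟩ := hg
  exact ⟨P * Q, fun n => by simpa using Nat.mul_le_mul (hP n) (hQ n)⟩

theorem Negligible.add {μ ν : ℕ → ℝ} (h : Negligible μ) (h' : Negligible ν) :
    Negligible fun n => μ n + ν n :=
  Asymptotics.SuperpolynomialDecay.add h h'

theorem Negligible.zero : Negligible fun _ => 0 :=
  Asymptotics.superpolynomialDecay_zero _ _

theorem Negligible.of_abs_le {μ ν : ℕ → ℝ} (h : Negligible ν) (hle : ∀ n, |μ n| ≤ |ν n|) :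
    Negligible μ :=
  Asymptotics.SuperpolynomialDecay.trans_abs_le h hle

theorem Negligible.polyBounded_mul {μ : ℕ → ℝ} {q : ℕ → ℕ} (hq : PolyBounded q)
    (h : Negligible μ) : Negligible fun n => q n * μ n := by
  obtain ⟨P, hP⟩ := hq
  have h1 : Negligible fun n => ((P.map (Nat.castRingHom ℝ)).eval (n : ℝ)) * μ n :=
    Asymptotics.SuperpolynomialDecay.polynomial_mul h _
  refine h1.of_abs_le fun n => ?_
  have e : (P.map (Nat.castRingHom ℝ)).eval (n : ℝ) = ((P.eval n : ℕ) : ℝ) := by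
    rw [Polynomial.eval_map, Polynomial.eval₂_at_natCast]; simp
  rw [abs_mul, abs_mul, e, Nat.abs_cast, Nat.abs_cast]
  exact mul_le_mul_of_nonneg_right (by exact_mod_cast hP n) (abs_nonneg _)

theorem Negligible.two_pow_inv : Negligible fun n => ((2 : ℝ) ^ n)⁻¹ := by
  intro k
  have := tendsto_pow_const_div_const_pow_of_one_lt k (r := (2 : ℝ)) (by norm_num)
  simpa [div_eq_mul_inv] using this

end Growth

/-! ### Building circuits -/

namespace Circ

variable {S : OracleSig} {α β γ δ : Type}

/-- An oracle-free circuit, seen as a circuit that may use oracle gates. -/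
def lift : {α β : Type} → Circ plainSig α β → Circ S α β
  | _, _, wire f => wire f
  | _, _, const b => const b
  | _, _, nand => nand
  | _, _, coin => coin
  | _, _, unif k => unif k
  | _, _, query q => Empty.elim q
  | _, _, seq c d => seq c.lift d.lift
  | _, _, par c d => par c.lift d.lift

@[simp]
theorem size_lift (c : Circ plainSig α β) : (c.lift : Circ S α β).size = c.size := by
  induction c with
  | query q => exact Empty.elim q
  | seq c d hc hd => simp [lift, size, hc, hd]
  | par c d hc hd => simp [lift, size, hc, hd]
  | _ => rfl

@[simp]
theorem eval_lift (O : S.Oracle) (c : Circ plainSig α β) (x : α → Bool) :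
    (c.lift : Circ S α β).eval O x = c.eval noOracle x := by
  induction c with
  | query q => exact Empty.elim q
  | seq c d hc hd => simp [lift, eval, hc, hd]
  | par c d hc hd => simp [lift, eval, hc, hd]
  | _ => rfl

/-- Selection of the output wires of a program. -/
def ret (f : β → α) : Circ S α β := wire f

/-- Running `c` on selected wires. -/
def on (f : β → α) (c : Circ S β γ) : Circ S α γ := seq (wire f) c

/-- Sequential composition in which the second circuit sees the input of the first one and its
output. Iterating it gives straight-line programs: the wires of a circuit are a context, to which
each step appends the wires of a new variable. -/
def bnd (c : Circ S α β) (d : Circ S (α ⊕ β) γ) : Circ S α γ :=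
  seq (seq (wire (Sum.elim id id)) (par (wire id) c)) d

@[simp]
theorem eval_ret (O : S.Oracle) (f : β → α) (x : α → Bool) :
    (ret f : Circ S α β).eval O x = PMF.pure (x ∘ f) := rfl

@[simp]
theorem size_ret (f : β → α) : (ret f : Circ S α β).size = 0 := rfl

@[simp]
theorem eval_on (O : S.Oracle) (f : β → α) (c : Circ S β γ) (x : α → Bool) :
    (on f c).eval O x = c.eval O (x ∘ f) := by
  simp [on, eval, Function.comp_def]

@[simp]
theorem size_on (f : β → α) (c : Circ S β γ) : (on f c).size = c.size := by
  simp [on, size]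

@[simp]
theorem eval_bnd (O : S.Oracle) (c : Circ S α β) (d : Circ S (α ⊕ β) γ) (x : α → Bool) :
    (bnd c d).eval O x = (c.eval O x).bind fun y => d.eval O (x ⧺ y) := by
  simp [bnd, eval, PMF.map_eq_bind]

@[simp]
theorem size_bnd (c : Circ S α β) (d : Circ S (α ⊕ β) γ) :
    (bnd c d).size = c.size + d.size := by
  simp [bnd, size]

theorem elim_comp_inl_comp (x : α → Bool) (y : β → Bool) (f : γ → α) :
    (x ⧺ y) ∘ Sum.inl ∘ f = x ∘ f := rfl

theorem elim_comp_inr_comp (x : α → Bool) (y : β → Bool) (f : γ → β) :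
    (x ⧺ y) ∘ Sum.inr ∘ f = y ∘ f := rfl

/-- A constant bit. -/
def bitC (b : Bool) : Circ S α Unit := on Empty.elim (const b)

@[simp]
theorem eval_bitC (O : S.Oracle) (b : Bool) (x : α → Bool) :
    (bitC b : Circ S α Unit).eval O x = PMF.pure fun _ => b := by
  simp [bitC, eval]

@[simp]
theorem size_bitC (b : Bool) : (bitC b : Circ S α Unit).size = 1 := by simp [bitC, size]

/-- A fair coin. -/
def coinC : Circ S α Unit := on Empty.elim coin

@[simp]
theorem eval_coinC (O : S.Oracle) (x : α → Bool) :
    (coinC : Circ S α Unit).eval O x = (PMF.uniformOfFintype Bool).map fun b _ => b := by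
  simp [coinC, eval]

@[simp]
theorem size_coinC : (coinC : Circ S α Unit).size = 1 := by simp [coinC, size]

/-- The NAND of two wires. Names that end in `C` denote circuits in an arbitrary context. -/
def nandC (i j : α) : Circ S α Unit := on (Sum.elim (fun _ => i) fun _ => j) nand

@[simp]
theorem eval_nandC (O : S.Oracle) (i j : α) (x : α → Bool) :
    (nandC i j : Circ S α Unit).eval O x = PMF.pure fun _ => !(x i && x j) := by
  simp [nandC, eval]

@[simp]
theorem size_nandC (i j : α) : (nandC i j : Circ S α Unit).size = 1 := by simp [nandC, size]

/-- The conjunction of two wires. -/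
def andC (i j : α) : Circ S α Unit := bnd (nandC i j) (nandC (Sum.inr ()) (Sum.inr ()))

@[simp]
theorem eval_andC (O : S.Oracle) (i j : α) (x : α → Bool) :
    (andC i j : Circ S α Unit).eval O x = PMF.pure fun _ => x i && x j := by
  simp [andC]

@[simp]
theorem size_andC (i j : α) : (andC i j : Circ S α Unit).size = 2 := by simp [andC]

/-- The exclusive or of two wires. -/
def xorC (i j : α) : Circ S α Unit :=
  bnd (nandC i j) <| bnd (nandC (Sum.inl i) (Sum.inr ())) <|
    bnd (nandC (Sum.inl (Sum.inl j)) (Sum.inl (Sum.inr ()))) <|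
      nandC (Sum.inl (Sum.inr ())) (Sum.inr ())

@[simp]
theorem eval_xorC (O : S.Oracle) (i j : α) (x : α → Bool) :
    (xorC i j : Circ S α Unit).eval O x = PMF.pure fun _ => xor (x i) (x j) := by
  simp only [xorC, eval_bnd, eval_nandC, PMF.pure_bind, Sum.elim_inl, Sum.elim_inr]
  congr 1; funext _; cases x i <;> cases x j <;> rfl

@[simp]
theorem size_xorC (i j : α) : (xorC i j : Circ S α Unit).size = 4 := by simp [xorC]

/-- The wire `i` if the wire `b` is set, and the wire `j` otherwise. -/
def muxC (b i j : α) : Circ S α Unit :=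
  bnd (nandC b i) <| bnd (nandC (Sum.inl b) (Sum.inl b)) <|
    bnd (nandC (Sum.inr ()) (Sum.inl (Sum.inl j))) <|
      nandC (Sum.inl (Sum.inl (Sum.inr ()))) (Sum.inr ())

@[simp]
theorem eval_muxC (O : S.Oracle) (b i j : α) (x : α → Bool) :
    (muxC b i j : Circ S α Unit).eval O x = PMF.pure fun _ => if x b then x i else x j := by
  simp only [muxC, eval_bnd, eval_nandC, PMF.pure_bind, Sum.elim_inl, Sum.elim_inr]
  congr 1; funext _; cases x i <;> cases x j <;> cases x b <;> rfl

@[simp]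
theorem size_muxC (b i j : α) : (muxC b i j : Circ S α Unit).size = 4 := by simp [muxC]

/-- Putting together one-bit circuits that share their input. -/
def tab : (k : ℕ) → (Fin k → Circ S α Unit) → Circ S α (Fin k)
  | 0, _ => ret Fin.elim0
  | k + 1, c => bnd (c 0) <| bnd (on Sum.inl (tab k fun i => c i.succ)) <|
      ret (Fin.cons (Sum.inl (Sum.inr ())) Sum.inr : Fin (k + 1) → (α ⊕ Unit) ⊕ Fin k)

theorem size_tab_eq (k : ℕ) (c : Fin k → Circ S α Unit) (s : ℕ) (h : ∀ i, (c i).size = s) :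
    (tab k c).size = k * s := by
  induction k with
  | zero => simp [tab]
  | succ k ih =>
    simp only [tab, size_bnd, size_on, size_ret, h 0, ih (fun i => c i.succ) fun i => h _]
    ring

theorem eval_tab (O : S.Oracle) (x : α → Bool) (k : ℕ) (c : Fin k → Circ S α Unit) (f : Bits k)
    (h : ∀ i, (c i).eval O x = PMF.pure fun _ => f i) :
    (tab k c).eval O x = PMF.pure f := by
  induction k with
  | zero => simp only [tab, eval_ret]; congr 1; exact Subsingleton.elim _ _
  | succ k ih =>
    simp only [tab, eval_bnd, eval_on, eval_ret, h, PMF.pure_bind, Sum.elim_comp_inl]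
    rw [ih (fun i => c i.succ) (fun i => f i.succ) fun i => h _, PMF.pure_bind]
    congr 1; funext i
    refine Fin.cases ?_ (fun i => ?_) i <;> simp

/-- Uniform bits. -/
def coinsC (k : ℕ) : Circ S α (Fin k) := tab k fun _ => coinC

@[simp]
theorem eval_coinsC (O : S.Oracle) (x : α → Bool) (k : ℕ) :
    (coinsC k : Circ S α (Fin k)).eval O x = PMF.uniformOfFintype (Bits k) := by
  induction k with
  | zero =>
    have h : PMF.uniformOfFintype (Bits 0) = PMF.pure Fin.elim0 := by
      rw [← PMF.bind_const (PMF.uniformOfFintype (Bits 0)) (PMF.pure Fin.elim0),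
        ← PMF.bind_pure (PMF.uniformOfFintype (Bits 0)), PMF.bind_bind]
      refine PMF.bind_congr' _ fun a => ?_
      rw [PMF.pure_bind]; congr 1; exact Subsingleton.elim _ _
    rw [h]
    simp only [coinsC, tab, eval_ret]; congr 1; exact Subsingleton.elim _ _
  | succ k ih =>
    rw [← PMF.bind_pure (PMF.uniformOfFintype (Bits (k + 1))), uniform_bits_succ]
    have ih' : (tab k fun _ => coinC : Circ S α (Fin k)).eval O x = _ := ih
    simp only [coinsC, tab, eval_bnd, eval_on, eval_ret, eval_coinC, PMF.bind_map_apply, ih',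
      Sum.elim_comp_inl]
    refine PMF.bind_congr' _ fun b => PMF.bind_congr' _ fun y => ?_
    congr 1; funext i
    refine Fin.cases ?_ (fun i => ?_) i <;> simp

@[simp]
theorem size_coinsC (k : ℕ) : (coinsC k : Circ S α (Fin k)).size = k :=
  (size_tab_eq k _ 1 fun _ => by simp).trans (mul_one k)

/-- A constant bit string. -/
def constC {k : ℕ} (v : Bits k) : Circ S α (Fin k) := tab k fun i => bitC (v i)

@[simp]
theorem eval_constC (O : S.Oracle) {k : ℕ} (v : Bits k) (x : α → Bool) :
    (constC v : Circ S α (Fin k)).eval O x = PMF.pure v :=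
  eval_tab _ _ _ _ _ fun i => by simp

@[simp]
theorem size_constC {k : ℕ} (v : Bits k) : (constC v : Circ S α (Fin k)).size = k :=
  (size_tab_eq k _ 1 fun _ => by simp).trans (mul_one k)

/-- Bitwise exclusive or. -/
def xorVecC {k : ℕ} (f g : Fin k → α) : Circ S α (Fin k) := tab k fun i => xorC (f i) (g i)

@[simp]
theorem eval_xorVecC (O : S.Oracle) {k : ℕ} (f g : Fin k → α) (x : α → Bool) :
    (xorVecC f g : Circ S α (Fin k)).eval O x = PMF.pure (DUQOT.xorBits (x ∘ f) (x ∘ g)) :=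
  eval_tab _ _ _ _ _ fun i => by simp [DUQOT.xorBits]

@[simp]
theorem size_xorVecC {k : ℕ} (f g : Fin k → α) :
    (xorVecC f g : Circ S α (Fin k)).size = k * 4 :=
  size_tab_eq k _ 4 fun _ => by simp

/-- Selection between two bit strings. -/
def muxVecC {k : ℕ} (b : α) (f g : Fin k → α) : Circ S α (Fin k) :=
  tab k fun i => muxC b (f i) (g i)

@[simp]
theorem eval_muxVecC (O : S.Oracle) {k : ℕ} (b : α) (f g : Fin k → α) (x : α → Bool) :
    (muxVecC b f g : Circ S α (Fin k)).eval O x =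
      PMF.pure (if x b then x ∘ f else x ∘ g) :=
  eval_tab _ _ _ _ _ fun i => by cases h : x b <;> simp [h]

@[simp]
theorem size_muxVecC {k : ℕ} (b : α) (f g : Fin k → α) :
    (muxVecC b f g : Circ S α (Fin k)).size = k * 4 :=
  size_tab_eq k _ 4 fun _ => by simp

/-- Equality of two bit strings. -/
def eqVecC : {k : ℕ} → (Fin k → α) → (Fin k → α) → Circ S α Unit
  | 0, _, _ => bitC true
  | _ + 1, f, g => bnd (xorC (f 0) (g 0)) <| bnd (nandC (Sum.inr ()) (Sum.inr ())) <|
      bnd (on (Sum.inl ∘ Sum.inl) (eqVecC (fun i => f i.succ) fun i => g i.succ)) <|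
        andC (Sum.inl (Sum.inr ())) (Sum.inr ())

@[simp]
theorem eval_eqVecC (O : S.Oracle) {k : ℕ} (f g : Fin k → α) (x : α → Bool) :
    (eqVecC f g : Circ S α Unit).eval O x = PMF.pure fun _ => decide (x ∘ f = x ∘ g) := by
  induction k with
  | zero => simp [eqVecC, Subsingleton.elim (x ∘ f) (x ∘ g)]
  | succ k ih =>
    have e : ((x ⧺ (fun _ : Unit => xor (x (f 0)) (x (g 0)))) ⧺
        (fun _ : Unit => !(xor (x (f 0)) (x (g 0)) && xor (x (f 0)) (x (g 0))))) ∘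
          Sum.inl ∘ Sum.inl = x := rfl
    simp only [eqVecC, eval_bnd, eval_xorC, eval_nandC, eval_on, eval_andC, PMF.pure_bind,
      Sum.elim_inl, Sum.elim_inr, e, ih]
    congr 1; funext _
    rw [Bool.eq_iff_iff]
    simp only [Bool.and_self, Bool.and_eq_true, Bool.not_eq_true', decide_eq_true_eq,
      funext_iff, Fin.forall_fin_succ, Function.comp, bne_eq_false_iff_eq]

@[simp]
theorem size_eqVecC {k : ℕ} (f g : Fin k → α) :
    (eqVecC f g : Circ S α Unit).size = k * 7 + 1 := by
  induction k with
  | zero => simp [eqVecC]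
  | succ k ih => simp [eqVecC, ih]; ring

end Circ

/-! ### Binary representations of exponents -/

section Binary

theorem ofBits_natBits {k x : ℕ} (h : x < 2 ^ k) : Nat.ofBits (natBits k x) = x := by
  unfold natBits
  rw [Nat.ofBits_testBit, Nat.mod_eq_of_lt h]

theorem natBits_injOn {k x y : ℕ} (hx : x < 2 ^ k) (hy : y < 2 ^ k)
    (h : natBits k x = natBits k y) : x = y := by
  rw [← ofBits_natBits hx, h, ofBits_natBits hy]

theorem natBits_comp_succ (k x : ℕ) : natBits (k + 1) x ∘ Fin.succ = natBits k (x / 2) := by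
  funext i
  simp [natBits, Nat.testBit_add_one]

theorem natBits_succ_zero (k x : ℕ) : natBits (k + 1) x 0 = decide (x % 2 = 1) := by
  simp [natBits]

theorem uniformBelow_natBits {k p : ℕ} [NeZero p] (h : p < 2 ^ k) :
    uniformBelow k (natBits k p) =
      (PMF.uniformOfFintype (ZMod p)).map fun a => natBits k a.val := by
  have key : ∀ N : ℕ, N = p → ∀ hN : N ≠ 0, (haveI : NeZero N := ⟨hN⟩
      (PMF.uniformOfFintype (Fin N)).map fun i => natBits k i) =
      (PMF.uniformOfFintype (ZMod p)).map fun a => natBits k a.val := by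
    intro N hNp hN
    subst hNp
    let e : Fin N ≃ ZMod N :=
      { toFun := fun i => ((i : ℕ) : ZMod N)
        invFun := fun a => ⟨a.val, ZMod.val_lt a⟩
        left_inv := fun i => Fin.ext (ZMod.val_cast_of_lt i.2)
        right_inv := fun a => ZMod.natCast_zmod_val a }
    simp only [PMF.map_eq_bind, pmf_bind_def, pmf_pure_def, PMF.bind_bind, PMF.pure_bind]
    rw [← uniform_bind_equiv e]
    refine PMF.bind_congr' _ fun i => ?_
    change _ = PMF.pure (natBits k ((i : ℕ) : ZMod N).val)
    rw [ZMod.val_cast_of_lt i.2]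
  have h1 := ofBits_natBits h
  unfold uniformBelow
  rw [dif_neg (by rw [h1]; exact NeZero.ne p)]
  exact key _ h1 (by rw [h1]; exact NeZero.ne p)

end Binary

/-! ### Exponentiation in the group -/

namespace GroupGen

open Circ

variable (𝒢 : GroupGen) {n : ℕ} {ω : Bits (𝒢.seedLen n)}

variable {𝒢} in
theorem pow_natCast (x : 𝒢.Carrier n ω) (k : ℕ) : 𝒢.pow x (k : 𝒢.Exp n ω) = x ^ k := by
  unfold pow
  rw [ZMod.val_natCast, ← 𝒢.card_eq n ω, pow_mod_natCard]

variable {𝒢} in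
theorem pow_add (x : 𝒢.Carrier n ω) (a b : 𝒢.Exp n ω) :
    𝒢.pow x (a + b) = 𝒢.pow x a * 𝒢.pow x b := by
  rw [← ZMod.natCast_zmod_val a, ← ZMod.natCast_zmod_val b, ← Nat.cast_add]
  simp only [pow_natCast, _root_.pow_add]

variable {𝒢} in
theorem pow_mul (x : 𝒢.Carrier n ω) (a b : 𝒢.Exp n ω) :
    𝒢.pow x (a * b) = 𝒢.pow (𝒢.pow x a) b := by
  rw [← ZMod.natCast_zmod_val a, ← ZMod.natCast_zmod_val b, ← Nat.cast_mul]
  simp only [pow_natCast, _root_.pow_mul]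

variable {𝒢} in
theorem pow_zero (x : 𝒢.Carrier n ω) : 𝒢.pow x 0 = 1 := by
  simpa using pow_natCast x 0

variable {𝒢} in
theorem pow_neg (x : 𝒢.Carrier n ω) (a : 𝒢.Exp n ω) : 𝒢.pow x (-a) = (𝒢.pow x a)⁻¹ := by
  rw [eq_inv_iff_mul_eq_one, ← pow_add, neg_add_cancel, pow_zero]

variable {𝒢} in
theorem pow_sub (x : 𝒢.Carrier n ω) (a b : 𝒢.Exp n ω) :
    𝒢.pow x (a - b) = 𝒢.pow x a / 𝒢.pow x b := by
  rw [sub_eq_add_neg, pow_add, pow_neg, div_eq_mul_inv]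

variable {𝒢} in
theorem pow_gen_injective : Function.Injective (𝒢.pow (𝒢.gen n ω)) := by
  have ho : orderOf (𝒢.gen n ω) = 𝒢.order n ω := by
    rw [← 𝒢.card_eq n ω]
    exact orderOf_eq_card_of_forall_mem_zpowers (𝒢.gen_generates n ω)
  intro a b h
  apply ZMod.val_injective
  exact pow_injOn_Iio_orderOf (by simpa [ho] using ZMod.val_lt a)
    (by simpa [ho] using ZMod.val_lt b) h

theorem encExp_injective : Function.Injective (𝒢.encExp (n := n) (ω := ω)) := by
  intro a b h
  exact ZMod.val_injective _ (natBits_injOn ((ZMod.val_lt a).trans (𝒢.order_lt n ω))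
    ((ZMod.val_lt b).trans (𝒢.order_lt n ω)) h)

/-! ### Circuits for the group operations -/

section GroupCircuits

variable {S : OracleSig} (O : S.Oracle)

variable (S n) in
/-- Group parameters from the seed. Names that end in `A` denote circuits for the algorithms of the
group and of the protocol. -/
def setupA : Circ S (Fin (𝒢.seedLen n)) (𝒢.ParamWires n) := (𝒢.genAlg.circ n).lift

@[simp]
theorem eval_setupA (ω : Bits (𝒢.seedLen n)) :
    (𝒢.setupA n S).eval O ω = PMF.pure (𝒢.params n ω) := by
  simpa [setupA, PPT.run, params] using 𝒢.genAlg_spec n ω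

variable (S n) in
/-- A uniform exponent. -/
def expA : Circ S (𝒢.ParamWires n) (Fin (𝒢.expLen n)) :=
  on (Sum.inr ∘ Sum.inl) (unif (𝒢.expLen n))

@[simp]
theorem eval_expA :
    (𝒢.expA n S).eval O (𝒢.params n ω) = (PMF.uniformOfFintype (𝒢.Exp n ω)).map 𝒢.encExp := by
  have h : 𝒢.params n ω ∘ Sum.inr ∘ Sum.inl = natBits (𝒢.expLen n) (𝒢.order n ω) := rfl
  rw [expA, eval_on, h]
  exact uniformBelow_natBits (𝒢.order_lt n ω)

variable (S n) in
/-- Multiplication. -/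
def mulA : Circ S (𝒢.ParamWires n ⊕ Fin (𝒢.eltLen n) ⊕ Fin (𝒢.eltLen n)) (Fin (𝒢.eltLen n)) :=
  (𝒢.mulAlg.circ n).lift

@[simp]
theorem eval_mulA (x y : 𝒢.Carrier n ω) :
    (𝒢.mulA n S).eval O (𝒢.params n ω ⧺ 𝒢.enc n ω x ⧺ 𝒢.enc n ω y) =
      PMF.pure (𝒢.enc n ω (x * y)) := by
  simpa [mulA, PPT.run, params] using 𝒢.mulAlg_spec n ω x y

variable (S n) in
/-- Inversion. -/
def invA : Circ S (𝒢.ParamWires n ⊕ Fin (𝒢.eltLen n)) (Fin (𝒢.eltLen n)) :=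
  (𝒢.invAlg.circ n).lift

@[simp]
theorem eval_invA (x : 𝒢.Carrier n ω) :
    (𝒢.invA n S).eval O (𝒢.params n ω ⧺ 𝒢.enc n ω x) = PMF.pure (𝒢.enc n ω x⁻¹) := by
  simpa [invA, PPT.run, params] using 𝒢.invAlg_spec n ω x

variable (S n) in
/-- Division. -/
def divA : Circ S (𝒢.ParamWires n ⊕ Fin (𝒢.eltLen n) ⊕ Fin (𝒢.eltLen n)) (Fin (𝒢.eltLen n)) :=
  bnd (on (Sum.inl ⧺ Sum.inr ∘ Sum.inr) (𝒢.invA n S)) <|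
    on (Sum.inl ∘ Sum.inl ⧺ Sum.inl ∘ Sum.inr ∘ Sum.inl ⧺ Sum.inr) (𝒢.mulA n S)

@[simp]
theorem eval_divA (x y : 𝒢.Carrier n ω) :
    (𝒢.divA n S).eval O (𝒢.params n ω ⧺ 𝒢.enc n ω x ⧺ 𝒢.enc n ω y) =
      PMF.pure (𝒢.enc n ω (x / y)) := by
  simp [divA, Sum.comp_elim, elim_comp_inl_comp, elim_comp_inr_comp, div_eq_mul_inv]

variable (S n) in
/-- The generator. -/
def genA : Circ S (𝒢.ParamWires n) (Fin (𝒢.eltLen n)) := ret (Sum.inr ∘ Sum.inr)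

@[simp]
theorem eval_genA :
    (𝒢.genA n S).eval O (𝒢.params n ω) = PMF.pure (𝒢.enc n ω (𝒢.gen n ω)) := rfl

variable (S n) in
/-- The identity of the group. -/
def oneA : Circ S (𝒢.ParamWires n) (Fin (𝒢.eltLen n)) :=
  bnd (𝒢.genA n S) <| on (Sum.inl ⧺ Sum.inr ⧺ Sum.inr) (𝒢.divA n S)

@[simp]
theorem eval_oneA :
    (𝒢.oneA n S).eval O (𝒢.params n ω) = PMF.pure (𝒢.enc n ω 1) := by
  simp [oneA, Sum.comp_elim]

variable (S n) in
/-- Square-and-multiply for a `k`-bit exponent; the inputs are the group parameters, the base, the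
identity and the exponent. -/
def powRecA : (k : ℕ) →
    Circ S (𝒢.ParamWires n ⊕ Fin (𝒢.eltLen n) ⊕ Fin (𝒢.eltLen n) ⊕ Fin k) (Fin (𝒢.eltLen n))
  | 0 => ret (Sum.inr ∘ Sum.inr ∘ Sum.inl)
  | k + 1 =>
      bnd (on (Sum.inl ⧺ Sum.inr ∘ Sum.inl ⧺ Sum.inr ∘ Sum.inr ∘ Sum.inl ⧺
        Sum.inr ∘ Sum.inr ∘ Sum.inr ∘ Fin.succ) (powRecA k)) <|
      bnd (on (Sum.inl ∘ Sum.inl ⧺ Sum.inr ⧺ Sum.inr) (𝒢.mulA n S)) <|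
      bnd (muxVecC (Sum.inl (Sum.inl (Sum.inr (Sum.inr (Sum.inr 0)))))
        (Sum.inl ∘ Sum.inl ∘ Sum.inr ∘ Sum.inl)
        (Sum.inl ∘ Sum.inl ∘ Sum.inr ∘ Sum.inr ∘ Sum.inl)) <|
      on (Sum.inl ∘ Sum.inl ∘ Sum.inl ∘ Sum.inl ⧺ Sum.inl ∘ Sum.inr ⧺ Sum.inr) (𝒢.mulA n S)

theorem eval_powRecA (x : 𝒢.Carrier n ω) (k e : ℕ) (he : e < 2 ^ k) :
    (𝒢.powRecA n S k).eval O (𝒢.params n ω ⧺ 𝒢.enc n ω x ⧺ 𝒢.enc n ω 1 ⧺ natBits k e) =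
      PMF.pure (𝒢.enc n ω (x ^ e)) := by
  induction k generalizing e with
  | zero =>
    obtain rfl : e = 0 := by simpa using he
    simp [powRecA, elim_comp_inr_comp]
  | succ k ih =>
    have h2 : e / 2 < 2 ^ k := by rw [_root_.pow_succ] at he; omega
    simp only [powRecA, eval_bnd, eval_on, Sum.comp_elim, elim_comp_inl_comp, elim_comp_inr_comp,
      Sum.elim_comp_inl, Sum.elim_comp_inr, natBits_comp_succ, ih _ h2, PMF.pure_bind, eval_mulA,
      eval_muxVecC, Sum.elim_inl, Sum.elim_inr, natBits_succ_zero]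
    rcases Nat.mod_two_eq_zero_or_one e with h | h
    · simp only [h, zero_ne_one, decide_false, Bool.false_eq_true, if_false, eval_mulA]
      rw [mul_one, ← _root_.pow_add]
      congr 3; omega
    · simp only [h, decide_true, if_true, eval_mulA]
      rw [← _root_.pow_add, ← _root_.pow_succ]
      congr 3; omega

variable (S n) in
/-- Exponentiation. -/
def powA : Circ S (𝒢.ParamWires n ⊕ Fin (𝒢.eltLen n) ⊕ Fin (𝒢.expLen n)) (Fin (𝒢.eltLen n)) :=
  bnd (on Sum.inl (𝒢.oneA n S)) <|
    on (Sum.inl ∘ Sum.inl ⧺ Sum.inl ∘ Sum.inr ∘ Sum.inl ⧺ Sum.inr ⧺ Sum.inl ∘ Sum.inr ∘ Sum.inr)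
      (𝒢.powRecA n S (𝒢.expLen n))

@[simp]
theorem eval_powA (x : 𝒢.Carrier n ω) (a : 𝒢.Exp n ω) :
    (𝒢.powA n S).eval O (𝒢.params n ω ⧺ 𝒢.enc n ω x ⧺ 𝒢.encExp a) =
      PMF.pure (𝒢.enc n ω (𝒢.pow x a)) := by
  have := 𝒢.eval_powRecA O x _ a.val ((ZMod.val_lt a).trans (𝒢.order_lt n ω))
  simp only [powA, eval_bnd, eval_on, Sum.comp_elim, elim_comp_inl_comp, elim_comp_inr_comp,
      Sum.elim_comp_inl, Sum.elim_comp_inr, PMF.pure_bind, eval_oneA]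
  exact this

variable (S n) in
/-- Powers of the generator. -/
def gpowA : Circ S (𝒢.ParamWires n ⊕ Fin (𝒢.expLen n)) (Fin (𝒢.eltLen n)) :=
  bnd (on Sum.inl (𝒢.genA n S)) <|
    on (Sum.inl ∘ Sum.inl ⧺ Sum.inr ⧺ Sum.inl ∘ Sum.inr) (𝒢.powA n S)

@[simp]
theorem eval_gpowA (a : 𝒢.Exp n ω) :
    (𝒢.gpowA n S).eval O (𝒢.params n ω ⧺ 𝒢.encExp a) =
      PMF.pure (𝒢.enc n ω (𝒢.pow (𝒢.gen n ω) a)) := by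
  simp [gpowA, Sum.comp_elim, elim_comp_inl_comp]

/-! ### Polynomial size of the group circuits -/

variable (S : ℕ → OracleSig)

theorem poly_setupA : PolyBounded fun n => (𝒢.setupA n (S n)).size := by
  simpa [setupA] using 𝒢.genAlg.poly

theorem poly_expA : PolyBounded fun n => (𝒢.expA n (S n)).size := by
  simpa [expA, size] using 𝒢.expLen_poly.add (.const 1)

theorem poly_mulA : PolyBounded fun n => (𝒢.mulA n (S n)).size := by
  simpa [mulA] using 𝒢.mulAlg.poly

theorem poly_divA : PolyBounded fun n => (𝒢.divA n (S n)).size := by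
  simpa [divA, invA] using 𝒢.invAlg.poly.add (𝒢.poly_mulA S)

theorem poly_powA : PolyBounded fun n => (𝒢.powA n (S n)).size := by
  have h : ∀ n k, (𝒢.powRecA n (S n) k).size ≤
      k * ((𝒢.mulA n (S n)).size + 𝒢.eltLen n * 4 + (𝒢.mulA n (S n)).size) := by
    intro n k
    induction k with
    | zero => simp [powRecA]
    | succ k ih =>
      simp only [powRecA, size_bnd, size_on, size_muxVecC]
      rw [Nat.add_mul]
      omega
  have h1 := (𝒢.poly_divA S).add (𝒢.expLen_poly.mul
    (((𝒢.poly_mulA S).add (𝒢.eltLen_poly.mul (.const 4))).add (𝒢.poly_mulA S)))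
  refine h1.mono fun n => ?_
  simpa [powA, oneA, genA] using h n _

theorem poly_gpowA : PolyBounded fun n => (𝒢.gpowA n (S n)).size := by
  simpa [gpowA, genA] using 𝒢.poly_powA S

end GroupCircuits

end GroupGen

/-! ### The random oracle on short strings -/

section RandomOracle

open scoped ENNReal

variable {L K : ℕ}

/-- The bit strings of length at most `K`. -/
noncomputable def shortStrings (K : ℕ) : Finset (List Bool) :=
  (List.finite_length_le Bool K).toFinset

theorem mem_shortStrings {l : List Bool} : l ∈ shortStrings K ↔ l.length ≤ K := by
  simp [shortStrings]

/-- Extension of a function on short strings by zero. -/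
noncomputable def extendShort (h : shortStrings K → Bits L) : List Bool → Bits L := fun l =>
  if hl : l ∈ shortStrings K then h ⟨l, hl⟩ else fun _ => false

/-- A random oracle on strings of length at most `K`, extended by zero; a finitely supported
substitute for `roMeasure` in experiments that make short queries only. -/
noncomputable def shortOracle (K L : ℕ) : PMF (List Bool → Bits L) :=
  (PMF.uniformOfFintype (shortStrings K → Bits L)).map extendShort

theorem shortOracle_resample {A : Type} {q : List Bool} (hq : q.length ≤ K)
    (f : (List Bool → Bits L) → PMF A) :
    ((shortOracle K L).bind fun h => (PMF.uniformOfFintype (Bits L)).bind fun v =>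
      f (Function.update h q v)) = (shortOracle K L).bind f := by
  have hm : q ∈ shortStrings K := mem_shortStrings.2 hq
  have e : ∀ (h : shortStrings K → Bits L) v,
      Function.update (extendShort h) q v = extendShort (Function.update h ⟨q, hm⟩ v) := by
    intro h v
    funext l
    by_cases hl : l = q
    · subst hl; simp [extendShort, hm]
    · by_cases hl' : l ∈ shortStrings K
      · simp [extendShort, hl, hl']
      · simp [extendShort, hl, hl']
  simp only [shortOracle, PMF.bind_map_apply, e]
  exact uniform_fun_resample (⟨q, hm⟩ : shortStrings K) fun h => f (extendShort h)

/-- Probabilities of experiments that depend on the values of the oracle at short strings only. -/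
theorem roProb_eq (E : (List Bool → Bits L) → PMF Bool)
    (hE : ∀ H H' : List Bool → Bits L, (∀ l : List Bool, l.length ≤ K → H l = H' l) →
      E H = E H') :
    roProb E = (((shortOracle K L).bind E) true).toReal := by
  unfold roProb
  congr 1
  -- The restriction of the product measure to finitely many coordinates is the uniform measure.
  let g : (shortStrings K → Bits L) → ℝ≥0∞ := fun h => E (extendShort h) true
  have h1 : ∀ H : List Bool → Bits L, E H true = g ((shortStrings K).restrict H) := by
    intro H
    simp only [g]
    rw [hE H (extendShort ((shortStrings K).restrict H))]
    intro l hl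
    simp [extendShort, mem_shortStrings.2 hl]
  have hg : Measurable g := measurable_of_finite g
  have h2 : ∫⁻ H, g ((shortStrings K).restrict H) ∂(roMeasure L) =
      ∫⁻ h, g h ∂((roMeasure L).map (shortStrings K).restrict) :=
    (lintegral_map hg (Finset.measurable_restrict _)).symm
  simp only [h1]
  rw [h2, roMeasure, Measure.infinitePi_map_restrict, lintegral_fintype, shortOracle,
    PMF.bind_map_apply, PMF.bind_apply, tsum_fintype]
  refine Finset.sum_congr rfl fun h _ => ?_
  rw [mul_comm, Measure.pi_singleton]
  congr 1
  simp only [PMF.toMeasure_apply_singleton _ _ (MeasurableSet.singleton _),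
    PMF.uniformOfFintype_apply, Finset.prod_const, Finset.card_univ, Fintype.card_fun,
    Nat.cast_pow, ENNReal.inv_pow]

end RandomOracle

/-! ### Logged and lazily sampled evaluation -/

namespace Circ

variable {L : ℕ} {α β γ : Type}

theorem query_length_le {K k : ℕ} (h : (query (S := roSig L) k).size ≤ K) :
    k ≤ K := by
  have : k + L + 1 ≤ K := h
  omega

/-- A log of oracle queries with their answers, the latest first. -/
abbrev Table (L : ℕ) : Type := List (List Bool × Bits L)

/-- Answering and logging a query. -/
noncomputable def answer (ans : Table L → List Bool → PMF (Bits L)) {k : ℕ} (x : Bits k)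
    (T : Table L) : PMF (Bits L × Table L) :=
  (ans T (List.ofFn x)).map fun v => (v, (List.ofFn x, v) :: T)

/-- Evaluation of an oracle circuit with a log of the queries and answers. Queries are answered by
`ans`, which may consult the log. -/
noncomputable def exec (ans : Table L → List Bool → PMF (Bits L)) :
    {α β : Type} → Circ (roSig L) α β → (α → Bool) → Table L → PMF ((β → Bool) × Table L)
  | _, _, wire f, x, T => PMF.pure (fun i => x (f i), T)
  | _, _, const b, _, T => PMF.pure (fun _ => b, T)
  | _, _, nand, x, T => PMF.pure (fun _ => !(x (Sum.inl ()) && x (Sum.inr ())), T)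
  | _, _, coin, _, T => (PMF.uniformOfFintype Bool).map fun b => (fun _ => b, T)
  | _, _, unif k, x, T => (uniformBelow k x).map fun y => (y, T)
  | _, _, query _, x, T => answer ans x T
  | _, _, seq c d, x, T => (exec ans c x T).bind fun r => exec ans d r.1 r.2
  | _, _, par c d, x, T =>
      (exec ans c (fun i => x (Sum.inl i)) T).bind fun r =>
        (exec ans d (fun i => x (Sum.inr i)) r.2).map fun r' => (r.1 ⧺ r'.1, r'.2)

/-- Answers given by a fixed function. -/
noncomputable def honest (H : List Bool → Bits L) : Table L → List Bool → PMF (Bits L) :=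
  fun _ q => PMF.pure (H q)

/-- Lazy sampling: repeated queries are answered consistently, new ones by fresh uniform values. -/
noncomputable def lazily : Table L → List Bool → PMF (Bits L) := fun T q =>
  match T.lookup q with
  | some v => PMF.pure v
  | none => PMF.uniformOfFintype (Bits L)

theorem map_fst_exec_honest (H : List Bool → Bits L) (c : Circ (roSig L) α β) (x : α → Bool)
    (T : Table L) : (exec (honest H) c x T).map Prod.fst = c.eval (roOracle H) x := by
  induction c generalizing T with
  | seq c d hc hd =>
    simp only [exec, eval, PMF.map_bind, hd, ← hc x T, PMF.bind_map_apply]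
  | par c d hc hd =>
    simp only [exec, eval, PMF.map_bind, ← hc _ T, PMF.bind_map_apply, PMF.map_comp]
    refine PMF.bind_congr' _ fun r => ?_
    rw [← hd _ r.2, PMF.map_comp]; rfl
  | query q =>
    have e : ∀ {k : ℕ} (x : Bits k), (answer (honest H) x T).map Prod.fst =
        PMF.pure (H (List.ofFn x)) := fun x => by simp [answer, honest, PMF.pure_map]
    exact e _
  | unif k => simp only [exec, eval, PMF.map_comp]; exact PMF.map_id _
  | coin => simp only [exec, eval, PMF.map_comp]; rfl
  | _ => simp only [exec, eval, PMF.pure_map]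

/-- A circuit cannot see the oracle outside the strings it is large enough to query. -/
theorem eval_congr {K : ℕ} {H H' : List Bool → Bits L}
    (h : ∀ l : List Bool, l.length ≤ K → H l = H' l) (c : Circ (roSig L) α β)
    (hc : c.size ≤ K) (x : α → Bool) : c.eval (roOracle H) x = c.eval (roOracle H') x := by
  induction c with
  | seq c d ihc ihd =>
    simp only [size] at hc
    simp only [eval, ihc (by omega), ihd (by omega)]
  | par c d ihc ihd =>
    simp only [size] at hc
    simp only [eval, ihc (by omega), ihd (by omega)]
  | query q =>
    simp only [eval, roOracle]
    rw [h _ (by rw [List.length_ofFn]; exact query_length_le hc)]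
  | _ => rfl

/-! ### Identical until bad -/

/-- The string `z` was queried. -/
def Queried (z : List Bool) (T : Table L) : Prop := z ∈ T.map Prod.fst

open Classical in
/-- Forgetting the outcome of an execution in which `z` was queried. -/
noncomputable def hide (z : List Bool) {A : Type} (r : A × Table L) : Option (A × Table L) :=
  if Queried z r.2 then none else some r

theorem hide_exec_of_queried (z : List Bool) (ans : Table L → List Bool → PMF (Bits L))
    (c : Circ (roSig L) α β) (x : α → Bool) (T : Table L) (hT : Queried z T) :
    (exec ans c x T).map (hide z) = PMF.pure none := by
  have bind_none : ∀ {A B : Type} (p : PMF (A × Table L)) (f : A × Table L → PMF (Option B)),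
      p.map (hide z) = PMF.pure none → (∀ r, Queried z r.2 → f r = PMF.pure none) →
      p.bind f = PMF.pure none := by
    intro A B p f hp hf
    have : ∀ r, f r = (fun o : Option (A × Table L) => o.elim (PMF.pure none) f) (hide z r) := by
      intro r
      by_cases hr : Queried z r.2
      · simp [hide, hr, hf r hr]
      · simp [hide, hr]
    rw [PMF.bind_congr' _ this, ← PMF.bind_map_apply p (hide z)
      (fun o : Option (A × Table L) => o.elim (PMF.pure none) f), hp, PMF.pure_bind]
    rfl
  induction c generalizing T with
  | seq c d hc hd =>
    simp only [exec, PMF.map_bind]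
    exact bind_none _ _ (hc x T hT) fun r hr => hd _ _ hr
  | par c d hc hd =>
    simp only [exec, PMF.map_bind]
    refine bind_none _ _ (hc _ T hT) fun r hr => ?_
    rw [PMF.map_comp]
    refine bind_none _ _ (hd _ _ hr) fun r' hr' => ?_
    simp [hide, hr']
  | query q =>
    have e : ∀ {k : ℕ} (x : Bits k), (answer ans x T).map (hide z) = PMF.pure none := by
      intro k x
      have : ∀ v : Bits L, Queried z ((List.ofFn x, v) :: T) := fun v => List.mem_cons_of_mem _ hT
      simp only [answer, PMF.map_comp, Function.comp_def, hide, this, if_true]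
      exact PMF.bind_const _ _
    exact e _
  | unif k =>
    simp only [exec, PMF.map_comp, Function.comp_def, hide, hT, if_true]
    exact PMF.bind_const _ _
  | coin =>
    simp only [exec, PMF.map_comp, Function.comp_def, hide, hT, if_true]
    exact PMF.bind_const _ _
  | _ => simp only [exec, PMF.pure_map, hide, hT, if_true]

/-- Executions with oracles that differ at `z` only agree as long as `z` is not queried. -/
theorem hide_exec_congr {z : List Bool} {H H' : List Bool → Bits L}
    (h : ∀ l, l ≠ z → H l = H' l) (c : Circ (roSig L) α β) (x : α → Bool) (T : Table L) :
    (exec (honest H) c x T).map (hide z) = (exec (honest H') c x T).map (hide z) := by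
  have bind_hide : ∀ {A B : Type} (p p' : PMF (A × Table L)) (f f' : A × Table L → PMF (Option B)),
      p.map (hide z) = p'.map (hide z) → (∀ r, f r = f' r) →
      (∀ r, Queried z r.2 → f r = PMF.pure none) → p.bind f = p'.bind f' := by
    intro A B p p' f f' hp hff hf
    have : ∀ r, f r = (fun o : Option (A × Table L) => o.elim (PMF.pure none) f) (hide z r) := by
      intro r
      by_cases hr : Queried z r.2
      · simp [hide, hr, hf r hr]
      · simp [hide, hr]
    have e : ∀ p : PMF (A × Table L), p.bind f =
        (p.map (hide z)).bind fun o : Option (A × Table L) => o.elim (PMF.pure none) f :=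
      fun p => by rw [PMF.bind_map_apply, PMF.bind_congr' _ this]
    rw [← PMF.bind_congr' _ hff, e p, e p', hp]
  induction c generalizing T with
  | seq c d hc hd =>
    simp only [exec, PMF.map_bind]
    exact bind_hide _ _ _ _ (hc x T) (fun r => hd _ _) fun r hr => hide_exec_of_queried _ _ _ _ _ hr
  | par c d hc hd =>
    simp only [exec, PMF.map_bind]
    have hq : ∀ {A B : Type} (y : A) (r' : B × Table L), Queried z r'.2 →
        (PMF.pure (hide z (y, r'.2)) : PMF (Option (A × Table L))) = PMF.pure none := by
      intro A B y r' hr'; simp [hide, hr']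
    refine bind_hide _ _ _ _ (hc _ T) (fun r => ?_) fun r hr => ?_
    · simp only [PMF.map_comp]
      exact bind_hide _ _ _ _ (hd _ _) (fun r => rfl) fun r' hr' => hq _ r' hr'
    · have e := hide_exec_of_queried z (honest H) d (fun i => x (Sum.inr i)) r.2 hr
      rw [PMF.map_comp]
      have e2 := bind_hide _ (PMF.pure ((fun _ => false), r.2))
        (fun r' => PMF.pure (hide z (r.1 ⧺ r'.1, r'.2)))
        (fun r' => PMF.pure (hide z (r.1 ⧺ r'.1, r'.2)))
        (e.trans (by simp [PMF.pure_map, hide, hr])) (fun _ => rfl) fun r' hr' => hq _ r' hr'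
      refine Eq.trans e2 ?_
      rw [PMF.pure_bind]; exact hq _ (r.1, r.2) hr
  | query q =>
    have e : ∀ {k : ℕ} (x : Bits k), (answer (honest H) x T).map (hide z) =
        (answer (honest H') x T).map (hide z) := by
      intro k x
      simp only [answer, honest, PMF.pure_map]
      by_cases hz : List.ofFn x = z
      · have : ∀ v : Bits L, Queried z ((List.ofFn x, v) :: T) := fun v => by simp [Queried, hz]
        simp only [hide, this, if_true]
      · rw [h _ hz]
    exact e _
  | _ => rfl

open Classical in
/-- The probability that `z` is queried, as an experiment. -/
noncomputable def queryExp (z : List Bool) (ans : Table L → List Bool → PMF (Bits L))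
    (c : Circ (roSig L) α β) (x : α → Bool) : PMF Bool :=
  (exec ans c x []).map fun r => decide (Queried z r.2)

/-- The bit computed by a circuit with a single output wire. -/
noncomputable def decision (O : (roSig L).Oracle) (c : Circ (roSig L) α Unit) (x : α → Bool) :
    PMF Bool :=
  (c.eval O x).map fun b => b ()

theorem queryExp_congr {z : List Bool} {H H' : List Bool → Bits L}
    (h : ∀ l, l ≠ z → H l = H' l) (c : Circ (roSig L) α β) (x : α → Bool) :
    queryExp z (honest H) c x = queryExp z (honest H') c x := by
  classical
  have e : ∀ H : List Bool → Bits L, queryExp z (honest H) c x =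
      ((exec (honest H) c x []).map (hide z)).map fun o => o.isNone := by
    intro H
    rw [queryExp, PMF.map_comp]
    congr 1; funext r
    by_cases hr : Queried z r.2 <;> simp [hide, hr]
  rw [e, e, hide_exec_congr h]

/-- Reprogramming the oracle at `z` changes the outcome of a circuit by at most the probability
that it queries `z`. -/
theorem decision_le_of_eq_off {z : List Bool} {H H' : List Bool → Bits L}
    (h : ∀ l, l ≠ z → H l = H' l) (c : Circ (roSig L) α Unit) (x : α → Bool) :
    decision (roOracle H) c x true ≤
      decision (roOracle H') c x true + queryExp z (honest H) c x true := by
  classical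
  have e : ∀ H : List Bool → Bits L, decision (roOracle H) c x =
      (exec (honest H) c x []).map fun r => r.1 () := by
    intro H
    rw [decision, ← map_fst_exec_honest H c x [], PMF.map_comp]; rfl
  -- The event that the circuit accepts without having queried `z`.
  let good : Option ((Unit → Bool) × Table L) → Bool := fun o => o.elim false fun r => r.1 ()
  have h1 : decision (roOracle H) c x true ≤
      ((exec (honest H) c x []).map (good ∘ hide z)) true + queryExp z (honest H) c x true := by
    rw [e]
    refine PMF.bind_true_le _ fun r => ?_
    by_cases hr : Queried z r.2
    · have : (PMF.pure (decide (Queried z r.2)) : PMF Bool) true = 1 := by simp [hr]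
      simp only [Function.comp]
      rw [this]
      exact (PMF.coe_le_one _ _).trans le_add_self
    · simp [good, hide, hr]
  have h2 : ((exec (honest H') c x []).map (good ∘ hide z)) true ≤
      decision (roOracle H') c x true := by
    rw [e]
    refine PMF.map_true_mono _ fun r => ?_
    by_cases hr : Queried z r.2 <;> simp [good, hide, hr]
  rw [← PMF.map_comp, hide_exec_congr h, PMF.map_comp] at h1
  exact h1.trans (by gcongr)

/-! ### Lazy sampling -/

/-- The function `h` overwritten by the entries of a table. -/
def fill (T : Table L) (h : List Bool → Bits L) : List Bool → Bits L := fun q =>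
  (T.lookup q).getD (h q)

theorem fill_nil (h : List Bool → Bits L) : fill [] h = h := rfl

theorem fill_cons_of_some {T : Table L} {q : List Bool} {v : Bits L} (hq : T.lookup q = some v)
    (h : List Bool → Bits L) : fill ((q, v) :: T) h = fill T h := by
  funext l
  by_cases hl : l = q
  · subst hl; simp [fill, hq]
  · have : (l == q) = false := by simpa using hl
    simp [fill, List.lookup_cons, this]

theorem fill_update_of_none {T : Table L} {q : List Bool} (hq : T.lookup q = none) (v : Bits L)
    (h : List Bool → Bits L) : fill T (Function.update h q v) = fill ((q, v) :: T) h := by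
  funext l
  by_cases hl : l = q
  · subst hl; simp [fill, hq]
  · have : (l == q) = false := by simpa using hl
    simp [fill, List.lookup_cons, this, hl]

/-- Executing a circuit with a random oracle that is fixed on a table, and then going on with the
same oracle, amounts to lazy sampling, after which the oracle is random outside of the extended
table. -/
theorem exec_honest_eq_lazily {K : ℕ} {A : Type} (c : Circ (roSig L) α β) (hc : c.size ≤ K)
    (x : α → Bool) (T : Table L)
    (f : (β → Bool) × Table L → (List Bool → Bits L) → PMF A) :
    ((shortOracle K L).bind fun h => (exec (honest (fill T h)) c x T).bind fun r =>
        f r (fill T h)) =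
      (exec lazily c x T).bind fun r => (shortOracle K L).bind fun h => f r (fill r.2 h) := by
  induction c generalizing T with
  | seq c d ihc ihd =>
    simp only [size] at hc
    simp only [exec, PMF.bind_bind]
    rw [ihc (by omega) x T fun r H => (exec (honest H) d r.1 r.2).bind fun r' => f r' H]
    exact PMF.bind_congr' _ fun r => ihd (by omega) _ _ _
  | par c d ihc ihd =>
    simp only [size] at hc
    simp only [exec, PMF.bind_bind, PMF.bind_map_apply]
    rw [ihc (by omega) _ T fun r H =>
      (exec (honest H) d (fun i => x (Sum.inr i)) r.2).bind fun r' => f (r.1 ⧺ r'.1, r'.2) H]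
    exact PMF.bind_congr' _ fun r => ihd (by omega) _ _ fun r' H => f (r.1 ⧺ r'.1, r'.2) H
  | query q =>
    have e : ∀ {k : ℕ} (_ : k ≤ K) (x : Bits k)
        (f : Bits L × Table L → (List Bool → Bits L) → PMF A),
        ((shortOracle K L).bind fun h => (answer (honest (fill T h)) x T).bind fun r =>
          f r (fill T h)) =
        (answer lazily x T).bind fun r => (shortOracle K L).bind fun h => f r (fill r.2 h) := by
      intro k hk x f
      have hq : (List.ofFn x).length ≤ K := by rwa [List.length_ofFn]
      simp only [answer, honest, lazily, PMF.pure_map, PMF.pure_bind, PMF.bind_map_apply]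
      rcases hl : T.lookup (List.ofFn x) with _ | v
      · rw [← shortOracle_resample hq, PMF.bind_comm]
        refine PMF.bind_congr' _ fun v => PMF.bind_congr' _ fun h => ?_
        have : fill T (Function.update h (List.ofFn x) v) (List.ofFn x) = v := by
          simp [fill, hl]
        rw [this, fill_update_of_none hl]
      · rw [PMF.pure_bind]
        refine PMF.bind_congr' _ fun h => ?_
        have : fill T h (List.ofFn x) = v := by simp [fill, hl]
        simp only [this, fill_cons_of_some hl]
    exact e (query_length_le hc) _ _
  | unif k => simp only [exec, PMF.bind_map_apply]; exact PMF.bind_comm _ _ _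
  | coin => simp only [exec, PMF.bind_map_apply]; exact PMF.bind_comm _ _ _
  | _ => simp only [exec, PMF.pure_bind]

theorem queryExp_honest_eq_lazily {K : ℕ} (z : List Bool) (c : Circ (roSig L) α β)
    (hc : c.size ≤ K) (x : α → Bool) :
    ((shortOracle K L).bind fun h => queryExp z (honest h) c x) = queryExp z lazily c x := by
  classical
  have := exec_honest_eq_lazily c hc x [] fun r _ => PMF.pure (decide (Queried z r.2))
  simpa only [queryExp, PMF.map_eq_bind, PMF.bind_const, fill_nil] using this

end Circ

/-! ### Lazy sampling by an oracle-free circuit -/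

namespace Circ

variable {L : ℕ} {α β W W' : Type}

/-- The wires in a context `W` that hold an entry of a query log. -/
structure Slot (L : ℕ) (W : Type) where
  len : ℕ
  key : Fin len → W
  val : Fin L → W

/-- The same entry in another context. -/
def Slot.map (f : W → W') (s : Slot L W) : Slot L W' := ⟨s.len, f ∘ s.key, f ∘ s.val⟩

/-- The log held by a list of slots. -/
def readTable (slots : List (Slot L W)) (w : W → Bool) : Table L :=
  slots.map fun s => (List.ofFn (w ∘ s.key), w ∘ s.val)

theorem readTable_map (f : W → W') (slots : List (Slot L W)) (w : W' → Bool) :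
    readTable (slots.map (Slot.map f)) w = readTable slots (w ∘ f) := by
  simp [readTable, Slot.map, Function.comp_def]

/-- The circuit that looks up a key in a log, and returns fresh uniform bits if it is not there. -/
def lookupA {k : ℕ} (key : Fin k → W) : List (Slot L W) → Circ plainSig W (Fin L)
  | [] => coinsC L
  | s :: slots =>
    if h : k = s.len then
      bnd (lookupA key slots) <|
      bnd (on Sum.inl (eqVecC key (s.key ∘ Fin.cast h))) <|
      muxVecC (Sum.inr ()) (Sum.inl ∘ Sum.inl ∘ s.val) (Sum.inl ∘ Sum.inr)
    else lookupA key slots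

theorem eval_lookupA {k : ℕ} (key : Fin k → W) (slots : List (Slot L W)) (w : W → Bool) :
    (lookupA key slots).eval noOracle w =
      lazily (readTable slots w) (List.ofFn (w ∘ key)) := by
  induction slots with
  | nil => simp [lookupA, lazily, readTable]
  | cons s slots ih =>
    have hc : readTable (s :: slots) w =
      (List.ofFn (w ∘ s.key), w ∘ s.val) :: readTable slots w := rfl
    rw [hc]
    by_cases h : k = s.len
    · obtain ⟨len, skey, val⟩ := s
      obtain rfl : k = len := h
      simp only [lookupA, dif_pos, eval_bnd, eval_on, eval_eqVecC, eval_muxVecC, ih,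
        PMF.pure_bind, Sum.elim_comp_inl, Sum.elim_inr, elim_comp_inl_comp, Sum.elim_comp_inr,
        lazily, List.lookup_cons]
      by_cases hk : w ∘ key = w ∘ skey
      · simp only [Fin.cast_refl, Function.comp_id, hk, decide_true, if_true, PMF.bind_const,
          beq_self_eq_true]
      · have : (List.ofFn (w ∘ key) == List.ofFn (w ∘ skey)) = false := by
          simpa using fun h => hk (List.ofFn_injective h)
        simp only [Fin.cast_refl, Function.comp_id, hk, decide_false, Bool.false_eq_true, if_false,
          this]
        exact PMF.bind_pure _
    · have : (List.ofFn (w ∘ key) == List.ofFn (w ∘ s.key)) = false := by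
        simp only [beq_eq_false_iff_ne]
        intro he
        exact h (by simpa using congrArg List.length he)
      simp only [lookupA, dif_neg h, ih, lazily, List.lookup_cons, this]

/-- Only slots with keys of the right length are compared, so that a query costs no more than its
own size times the number of slots. -/
theorem size_lookupA_le {k : ℕ} (key : Fin k → W) (slots : List (Slot L W)) :
    (lookupA key slots).size ≤ L + slots.length * (7 * (k + L + 1)) := by
  induction slots with
  | nil => simp [lookupA]
  | cons s slots ih =>
    rw [List.length_cons, Nat.add_mul]
    by_cases h : k = s.len
    · simp only [lookupA, dif_pos h, size_bnd, size_on, size_eqVecC, size_muxVecC]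
      omega
    · simp only [lookupA, dif_neg h]
      omega

theorem elim_elim_comp_sumAssoc {Z₁ Z₂ : Type} (w : W → Bool) (y : Z₁ → Bool) (z : Z₂ → Bool) :
    (w ⧺ (y ⧺ z)) ∘ Equiv.sumAssoc W Z₁ Z₂ = (w ⧺ y) ⧺ z := by
  funext i
  rcases i with (i | i) | i <;> rfl

/-- An oracle circuit whose queries are answered by lazy sampling is computed by an oracle-free
circuit of polynomially related size. The circuit lives in a context `W` that holds the input and
the log of earlier queries; it produces further wires `Z`, among which the output and the new log
entries are found. -/
theorem exists_lazy_circuit (c : Circ (roSig L) α β) (N : ℕ) :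
    ∀ {W : Type} (a : α → W) (slots : List (Slot L W)), slots.length + c.size ≤ N →
    ∃ (Z : Type) (d : Circ plainSig W Z) (b : β → W ⊕ Z) (slots' : List (Slot L (W ⊕ Z))),
      slots'.length ≤ slots.length + c.size ∧ d.size ≤ c.size * (1 + 7 * N) ∧
      ∀ w : W → Bool, ((d.eval noOracle w).map fun z => ((w ⧺ z) ∘ b, readTable slots' (w ⧺ z))) =
        exec lazily c (w ∘ a) (readTable slots w) := by
  -- Slots survive an extension of the context.
  have keep : ∀ {W Z : Type} (slots : List (Slot L W)) (w : W → Bool) (z : Z → Bool),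
      readTable (slots.map (Slot.map Sum.inl)) (w ⧺ z) = readTable slots w :=
    fun slots w z => by rw [readTable_map, Sum.elim_comp_inl]
  induction c with
  | wire f =>
    intro W a slots _
    refine ⟨Empty, ret Empty.elim, Sum.inl ∘ a ∘ f, slots.map (Slot.map Sum.inl), by simp, by simp,
      fun w => ?_⟩
    simp only [eval_ret, PMF.pure_map, keep]; rfl
  | const b =>
    intro W a slots _
    refine ⟨Unit, bitC b, Sum.inr, slots.map (Slot.map Sum.inl), by simp, by simp [size],
      fun w => ?_⟩
    simp only [eval_bitC, PMF.pure_map, keep]; rfl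
  | nand =>
    intro W a slots _
    refine ⟨Unit, on a nand, Sum.inr, slots.map (Slot.map Sum.inl), by simp, by simp [size],
      fun w => ?_⟩
    simp only [eval_on, eval, PMF.pure_map, keep]; rfl
  | coin =>
    intro W a slots _
    refine ⟨Unit, coinC, Sum.inr, slots.map (Slot.map Sum.inl), by simp, by simp [size],
      fun w => ?_⟩
    simp only [eval_coinC, PMF.map_comp, keep, Function.comp_def]; rfl
  | unif k =>
    intro W a slots _
    refine ⟨Fin k, on a (unif k), Sum.inr, slots.map (Slot.map Sum.inl), by simp,
      by simp [size], fun w => ?_⟩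
    simp only [eval_on, keep]; rfl
  | query q =>
    have main : ∀ {k : ℕ} {W : Type} (a : Fin k → W) (slots : List (Slot L W)),
        slots.length + (k + L + 1) ≤ N →
        ∃ (Z : Type) (d : Circ plainSig W Z) (b : Fin L → W ⊕ Z) (slots' : List (Slot L (W ⊕ Z))),
          slots'.length ≤ slots.length + (k + L + 1) ∧ d.size ≤ (k + L + 1) * (1 + 7 * N) ∧
          ∀ w : W → Bool,
            ((d.eval noOracle w).map fun z => ((w ⧺ z) ∘ b, readTable slots' (w ⧺ z))) =
              answer lazily (w ∘ a) (readTable slots w) := by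
      intro k W a slots hN
      refine ⟨Fin L, lookupA a slots, Sum.inr,
        ⟨k, Sum.inl ∘ a, Sum.inr⟩ :: slots.map (Slot.map Sum.inl), ?_, ?_, fun w => ?_⟩
      · simp
      · refine (size_lookupA_le a slots).trans ?_
        have : slots.length * (7 * (k + L + 1)) ≤ N * (7 * (k + L + 1)) :=
          Nat.mul_le_mul_right _ (by omega)
        nlinarith
      · rw [eval_lookupA, answer]
        congr 1; funext z
        simp only [Sum.elim_comp_inr]
        congr 1
        change _ :: _ = _
        rw [← keep slots w z]; rfl
    intro W a slots hN
    exact main a slots hN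
  | seq c d ihc ihd =>
    intro W a slots hN
    simp only [size] at hN ⊢
    obtain ⟨Z₁, d₁, b₁, s₁, hl₁, hs₁, he₁⟩ := ihc a slots (by omega)
    obtain ⟨Z₂, d₂, b₂, s₂, hl₂, hs₂, he₂⟩ := ihd b₁ s₁ (by omega)
    let ρ := Equiv.sumAssoc W Z₁ Z₂
    refine ⟨Z₁ ⊕ Z₂, bnd d₁ (bnd d₂ (ret (Sum.inl ∘ Sum.inr ⧺ Sum.inr))), ρ ∘ b₂,
      s₂.map (Slot.map ρ), by rw [List.length_map]; omega, ?_, fun w => ?_⟩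
    · simp only [size_bnd, size_ret]; rw [Nat.add_mul]; omega
    · simp only [eval_bnd, eval_ret, exec, ← he₁ w, PMF.bind_map_apply, PMF.map_bind]
      refine PMF.bind_congr' _ fun y => ?_
      rw [← he₂ (w ⧺ y), PMF.map_eq_bind]
      refine PMF.bind_congr' _ fun z => ?_
      simp only [PMF.pure_map, Sum.comp_elim, Sum.elim_comp_inl, Sum.elim_comp_inr, readTable_map,
        ρ, elim_elim_comp_sumAssoc, ← Function.comp_assoc]
  | par c d ihc ihd =>
    intro W a slots hN
    simp only [size] at hN ⊢
    obtain ⟨Z₁, d₁, b₁, s₁, hl₁, hs₁, he₁⟩ := ihc (a ∘ Sum.inl) slots (by omega)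
    obtain ⟨Z₂, d₂, b₂, s₂, hl₂, hs₂, he₂⟩ := ihd (Sum.inl ∘ a ∘ Sum.inr) s₁ (by omega)
    let ρ := Equiv.sumAssoc W Z₁ Z₂
    refine ⟨Z₁ ⊕ Z₂, bnd d₁ (bnd d₂ (ret (Sum.inl ∘ Sum.inr ⧺ Sum.inr))),
      (ρ ∘ Sum.inl ∘ b₁) ⧺ (ρ ∘ b₂), s₂.map (Slot.map ρ), by rw [List.length_map]; omega, ?_,
      fun w => ?_⟩
    · simp only [size_bnd, size_ret]; rw [Nat.add_mul]; omega
    · have e₁ : exec lazily c (fun i => (w ∘ a) (Sum.inl i)) (readTable slots w) = _ :=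
        (he₁ w).symm
      simp only [eval_bnd, eval_ret, exec, e₁, PMF.bind_map_apply, PMF.map_bind]
      refine PMF.bind_congr' _ fun y => ?_
      have e₂ : exec lazily d (fun i => (w ∘ a) (Sum.inr i)) (readTable s₁ (w ⧺ y)) = _ :=
        (he₂ (w ⧺ y)).symm
      rw [e₂, PMF.map_comp, PMF.map_eq_bind]
      refine PMF.bind_congr' _ fun z => ?_
      simp only [PMF.pure_map, Sum.comp_elim, Sum.elim_comp_inl, Sum.elim_comp_inr, readTable_map,
        ρ, elim_elim_comp_sumAssoc, ← Function.comp_assoc, Function.comp_apply]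

end Circ

namespace DUQOT

open Circ

open scoped ENNReal

/- In a straight-line circuit, `vₖ` selects the wires of the variable bound `k` steps before the
most recent one. -/
local notation:max "v₀" => Sum.inr
local notation:max "v₁" => (Sum.inl ∘ v₀)
local notation:max "v₂" => (Sum.inl ∘ v₁)
local notation:max "v₃" => (Sum.inl ∘ v₂)
local notation:max "v₄" => (Sum.inl ∘ v₃)
local notation:max "v₅" => (Sum.inl ∘ v₄)
local notation:max "v₆" => (Sum.inl ∘ v₅)
local notation:max "v₇" => (Sum.inl ∘ v₆)
local notation:max "v₈" => (Sum.inl ∘ v₇)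
local notation:max "v₉" => (Sum.inl ∘ v₈)

-- This lemma introduces a composition of functions, and would compete with `PMF.bind_map_apply`.
attribute [-simp] PMF.bind_map

-- The rewriting rules that compute the wires selected in a context.
attribute [local simp] Sum.comp_elim Function.comp_assoc PMF.bind_map_apply elim_comp_inl_comp
  elim_comp_inr_comp

/-! ### Executions of the protocol -/

section OtherParties

variable {𝒢 : GroupGen} {n : ℕ}

/-- An affine substitution with slope `±1` in a uniform exponent. -/
theorem uniform_bind_affine {A : Type} {p : ℕ} [NeZero p] (c u : ZMod p) (hu : u * u = 1)
    {f g : ZMod p → PMF A} (h : ∀ r, g r = f (c + r * u)) :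
    (PMF.uniformOfFintype (ZMod p)).bind g = (PMF.uniformOfFintype (ZMod p)).bind f := by
  rw [funext h]
  let e : ZMod p ≃ ZMod p :=
    { toFun := fun r => c + r * u
      invFun := fun r => (r - c) * u
      left_inv := fun r => by
        change (c + r * u - c) * u = r
        linear_combination r * hu
      right_inv := fun r => by
        change c + (r - c) * u * u = r
        linear_combination (r - c) * hu }
  exact uniform_bind_equiv e f

theorem sign_mul_self {p : ℕ} (b : Bool) : ((-1 : ZMod p) ^ b.toNat) * (-1) ^ b.toNat = 1 := by
  cases b <;> simp

theorem uniform_bind_xor {A : Type} (s : Bool) (f : Bool → PMF A) :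
    ((PMF.uniformOfFintype Bool).bind fun b => f (xor b s)) =
      (PMF.uniformOfFintype Bool).bind f :=
  uniform_bind_equiv (⟨fun b => xor b s, fun b => xor b s, fun b => by simp, fun b => by simp⟩ :
    Bool ≃ Bool) f

/-- The receiver's decryption exponent. -/
def Coins.x (c : Coins 𝒢 n) (s : Bool) : 𝒢.Exp n c.seed :=
  c.r₂ + c.r₁ * (-1) ^ (c.s₂ s).toNat

/-- The receiver knows the discrete logarithm of `β_s`, and `β₀ * β₁ = C`. -/
theorem Coins.β_eq (c : Coins 𝒢 n) (s i : Bool) :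
    c.β s i = if i = s then 𝒢.pow c.g (c.x s) else c.C / 𝒢.pow c.g (c.x s) := by
  obtain ⟨seed, a, y, τ, r₁, r₂, s₁, r₃⟩ := c
  have p1 : ∀ r : 𝒢.Exp n seed, 𝒢.gen n seed ^ r.val = 𝒢.pow (𝒢.gen n seed) r := fun _ => rfl
  simp only [Coins.β, Coins.δ, Coins.x, Coins.s₂, genQuery₁, genQuery₂, Coins.g, Coins.C, p1]
  cases s₁ <;> cases s <;> cases i <;>
    simp [← sub_eq_add_neg, GroupGen.pow_sub, GroupGen.pow_add, div_eq_mul_inv, mul_comm,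
      mul_left_comm]

/-! The next lemmas are stated for coins given by their components, so that rewriting with them
leaves no trace of the coins that do not matter. -/

section Components

variable {seed : Bits (𝒢.seedLen n)} (a : 𝒢.Exp n seed) (y : Bool → 𝒢.Exp n seed)
  (τ : Equiv.Perm Bool) (r₁ r₂ : 𝒢.Exp n seed) (s₁ : Bool) (r₃ : Bits n) (s : Bool)

/-- The discrete logarithm of `δ₀` is an affine function of `r₂` with slope `±1`. -/
theorem δ_false_mk : (⟨seed, a, y, τ, r₁, r₂, s₁, r₃⟩ : Coins 𝒢 n).δ s false =
    𝒢.pow (𝒢.gen n seed) ((if xor s₁ s then a else 0) + r₂ * (-1) ^ (xor s₁ s).toNat) := by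
  have p1 : ∀ r : 𝒢.Exp n seed, 𝒢.gen n seed ^ r.val = 𝒢.pow (𝒢.gen n seed) r := fun _ => rfl
  simp only [Coins.δ, Coins.s₂, genQuery₂, Coins.g, Coins.C, p1]
  cases s₁ <;> cases s <;> simp [← sub_eq_add_neg, GroupGen.pow_sub]

theorem δ_true_mk : (⟨seed, a, y, τ, r₁, r₂, s₁, r₃⟩ : Coins 𝒢 n).δ s true =
    𝒢.pow (𝒢.gen n seed) a / 𝒢.pow (𝒢.gen n seed)
      ((if xor s₁ s then a else 0) + r₂ * (-1) ^ (xor s₁ s).toNat) := by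
  rw [← δ_false_mk a y τ r₁ r₂ s₁ r₃ s]
  simp only [Coins.δ, Coins.s₂, genQuery₂, Coins.g, Coins.C]
  cases s₁ <;> cases s <;> simp

/-- The discrete logarithm of `β₀` is an affine function of `r₁` with slope `±1`. -/
theorem β_false_mk : (⟨seed, a, y, τ, r₁, r₂, s₁, r₃⟩ : Coins 𝒢 n).β s false =
    𝒢.pow (𝒢.gen n seed) ((if s then a - r₂ else r₂) + r₁ * (-1) ^ s₁.toNat) := by
  simp only [Coins.β_eq, Coins.x, Coins.C, Coins.g, Coins.s₂, ← GroupGen.pow_sub]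
  cases s₁ <;> cases s <;> simp <;> congr 1 <;> ring

theorem β_true_mk : (⟨seed, a, y, τ, r₁, r₂, s₁, r₃⟩ : Coins 𝒢 n).β s true =
    𝒢.pow (𝒢.gen n seed) a / 𝒢.pow (𝒢.gen n seed)
      ((if s then a - r₂ else r₂) + r₁ * (-1) ^ s₁.toNat) := by
  rw [← β_false_mk a y τ r₁ r₂ s₁ r₃ s]
  simp only [Coins.β_eq]
  cases s <;> simp [Coins.C, Coins.g]

end Components

theorem sampleCoins_map {A : Type} (π : ℕ → PMF (Equiv.Perm Bool)) (f : Coins 𝒢 n → A) :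
    (sampleCoins 𝒢 π n).map f =
      (PMF.uniformOfFintype (Bits (𝒢.seedLen n))).bind fun seed =>
      (PMF.uniformOfFintype (𝒢.Exp n seed)).bind fun a =>
      (PMF.uniformOfFintype (𝒢.Exp n seed)).bind fun y₀ =>
      (PMF.uniformOfFintype (𝒢.Exp n seed)).bind fun y₁ =>
      (π n).bind fun τ =>
      (PMF.uniformOfFintype (𝒢.Exp n seed)).bind fun r₁ =>
      (PMF.uniformOfFintype (𝒢.Exp n seed)).bind fun r₂ =>
      (PMF.uniformOfFintype Bool).bind fun s₁ =>
      (PMF.uniformOfFintype (Bits n)).bind fun r₃ =>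
      PMF.pure (f ⟨seed, a, fun i => if i then y₁ else y₀, τ, r₁, r₂, s₁, r₃⟩) := by
  simp only [sampleCoins, pmf_bind_def, pmf_pure_def, PMF.map_bind, PMF.pure_map]

/-! ### A secure random permutation is nearly a fair coin -/

theorem _root_.SecurePermutation.exists_close {π : ℕ → PMF (Equiv.Perm Bool)}
    (hπ : SecurePermutation π) : ∃ μ : ℕ → ℝ, Negligible μ ∧ (∀ n, 0 ≤ μ n) ∧
      ∀ n b, ((π n).map fun τ => τ false) b ≤
          PMF.uniformOfFintype Bool b + ENNReal.ofReal (μ n) ∧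
        PMF.uniformOfFintype Bool b ≤
          ((π n).map fun τ => τ false) b + ENNReal.ofReal (μ n) := by
  obtain ⟨μ, hμ, h⟩ := hπ
  refine ⟨fun n => |μ n|, hμ.of_abs_le fun n => by simp, fun n => abs_nonneg _, fun n b => ?_⟩
  set t := (π n).map fun τ => τ false with ht
  have hu : PMF.uniformOfFintype Bool b = 2⁻¹ := by simp
  have h1 : ∀ b, t b ≤ 2⁻¹ + ENNReal.ofReal |μ n| := by
    intro b
    have h2 := (h n b false).trans (add_le_add_right (le_abs_self (μ n)) (1 / 2))
    rw [← ht] at h2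
    have h3 := ENNReal.ofReal_le_ofReal h2
    rw [ENNReal.ofReal_toReal (t.apply_ne_top b), ENNReal.ofReal_add (by norm_num) (abs_nonneg _)]
      at h3
    have : ENNReal.ofReal (1 / 2) = 2⁻¹ := by
      rw [one_div, ENNReal.ofReal_inv_of_pos (by norm_num)]; simp
    rwa [this] at h3
  rw [hu]
  refine ⟨h1 b, ?_⟩
  have h4 : t b + t (!b) = 1 := by
    cases b
    · rw [add_comm]; exact t.bool_sum
    · exact t.bool_sum
  -- A lower bound for the probability of `b` is an upper bound for that of `!b`.
  have h5 : (2⁻¹ : ℝ≥0∞) + 2⁻¹ ≤ (t b + ENNReal.ofReal |μ n|) + 2⁻¹ := by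
    rw [ENNReal.inv_two_add_inv_two, ← h4, add_assoc]
    gcongr
    rw [add_comm]
    exact h1 _
  exact (ENNReal.add_le_add_iff_right (by simp)).1 h5

theorem perm_bool_true (τ : Equiv.Perm Bool) : τ true = !τ false := by
  have h : τ true ≠ τ false := fun h => by simpa using τ.injective h
  cases h1 : τ true <;> cases h2 : τ false <;> simp_all

/-! ### Comparing experiments in the random-oracle model -/

/-- Experiments that are close for each oracle have close probabilities. -/
theorem roProb_abs_sub_le {L : ℕ} {E E' : (List Bool → Bits L) → PMF Bool} {ε : ℝ} (hε : 0 ≤ ε)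
    (h : ∀ H, E H true ≤ E' H true + ENNReal.ofReal ε)
    (h' : ∀ H, E' H true ≤ E H true + ENNReal.ofReal ε) :
    |roProb E - roProb E'| ≤ ε := by
  have : IsProbabilityMeasure (roMeasure L) := by unfold roMeasure; infer_instance
  have fin : ∀ E : (List Bool → Bits L) → PMF Bool, ∫⁻ H, E H true ∂(roMeasure L) ≠ ∞ := by
    intro E
    refine ne_top_of_le_ne_top ENNReal.one_ne_top ?_
    calc ∫⁻ H, E H true ∂(roMeasure L) ≤ ∫⁻ _, 1 ∂(roMeasure L) :=
          lintegral_mono fun H => PMF.coe_le_one _ _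
      _ = 1 := by simp
  have key : ∀ E E' : (List Bool → Bits L) → PMF Bool,
      (∀ H, E H true ≤ E' H true + ENNReal.ofReal ε) → roProb E ≤ roProb E' + ε := by
    intro E E' h
    have h1 : ∫⁻ H, E H true ∂(roMeasure L) ≤
        ∫⁻ H, E' H true ∂(roMeasure L) + ENNReal.ofReal ε := by
      calc _ ≤ ∫⁻ H, (E' H true + ENNReal.ofReal ε) ∂(roMeasure L) := lintegral_mono h
        _ = _ := by rw [lintegral_add_right _ measurable_const]; simp
    have h2 := ENNReal.toReal_mono (ENNReal.add_ne_top.2 ⟨fin E', ENNReal.ofReal_ne_top⟩) h1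
    rwa [ENNReal.toReal_add (fin E') ENNReal.ofReal_ne_top, ENNReal.toReal_ofReal hε] at h2
  rw [abs_sub_le_iff]
  exact ⟨by linarith [key E E' h], by linarith [key E' E h']⟩

/-! ### Simulators for the parties other than the receiver -/

section Simulators

variable (𝒢 n) {S : OracleSig} {α : Type}

/-- A fresh public key. -/
def pubA : Circ S α (PkWires 𝒢 n) :=
  bnd (coinsC (𝒢.seedLen n)) <|
  bnd (on v₀ (𝒢.setupA n S)) <|
  bnd (on v₀ (𝒢.expA n S)) <|
  bnd (on (v₁ ⧺ v₀) (𝒢.gpowA n S)) <|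
  ret (v₂ ⧺ v₀)

@[simp]
theorem eval_pubA (O : S.Oracle) (x : α → Bool) :
    (pubA 𝒢 n : Circ S α (PkWires 𝒢 n)).eval O x =
      (PMF.uniformOfFintype (Bits (𝒢.seedLen n))).bind fun ω =>
      (PMF.uniformOfFintype (𝒢.Exp n ω)).bind fun a =>
      PMF.pure (𝒢.params n ω ⧺ 𝒢.enc n ω (𝒢.pow (𝒢.gen n ω) a)) := by
  simp [pubA]

/-- A fresh view of `P₁`: the public key, `r₁`, the discrete logarithm of `δ₀`, and `s₁` are drawn
in this order. -/
def simP₁A : Circ S α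
    (PkWires 𝒢 n ⊕ Unit ⊕ Fin (𝒢.expLen n) ⊕ Fin (𝒢.eltLen n) ⊕ Fin (𝒢.eltLen n)) :=
  bnd (pubA 𝒢 n) <|
  bnd (on (v₀ ∘ Sum.inl) (𝒢.expA n S)) <|
  bnd (on (v₁ ∘ Sum.inl) (𝒢.expA n S)) <|
  bnd coinC <|
  bnd (on (v₃ ∘ Sum.inl ⧺ v₁) (𝒢.gpowA n S)) <|
  bnd (on (v₄ ∘ Sum.inl ⧺ v₄ ∘ Sum.inr ⧺ v₀) (𝒢.divA n S)) <|
  ret (v₅ ⧺ v₂ ⧺ v₄ ⧺ v₁ ⧺ v₀)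

/-- A fresh view of `P₂`. -/
def simP₂A : Circ S α (PkWires 𝒢 n ⊕ Unit ⊕ Fin (𝒢.expLen n)) :=
  bnd (pubA 𝒢 n) <|
  bnd (on (v₀ ∘ Sum.inl) (𝒢.expA n S)) <|
  bnd coinC <|
  ret (v₂ ⧺ v₀ ⧺ v₁)

/-- A fresh view of the query issuer. -/
def simTA : Circ S (Unit ⊕ Empty) (Unit ⊕ (Unit ⊕ Fin n) ⊕ PkWires 𝒢 n) :=
  bnd (pubA 𝒢 n) <|
  bnd coinC <|
  bnd (coinsC n) <|
  ret (Sum.inl ∘ Sum.inl ∘ Sum.inl ∘ Sum.inl ⧺ (v₁ ⧺ v₀) ⧺ v₂)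

/-- A fresh view of the sender with messages of `ℓ` bits: the seed, `a`, `y₀`, `y₁`, a coin in
place of the permutation, the discrete logarithm of `β₀` and the tag are drawn in this order. -/
def simSA (ℓ : ℕ) : Circ S ((Fin ℓ ⊕ Fin ℓ) ⊕ Empty)
    ((Fin ℓ ⊕ Fin ℓ) ⊕
      (Fin (𝒢.seedLen n) ⊕ Fin (𝒢.expLen n) ⊕ Fin (𝒢.expLen n) ⊕ Fin (𝒢.expLen n) ⊕ Unit) ⊕
      PkWires 𝒢 n ⊕ Fin n ⊕ Fin (𝒢.eltLen n) ⊕ Fin (𝒢.eltLen n)) :=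
  bnd (coinsC (𝒢.seedLen n)) <|
  bnd (on v₀ (𝒢.setupA n S)) <|
  bnd (on v₀ (𝒢.expA n S)) <|
  bnd (on v₁ (𝒢.expA n S)) <|
  bnd (on v₂ (𝒢.expA n S)) <|
  bnd coinC <|
  bnd (on v₄ (𝒢.expA n S)) <|
  bnd (coinsC n) <|
  bnd (on (v₆ ⧺ v₅) (𝒢.gpowA n S)) <|
  bnd (on (v₇ ⧺ v₂) (𝒢.gpowA n S)) <|
  bnd (on (v₈ ⧺ v₁ ⧺ v₀) (𝒢.divA n S)) <|
  ret (Sum.inl ∘ Sum.inl ∘ Sum.inl ∘ Sum.inl ∘ Sum.inl ∘ Sum.inl ∘ Sum.inl ∘ Sum.inl ∘ Sum.inl ∘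
      Sum.inl ∘ Sum.inl ∘ Sum.inl ⧺ (Sum.inl ∘ v₉ ⧺ v₈ ⧺ v₇ ⧺ v₆ ⧺ v₅) ⧺ (v₉ ⧺ v₂) ⧺
    v₃ ⧺ v₁ ⧺ v₀)

end Simulators

section PerfectViews

variable (𝒢 n) {S : OracleSig} {α : Type} {σ : ℕ → ℕ} (π : ℕ → PMF (Equiv.Perm Bool))
  (O : S.Oracle) (H : List Bool → Bits (σ n + n)) (m : Bool → Bits (σ n)) (s : Bool)

theorem eval_simP₂A (x : α → Bool) :
    (simP₂A 𝒢 n : Circ S α _).eval O x = (duqOT 𝒢 σ π).view n H m s .P₂ := by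
  change _ = (sampleCoins 𝒢 π n).map fun c => c.pk ⧺ bit (c.s₂ s) ⧺ 𝒢.encExp c.r₂
  simp only [sampleCoins_map, Coins.pk, Coins.C, Coins.g, Coins.s₂]
  simp [simP₂A]
  refine PMF.bind_congr' _ fun ω => PMF.bind_congr' _ fun a => PMF.bind_congr' _ fun r => ?_
  exact (uniform_bind_xor s _).symm

/-- The proxy `P₁` sees nothing but uniform values and the pair `g ^ b, C / g ^ b` for a uniform
`b`, whatever the index `s` is. -/
theorem eval_simP₁A (x : α → Bool) :
    (simP₁A 𝒢 n : Circ S α _).eval O x = (duqOT 𝒢 σ π).view n H m s .P₁ := by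
  change _ = (sampleCoins 𝒢 π n).map fun c => c.pk ⧺ bit c.s₁ ⧺ 𝒢.encExp c.r₁ ⧺
    𝒢.enc n c.seed (c.δ s false) ⧺ 𝒢.enc n c.seed (c.δ s true)
  simp only [sampleCoins_map, δ_true_mk, δ_false_mk, Coins.pk, Coins.C, Coins.g]
  simp [simP₁A]
  refine PMF.bind_congr' _ fun ω => PMF.bind_congr' _ fun a => PMF.bind_congr' _ fun r => ?_
  rw [PMF.bind_comm, PMF.bind_comm _ (PMF.uniformOfFintype Bool)]
  refine PMF.bind_congr' _ fun s₁ => ?_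
  exact (uniform_bind_affine _ _ (sign_mul_self (xor s₁ s)) fun _ => rfl).symm

theorem eval_simTA :
    (simTA 𝒢 n : Circ S _ _).eval O (partyInput m s .T ⧺ functionality m s .T) =
      (duqOT 𝒢 σ π).view n H m s .T := by
  change _ = (sampleCoins 𝒢 π n).map fun c => bit s ⧺ (bit c.s₁ ⧺ c.r₃) ⧺ c.pk
  simp only [sampleCoins_map, Coins.pk, Coins.C, Coins.g]
  simp [simTA]
  rfl

/-- The sender's view when the permutation is described by a bit of law `t`. -/
noncomputable def senderView (m : Bool → Bits (σ n)) (t : PMF Bool) :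
    PMF (ViewWires 𝒢 σ .S n → Bool) :=
  (PMF.uniformOfFintype (Bits (𝒢.seedLen n))).bind fun ω =>
  (PMF.uniformOfFintype (𝒢.Exp n ω)).bind fun a =>
  (PMF.uniformOfFintype (𝒢.Exp n ω)).bind fun y₀ =>
  (PMF.uniformOfFintype (𝒢.Exp n ω)).bind fun y₁ =>
  t.bind fun b =>
  (PMF.uniformOfFintype (𝒢.Exp n ω)).bind fun r =>
  (PMF.uniformOfFintype (Bits n)).bind fun r₃ =>
  PMF.pure ((m false ⧺ m true) ⧺
    (ω ⧺ 𝒢.encExp a ⧺ 𝒢.encExp y₀ ⧺ 𝒢.encExp y₁ ⧺ bit b) ⧺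
    (𝒢.params n ω ⧺ 𝒢.enc n ω (𝒢.pow (𝒢.gen n ω) a)) ⧺ r₃ ⧺
    𝒢.enc n ω (𝒢.pow (𝒢.gen n ω) r) ⧺
    𝒢.enc n ω (𝒢.pow (𝒢.gen n ω) a / 𝒢.pow (𝒢.gen n ω) r))

theorem eval_simSA :
    (simSA 𝒢 n (σ n) : Circ S _ _).eval O (partyInput m s .S ⧺ functionality m s .S) =
      senderView 𝒢 n m (PMF.uniformOfFintype Bool) := by
  simp [simSA, senderView]
  rfl

theorem view_S :
    (duqOT 𝒢 σ π).view n H m s .S = senderView 𝒢 n m ((π n).map fun τ => τ false) := by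
  change (sampleCoins 𝒢 π n).map (fun c => (m false ⧺ m true) ⧺
      (c.seed ⧺ 𝒢.encExp c.a ⧺ 𝒢.encExp (c.y false) ⧺ 𝒢.encExp (c.y true) ⧺ bit (c.τ false)) ⧺
      c.pk ⧺ c.r₃ ⧺ 𝒢.enc n c.seed (c.β s false) ⧺ 𝒢.enc n c.seed (c.β s true)) = _
  simp only [sampleCoins_map, β_true_mk, β_false_mk, Coins.pk, Coins.C, Coins.g,
    senderView, PMF.bind_map_apply, Bool.false_eq_true, if_false, if_true]
  refine PMF.bind_congr' _ fun ω => PMF.bind_congr' _ fun a => PMF.bind_congr' _ fun y₀ =>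
    PMF.bind_congr' _ fun y₁ => PMF.bind_congr' _ fun τ => ?_
  -- Whatever `r₂` and `s₁` are, the uniform `r₁` makes `β₀` uniform.
  rw [PMF.bind_comm]
  refine Eq.trans (PMF.bind_congr' _ fun r₂ => ?_) (PMF.bind_const (PMF.uniformOfFintype _) _)
  rw [PMF.bind_comm]
  refine Eq.trans (PMF.bind_congr' _ fun s₁ => ?_) (PMF.bind_const (PMF.uniformOfFintype Bool) _)
  exact uniform_bind_affine (if s then a - r₂ else r₂) _ (sign_mul_self s₁) fun _ => rfl

theorem senderView_bind_le {t u : PMF Bool} {ε : ℝ≥0∞} (h : ∀ b, t b ≤ u b + ε)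
    (D : (ViewWires 𝒢 σ .S n → Bool) → PMF Bool) :
    ((senderView 𝒢 n m t).bind D) true ≤ ((senderView 𝒢 n m u).bind D) true + ε := by
  simp only [senderView, PMF.bind_bind]
  exact PMF.bind_true_le_const _ fun ω => PMF.bind_true_le_const _ fun a =>
    PMF.bind_true_le_const _ fun y₀ => PMF.bind_true_le_const _ fun y₁ =>
      PMF.bool_bind_true_le _ _ h

end PerfectViews

/-! ### Polynomial size of the simulators -/

theorem poly_pubA (S : ℕ → OracleSig) (α : ℕ → Type) :
    PolyBounded fun n => (pubA 𝒢 n : Circ (S n) (α n) _).size := by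
  refine ((𝒢.seedLen_poly.add (𝒢.poly_setupA S)).add
    ((𝒢.poly_expA S).add (𝒢.poly_gpowA S))).mono fun n => ?_
  simp only [pubA, size_bnd, size_on, size_ret, size_coinsC]
  omega

theorem poly_simP₁A (S : ℕ → OracleSig) (α : ℕ → Type) :
    PolyBounded fun n => (simP₁A 𝒢 n : Circ (S n) (α n) _).size := by
  refine ((poly_pubA (𝒢 := 𝒢) S α).add (((𝒢.poly_expA S).add (𝒢.poly_expA S)).add
    ((PolyBounded.const 1).add ((𝒢.poly_gpowA S).add (𝒢.poly_divA S))))).mono fun n => ?_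
  simp only [simP₁A, size_bnd, size_on, size_ret, size_coinC]
  omega

theorem poly_simP₂A (S : ℕ → OracleSig) (α : ℕ → Type) :
    PolyBounded fun n => (simP₂A 𝒢 n : Circ (S n) (α n) _).size := by
  refine ((poly_pubA (𝒢 := 𝒢) S α).add ((𝒢.poly_expA S).add (.const 1))).mono fun n => ?_
  simp only [simP₂A, size_bnd, size_on, size_ret, size_coinC]
  omega

theorem poly_simTA (S : ℕ → OracleSig) :
    PolyBounded fun n => (simTA 𝒢 n : Circ (S n) _ _).size := by
  refine ((poly_pubA (𝒢 := 𝒢) S fun _ => Unit ⊕ Empty).add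
    ((PolyBounded.const 1).add .id)).mono fun n => ?_
  simp only [simTA, size_bnd, size_ret, size_coinC, size_coinsC]
  omega

theorem poly_simSA (S : ℕ → OracleSig) (σ : ℕ → ℕ) :
    PolyBounded fun n => (simSA 𝒢 n (σ n) : Circ (S n) _ _).size := by
  have he := 𝒢.poly_expA S
  have hg := 𝒢.poly_gpowA S
  refine (((𝒢.seedLen_poly.add .id).add ((𝒢.poly_setupA S).add (.const 1))).add
    ((((he.add he).add (he.add he)).add (hg.add hg)).add (𝒢.poly_divA S))).mono fun n => ?_
  simp only [simSA, size_bnd, size_on, size_ret, size_coinC, size_coinsC]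
  omega

/-! ### Security against the sender, the proxies and the query issuer -/

variable (𝒢)

/-- A circuit family that produces the view of a party exactly is a perfect simulator. -/
theorem exists_simulator_of_eq {σ : ℕ → ℕ} (π : ℕ → PMF (Equiv.Perm Bool)) (i : Party)
    (Sim : (duqOT 𝒢 σ π).Simulator i)
    (h : ∀ n H m s, (Sim.circ n).eval (roOracle H) (partyInput m s i ⧺ functionality m s i) =
      (duqOT 𝒢 σ π).view n H m s i) (D : (duqOT 𝒢 σ π).Distinguisher i) :
    ∃ μ, Negligible μ ∧ ∀ n m s,
      |(duqOT 𝒢 σ π).idealProb i Sim D n m s - (duqOT 𝒢 σ π).realProb i D n m s| ≤ μ n :=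
  ⟨_, Negligible.zero, fun n m s => by simp [Protocol.idealProb, Protocol.realProb, h]⟩

/-- The simulated view of the sender has a fair coin in place of the permutation, and is perfect
otherwise. -/
theorem simulator_S {σ : ℕ → ℕ} {π : ℕ → PMF (Equiv.Perm Bool)} (hπ : SecurePermutation π) :
    ∃ Sim : (duqOT 𝒢 σ π).Simulator .S, ∀ D : (duqOT 𝒢 σ π).Distinguisher .S,
      ∃ μ, Negligible μ ∧ ∀ n m s,
      |(duqOT 𝒢 σ π).idealProb .S Sim D n m s - (duqOT 𝒢 σ π).realProb .S D n m s| ≤ μ n := by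
  obtain ⟨μ, hμ, h0, h⟩ := hπ.exists_close
  refine ⟨⟨fun n => simSA 𝒢 n (σ n), poly_simSA _ σ⟩, fun D => ⟨μ, hμ, fun n m s => ?_⟩⟩
  refine roProb_abs_sub_le (h0 n) (fun H => ?_) fun H => ?_
  · have := senderView_bind_le 𝒢 n m (fun b => (h n b).2) fun v =>
      ((D.circ n).eval (roOracle H) v).bind fun b => PMF.pure (b ())
    rw [← eval_simSA 𝒢 n (roOracle H) m s, ← view_S 𝒢 n π H m s] at this
    exact this
  · have := senderView_bind_le 𝒢 n m (fun b => (h n b).1) fun v =>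
      ((D.circ n).eval (roOracle H) v).bind fun b => PMF.pure (b ())
    rw [← eval_simSA 𝒢 n (roOracle H) m s, ← view_S 𝒢 n π H m s] at this
    exact this

theorem simulator_P₁ {σ : ℕ → ℕ} (π : ℕ → PMF (Equiv.Perm Bool)) :
    ∃ Sim : (duqOT 𝒢 σ π).Simulator .P₁, ∀ D : (duqOT 𝒢 σ π).Distinguisher .P₁,
      ∃ μ, Negligible μ ∧ ∀ n m s,
      |(duqOT 𝒢 σ π).idealProb .P₁ Sim D n m s - (duqOT 𝒢 σ π).realProb .P₁ D n m s| ≤ μ n :=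
  ⟨⟨fun n => simP₁A 𝒢 n, poly_simP₁A _ _⟩, fun D => exists_simulator_of_eq 𝒢 π .P₁ _
    (fun n H m s => eval_simP₁A 𝒢 n π (roOracle H) H m s _) D⟩

theorem simulator_P₂ {σ : ℕ → ℕ} (π : ℕ → PMF (Equiv.Perm Bool)) :
    ∃ Sim : (duqOT 𝒢 σ π).Simulator .P₂, ∀ D : (duqOT 𝒢 σ π).Distinguisher .P₂,
      ∃ μ, Negligible μ ∧ ∀ n m s,
      |(duqOT 𝒢 σ π).idealProb .P₂ Sim D n m s - (duqOT 𝒢 σ π).realProb .P₂ D n m s| ≤ μ n :=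
  ⟨⟨fun n => simP₂A 𝒢 n, poly_simP₂A _ _⟩, fun D => exists_simulator_of_eq 𝒢 π .P₂ _
    (fun n H m s => eval_simP₂A 𝒢 n π (roOracle H) H m s _) D⟩

theorem simulator_T {σ : ℕ → ℕ} (π : ℕ → PMF (Equiv.Perm Bool)) :
    ∃ Sim : (duqOT 𝒢 σ π).Simulator .T, ∀ D : (duqOT 𝒢 σ π).Distinguisher .T,
      ∃ μ, Negligible μ ∧ ∀ n m s,
      |(duqOT 𝒢 σ π).idealProb .T Sim D n m s - (duqOT 𝒢 σ π).realProb .T D n m s| ≤ μ n :=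
  ⟨⟨fun n => simTA 𝒢 n, poly_simTA _⟩, fun D => exists_simulator_of_eq 𝒢 π .T _
    (fun n H m s => eval_simTA 𝒢 n π (roOracle H) H m s) D⟩

end OtherParties

/-! ### Correctness -/

section Correctness

variable {𝒢 : GroupGen} {n : ℕ}

/-- The query by which the receiver decrypts the ciphertext of the message that was not chosen. -/
def Coins.otherKey (c : Coins 𝒢 n) (s : Bool) : List Bool :=
  List.ofFn (𝒢.enc n c.seed (𝒢.pow (𝒢.pow c.g (c.y !s)) (c.x s)))

/-- The query that encrypts the message that was not chosen. -/
def Coins.hiddenKey (c : Coins 𝒢 n) (s : Bool) : List Bool :=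
  List.ofFn (𝒢.enc n c.seed (𝒢.pow (c.C / 𝒢.pow c.g (c.x s)) (c.y !s)))

/-- The query that encrypts, and decrypts, the chosen message. -/
def Coins.chosenKey (c : Coins 𝒢 n) (s : Bool) : List Bool :=
  List.ofFn (𝒢.enc n c.seed (𝒢.pow (𝒢.pow c.g (c.x s)) (c.y s)))

/-- The last `k` bits of a string. -/
def tagBits {ℓ k : ℕ} (w : Bits (ℓ + k)) : Bits k := fun i => w (Fin.natAdd ℓ i)

/-- The sender never aborts, and encrypts under the chosen and the hidden key. -/
theorem Coins.res_eq {ℓ : ℕ} (c : Coins 𝒢 n) (H : List Bool → Bits (ℓ + n)) (m : Bool → Bits ℓ)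
    (s : Bool) :
    c.res H m s = some fun j => (𝒢.pow c.g (c.y (c.τ j)),
      xorBits (H (if c.τ j = s then c.chosenKey s else c.hiddenKey s))
        (Fin.append (m (c.τ j)) c.r₃)) := by
  have hC : c.C = c.β s false * c.β s true := by
    simp only [Coins.β_eq]
    cases s <;> simp
  rw [Coins.res, genRes, if_pos hC]
  congr 1; funext j
  refine Prod.ext rfl ?_
  simp only [Coins.β_eq]
  by_cases h : c.τ j = s
  · simp only [h, if_true, Coins.chosenKey]; rfl
  · have h' : c.τ j = !s := by cases hs : s <;> cases hj : c.τ j <;> simp_all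
    have h2 : (!s) ≠ s := by cases s <;> simp
    simp only [h', h2, if_false, Coins.hiddenKey]; rfl

theorem xorBits_self_left {k : ℕ} (x y : Bits k) : xorBits x (xorBits x y) = y := by
  funext i; simp [xorBits]

theorem decrypt_chosen {ℓ : ℕ} (c : Coins 𝒢 n) (H : List Bool → Bits (ℓ + n)) (m : Bool → Bits ℓ)
    (s : Bool) :
    decrypt H (𝒢.enc n c.seed) (c.x s)
      (𝒢.pow c.g (c.y s), xorBits (H (c.chosenKey s)) (Fin.append (m s) c.r₃)) = (m s, c.r₃) := by
  have hk : List.ofFn (𝒢.enc n c.seed ((𝒢.pow c.g (c.y s)) ^ (c.x s).val)) = c.chosenKey s := by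
    have : (𝒢.pow c.g (c.y s)) ^ (c.x s).val = 𝒢.pow (𝒢.pow c.g (c.y s)) (c.x s) := rfl
    rw [this, Coins.chosenKey, ← GroupGen.pow_mul, ← GroupGen.pow_mul, mul_comm]
  simp only [decrypt, hk, xorBits_self_left]
  simp

theorem decrypt_other_snd {ℓ : ℕ} (c : Coins 𝒢 n) (H : List Bool → Bits (ℓ + n)) (w : Bits ℓ)
    (s : Bool) :
    (decrypt H (𝒢.enc n c.seed) (c.x s)
      (𝒢.pow c.g (c.y !s), xorBits (H (c.hiddenKey s)) (Fin.append w c.r₃))).2 = c.r₃ ↔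
      tagBits (H (c.otherKey s)) = tagBits (H (c.hiddenKey s)) := by
  have hk : List.ofFn (𝒢.enc n c.seed ((𝒢.pow c.g (c.y !s)) ^ (c.x s).val)) = c.otherKey s := rfl
  simp only [decrypt, hk, funext_iff, xorBits, Fin.append_right, tagBits]
  refine forall_congr' fun i => ?_
  cases H (c.otherKey s) (Fin.natAdd ℓ i) <;> cases H (c.hiddenKey s) (Fin.natAdd ℓ i) <;>
    cases c.r₃ i <;> simp

/-- The tag of the message that was not chosen is accepted by accident. -/
def Coins.tagCollision {ℓ : ℕ} (c : Coins 𝒢 n) (H : List Bool → Bits (ℓ + n)) (s : Bool) : Bool :=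
  decide (tagBits (H (c.otherKey s)) = tagBits (H (c.hiddenKey s)))

/-- The tag of the chosen message is always accepted. -/
theorem Coins.out_eq {ℓ : ℕ} (c : Coins 𝒢 n) (H : List Bool → Bits (ℓ + n)) (m : Bool → Bits ℓ)
    (s : Bool) (hc : c.tagCollision H s = false) : c.out H m s = some (m s) := by
  have hne : ¬ tagBits (H (c.otherKey s)) = tagBits (H (c.hiddenKey s)) := by
    simpa [Coins.tagCollision] using hc
  have hx : c.r₂ + c.r₁ * (-1) ^ (c.s₂ s).toNat = c.x s := rfl
  have h2 : (!s) ≠ s := by cases s <;> simp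
  rw [Coins.out, Coins.res_eq, retrieve, hx]
  simp only [List.foldl]
  have hpos : ∀ j, c.τ j = s → decrypt H (𝒢.enc n c.seed) (c.x s) (𝒢.pow c.g (c.y (c.τ j)),
      xorBits (H (if c.τ j = s then c.chosenKey s else c.hiddenKey s))
        (Fin.append (m (c.τ j)) c.r₃)) = (m s, c.r₃) := by
    intro j hj
    rw [hj, if_pos rfl, decrypt_chosen]
  have hneg : ∀ j, c.τ j = (!s) → (decrypt H (𝒢.enc n c.seed) (c.x s) (𝒢.pow c.g (c.y (c.τ j)),
      xorBits (H (if c.τ j = s then c.chosenKey s else c.hiddenKey s))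
        (Fin.append (m (c.τ j)) c.r₃))).2 ≠ c.r₃ := by
    intro j hj
    rw [hj, if_neg h2, Ne, decrypt_other_snd]
    exact hne
  by_cases h : c.τ false = s
  · have h' : c.τ true = !s := by rw [perm_bool_true, h]
    rw [if_neg (hneg _ h'), hpos _ h, if_pos rfl]
  · have hf : c.τ false = !s := by cases hs : s <;> cases hj : c.τ false <;> simp_all
    have h' : c.τ true = s := by rw [perm_bool_true, hf, Bool.not_not]
    rw [hpos _ h', if_pos rfl]

theorem res_congr {ℓ : ℕ} (c : Coins 𝒢 n) {H H' : List Bool → Bits (ℓ + n)}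
    (h : ∀ l : List Bool, l.length ≤ 𝒢.eltLen n → H l = H' l) (m : Bool → Bits ℓ) (s : Bool) :
    c.res H m s = c.res H' m s := by
  have e : ∀ x : Bits (𝒢.eltLen n), H (List.ofFn x) = H' (List.ofFn x) := fun x =>
    h _ (by simp)
  simp only [Coins.res, genRes, e]

theorem out_congr {ℓ : ℕ} (c : Coins 𝒢 n) {H H' : List Bool → Bits (ℓ + n)}
    (h : ∀ l : List Bool, l.length ≤ 𝒢.eltLen n → H l = H' l) (m : Bool → Bits ℓ) (s : Bool) :
    c.out H m s = c.out H' m s := by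
  have e : ∀ x : Bits (𝒢.eltLen n), H (List.ofFn x) = H' (List.ofFn x) := fun x =>
    h _ (by simp)
  have hd : ∀ (x : 𝒢.Exp n c.seed) w,
      decrypt H (𝒢.enc n c.seed) x w = decrypt H' (𝒢.enc n c.seed) x w := by
    intro x w
    simp only [decrypt, e]
  rw [Coins.out, Coins.out, res_congr c h]
  cases c.res H' m s
  · rfl
  · simp only [retrieve, hd]

/-! ### The receiver accepts the wrong tag with negligible probability only -/

/-- Guessing a uniform exponent to be zero. -/
noncomputable def zeroExp (𝒢 : GroupGen) (n : ℕ) : PMF Bool :=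
  (PMF.uniformOfFintype (Bits (𝒢.seedLen n))).bind fun ω =>
    (PMF.uniformOfFintype (𝒢.Exp n ω)).map fun a => decide (a = 0)

/-- Under the DL assumption the order of the group is superpolynomial on average, for otherwise
zero would be a good guess. -/
theorem negligible_zeroExp (hDL : 𝒢.DLHard) : Negligible fun n => (zeroExp 𝒢 n true).toReal := by
  -- The DL adversary that always answers `0`.
  have h := hDL ⟨fun n => constC (natBits (𝒢.expLen n) 0), by simpa using 𝒢.expLen_poly⟩
  convert h using 2 with n
  unfold GroupGen.dlAdvantage zeroExp
  simp only [PPT.run, eval_constC, pmf_bind_def, pmf_pure_def, PMF.pure_bind, PMF.map_eq_bind]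
  congr 3
  funext ω
  congr 1
  funext a
  congr 1
  have h0 : natBits (𝒢.expLen n) 0 = 𝒢.encExp (0 : 𝒢.Exp n ω) := by
    simp [GroupGen.encExp]
  rw [h0, decide_eq_decide]
  exact ⟨fun h => h ▸ rfl, fun h => (𝒢.encExp_injective h).symm⟩

theorem uniform_map_decide_eq {A : Type} [Fintype A] [Nonempty A] [DecidableEq A] (a b : A) :
    ((PMF.uniformOfFintype A).map fun x => decide (x = a)) true =
      ((PMF.uniformOfFintype A).map fun x => decide (x = b)) true := by
  simp only [PMF.map_true_apply, PMF.uniformOfFintype_apply, decide_eq_true_eq, mul_ite, mul_one,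
    mul_zero, tsum_ite_eq]

theorem uniform_tag_eq {ℓ k : ℕ} (t : Bits k) :
    ((PMF.uniformOfFintype (Bits (ℓ + k))).bind fun v =>
      PMF.pure (decide (tagBits v = t))) true = (2 ^ k : ℝ≥0∞)⁻¹ := by
  have e : ∀ p : Bits ℓ × Bits k, tagBits (Fin.appendEquiv ℓ k p) = p.2 := by
    intro p; funext i; simp [tagBits, Fin.appendEquiv]
  rw [← uniform_bind_equiv (Fin.appendEquiv ℓ k)]
  simp only [e]
  rw [uniform_prod_bind]
  refine (congrArg (fun p : PMF Bool => p true) (PMF.bind_const (PMF.uniformOfFintype (Bits ℓ))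
    ((PMF.uniformOfFintype (Bits k)).bind fun x => PMF.pure (decide (x = t))))).trans ?_
  change ((PMF.uniformOfFintype (Bits k)).map fun x => decide (x = t)) true = _
  simp only [PMF.map_true_apply, PMF.uniformOfFintype_apply, decide_eq_true_eq, mul_ite, mul_one,
    mul_zero, tsum_ite_eq]
  simp

/-- With `y` the exponent of the other ciphertext, the keys agree if and only if
`y * x = (a - x) * y`. -/
theorem otherKey_eq_hiddenKey {c : Coins 𝒢 n} {s : Bool} (h : c.otherKey s = c.hiddenKey s) :
    c.y (!s) = 0 ∨ c.a = 2 * c.x s := by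
  have : Fact (𝒢.order n c.seed).Prime := ⟨𝒢.order_prime n c.seed⟩
  have h1 := 𝒢.enc_injective n c.seed (List.ofFn_injective h)
  rw [Coins.C, ← GroupGen.pow_sub, ← GroupGen.pow_mul, ← GroupGen.pow_mul] at h1
  have h2 := GroupGen.pow_gen_injective h1
  have h3 : c.y (!s) * (c.a - 2 * c.x s) = 0 := by linear_combination -h2
  rcases mul_eq_zero.1 h3 with h4 | h4
  · exact Or.inl h4
  · exact Or.inr (by linear_combination h4)

theorem prob_otherKey_eq_hiddenKey (π : ℕ → PMF (Equiv.Perm Bool)) (s : Bool) :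
    ((sampleCoins 𝒢 π n).map fun c => decide (c.otherKey s = c.hiddenKey s)) true ≤
      zeroExp 𝒢 n true + zeroExp 𝒢 n true := by
  rw [sampleCoins_map]
  refine PMF.bind_true_le _ fun ω => ?_
  -- The law of `2 * x`, which is independent of `a`.
  let X : PMF (𝒢.Exp n ω) :=
    (PMF.uniformOfFintype (𝒢.Exp n ω)).bind fun y₀ =>
    (PMF.uniformOfFintype (𝒢.Exp n ω)).bind fun y₁ =>
    (π n).bind fun τ =>
    (PMF.uniformOfFintype (𝒢.Exp n ω)).bind fun r₁ =>
    (PMF.uniformOfFintype (𝒢.Exp n ω)).bind fun r₂ =>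
    (PMF.uniformOfFintype Bool).bind fun s₁ =>
    (PMF.uniformOfFintype (Bits n)).bind fun r₃ =>
    PMF.pure (2 * (⟨ω, 0, fun i => if i then y₁ else y₀, τ, r₁, r₂, s₁, r₃⟩ : Coins 𝒢 n).x s)
  have h1 : ((PMF.uniformOfFintype (𝒢.Exp n ω)).bind fun a => X.bind fun x =>
      PMF.pure (decide (a = x))) true ≤
      ((PMF.uniformOfFintype (𝒢.Exp n ω)).map fun a => decide (a = 0)) true := by
    rw [PMF.bind_comm]
    refine PMF.bind_true_le_of_le _ fun x => ?_
    exact (uniform_map_decide_eq x 0).le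
  have h2 : ((PMF.uniformOfFintype (𝒢.Exp n ω)).bind fun y₀ =>
      (PMF.uniformOfFintype (𝒢.Exp n ω)).bind fun y₁ =>
        PMF.pure (decide ((if !s then y₁ else y₀) = 0))) true ≤
      ((PMF.uniformOfFintype (𝒢.Exp n ω)).map fun a => decide (a = 0)) true := by
    cases s
    · simp only [Bool.not_false, if_true, PMF.bind_const]; exact le_rfl
    · simp only [Bool.not_true, Bool.false_eq_true, if_false, PMF.bind_const]; exact le_rfl
  refine le_trans ?_ (add_le_add h2 h1)
  simp only [X, PMF.bind_bind, PMF.pure_bind]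
  rw [← PMF.bind_const (PMF.uniformOfFintype (𝒢.Exp n ω))
    ((PMF.uniformOfFintype (𝒢.Exp n ω)).bind fun y₀ =>
      (PMF.uniformOfFintype (𝒢.Exp n ω)).bind fun y₁ =>
        PMF.pure (decide ((if !s then y₁ else y₀) = 0)))]
  refine PMF.bind_true_le _ fun a => PMF.bind_true_le _ fun y₀ => PMF.bind_true_le _ fun y₁ => ?_
  have key : ∀ (c : Coins 𝒢 n) (y x a : ZMod _), c.y (!s) = y → 2 * c.x s = x → c.a = a →
      (PMF.pure (decide (c.otherKey s = c.hiddenKey s)) : PMF Bool) true ≤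
        (PMF.pure (decide (y = 0)) : PMF Bool) true +
          (PMF.pure (decide (a = x)) : PMF Bool) true := by
    rintro c _ _ _ rfl rfl rfl
    by_cases h : c.otherKey s = c.hiddenKey s
    · rcases otherKey_eq_hiddenKey h with h' | h'
      · exact (PMF.coe_le_one _ _).trans (by simp [h'])
      · exact (PMF.coe_le_one _ _).trans (by simp [h'])
    · simp [h]
  have absorb : ∀ {A : Type} (p : PMF A) {f e : A → PMF Bool} (g : PMF Bool),
      (∀ a, f a true ≤ g true + e a true) → (p.bind f) true ≤ g true + (p.bind e) true := by
    intro A p f e g h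
    have := p.bind_true_le (f := f) (g := fun _ => g) (e := e) h
    rwa [PMF.bind_const] at this
  exact absorb _ _ fun τ => absorb _ _ fun r₁ => absorb _ _ fun r₂ => absorb _ _ fun s₁ =>
    absorb _ _ fun r₃ => key _ _ _ _ rfl rfl rfl

/-- The experiment that the receiver accepts the message that was not chosen. -/
noncomputable def collisionExp (𝒢 : GroupGen) (σ : ℕ → ℕ) (π : ℕ → PMF (Equiv.Perm Bool))
    (n K : ℕ) (s : Bool) : PMF Bool :=
  (shortOracle K (σ n + n)).bind fun h =>
    (sampleCoins 𝒢 π n).map fun c => c.tagCollision h s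

theorem collisionExp_le (σ : ℕ → ℕ) (π : ℕ → PMF (Equiv.Perm Bool)) {K : ℕ}
    (hK : 𝒢.eltLen n ≤ K) (s : Bool) :
    collisionExp 𝒢 σ π n K s true ≤
      zeroExp 𝒢 n true + zeroExp 𝒢 n true + (2 ^ n : ℝ≥0∞)⁻¹ := by
  unfold collisionExp
  simp only [PMF.map_eq_bind]
  rw [PMF.bind_comm]
  refine le_trans ?_ (add_le_add_left (prob_otherKey_eq_hiddenKey π s) _)
  refine PMF.bind_true_le_const _ fun c => ?_
  by_cases h : c.otherKey s = c.hiddenKey s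
  · simp only [Function.comp, h, decide_true]
    exact (PMF.coe_le_one _ _).trans (by simp)
  · refine le_trans ?_ le_add_self
    -- The keys being different, the value at one of them may be drawn after that at the other.
    rw [← shortOracle_resample (q := c.otherKey s) (by simpa [Coins.otherKey] using hK)]
    refine PMF.bind_true_le_of_le _ fun f => ?_
    simp only [Coins.tagCollision, Function.update_self, Function.update_of_ne (Ne.symm h)]
    exact (uniform_tag_eq _).le

/-- A negligible bound on the probability of a wrong output. -/
noncomputable def collisionBound (𝒢 : GroupGen) (n : ℕ) : ℝ :=
  (zeroExp 𝒢 n true).toReal + (zeroExp 𝒢 n true).toReal + ((2 : ℝ) ^ n)⁻¹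

theorem negligible_collisionBound (hDL : 𝒢.DLHard) : Negligible (collisionBound 𝒢) :=
  ((negligible_zeroExp hDL).add (negligible_zeroExp hDL)).add .two_pow_inv

theorem collisionBound_nonneg : 0 ≤ collisionBound 𝒢 n := by
  unfold collisionBound; positivity

theorem collisionExp_toReal_le (σ : ℕ → ℕ) (π : ℕ → PMF (Equiv.Perm Bool)) {K : ℕ}
    (hK : 𝒢.eltLen n ≤ K) (s : Bool) :
    (collisionExp 𝒢 σ π n K s true).toReal ≤ collisionBound 𝒢 n := by
  have hz := (zeroExp 𝒢 n).apply_ne_top true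
  have h2 : ((2 ^ n : ℝ≥0∞)⁻¹) ≠ ∞ := by simp
  have := ENNReal.toReal_mono (ENNReal.add_ne_top.2 ⟨ENNReal.add_ne_top.2 ⟨hz, hz⟩, h2⟩)
    (collisionExp_le σ π hK s)
  rwa [ENNReal.toReal_add (ENNReal.add_ne_top.2 ⟨hz, hz⟩) h2, ENNReal.toReal_add hz hz,
    ENNReal.toReal_inv, ENNReal.toReal_pow, ENNReal.toReal_ofNat] at this

/-- The output differs from `m_s` only if the tag of the other message is accepted by accident. -/
theorem correct (hDL : 𝒢.DLHard) (σ : ℕ → ℕ) (π : ℕ → PMF (Equiv.Perm Bool)) :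
    (duqOT 𝒢 σ π).Correct := by
  classical
  refine ⟨collisionBound 𝒢, negligible_collisionBound hDL, fun n m s => ?_⟩
  rw [roProb_eq (K := 𝒢.eltLen n)]
  · have h1 : (1 : ℝ≥0∞) ≤
        ((shortOracle (𝒢.eltLen n) (σ n + n)).bind fun h =>
          ((duqOT 𝒢 σ π).output n h m s).map fun o => decide (o = some (m s))) true +
        collisionExp 𝒢 σ π n (𝒢.eltLen n) s true := by
      have h0 : (1 : ℝ≥0∞) = ((shortOracle (𝒢.eltLen n) (σ n + n)).bind fun _ =>
          (sampleCoins 𝒢 π n).bind fun _ => PMF.pure true) true := by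
        simp only [PMF.bind_const, PMF.pure_apply_self]
      rw [h0]
      refine PMF.bind_true_le _ fun h => ?_
      simp only [duqOT, PMF.map_comp]
      refine PMF.bind_true_le _ fun c => ?_
      cases hc : c.tagCollision h s
      · simp [Function.comp, Coins.out_eq c h m s hc]
      · simp [Function.comp, hc]
    have h2 := ENNReal.toReal_mono (ENNReal.add_ne_top.2 ⟨PMF.apply_ne_top _ _,
      PMF.apply_ne_top _ _⟩) h1
    rw [ENNReal.toReal_add (PMF.apply_ne_top _ _) (PMF.apply_ne_top _ _), ENNReal.toReal_one] at h2
    linarith [collisionExp_toReal_le σ π (le_refl (𝒢.eltLen n)) s]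
  · intro H H' h
    simp only [duqOT, PMF.map_comp, Function.comp_def, out_congr _ h]

end Correctness

/-! ### The simulator for the receiver -/

section Circuits

/-- The oracle's answer to a query on selected wires. -/
def queryC {L k : ℕ} {α : Type} (f : Fin k → α) : Circ (roSig L) α (Fin L) :=
  on f (query (S := roSig L) k)

@[simp]
theorem eval_queryC {L k : ℕ} {α : Type} (H : List Bool → Bits L) (f : Fin k → α)
    (x : α → Bool) :
    (queryC f : Circ (roSig L) α (Fin L)).eval (roOracle H) x =
      PMF.pure (H (List.ofFn (x ∘ f))) :=
  eval_on (roOracle H) f (query (S := roSig L) k) x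

@[simp]
theorem size_queryC {L k : ℕ} {α : Type} (f : Fin k → α) :
    (queryC f : Circ (roSig L) α (Fin L)).size = k + L + 1 :=
  size_on f (query (S := roSig L) k)

@[simp]
theorem comp_fin_append {k l : ℕ} {X Y : Type} (x : X → Y) (f : Fin k → X) (g : Fin l → X) :
    x ∘ Fin.append f g = Fin.append (x ∘ f) (x ∘ g) := by
  funext i
  refine Fin.addCases (fun i => ?_) (fun i => ?_) i <;> simp

variable (𝒢 : GroupGen) (n ℓ : ℕ) {S : OracleSig}

/-- The base raised to `r₂ + r₁ * (-1) ^ s₂`. -/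
def signedPowA : Circ S ((𝒢.ParamWires n ⊕ Fin (𝒢.eltLen n)) ⊕ Fin (𝒢.expLen n) ⊕
    Fin (𝒢.expLen n) ⊕ Unit) (Fin (𝒢.eltLen n)) :=
  bnd (on (Sum.inl ∘ Sum.inl ⧺ Sum.inl ∘ Sum.inr ⧺ Sum.inr ∘ Sum.inl) (𝒢.powA n S)) <|
  bnd (on (Sum.inl ∘ Sum.inl ∘ Sum.inl ⧺ Sum.inl ∘ Sum.inl ∘ Sum.inr ⧺
    Sum.inl ∘ Sum.inr ∘ Sum.inr ∘ Sum.inl) (𝒢.powA n S)) <|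
  bnd (on (Sum.inl ∘ Sum.inl ∘ Sum.inl ∘ Sum.inl ⧺ v₀ ⧺ v₁) (𝒢.mulA n S)) <|
  bnd (on (Sum.inl ∘ Sum.inl ∘ Sum.inl ∘ Sum.inl ∘ Sum.inl ⧺ v₁ ⧺ v₂) (𝒢.divA n S)) <|
  muxVecC (Sum.inl (Sum.inl (Sum.inl (Sum.inl (Sum.inr (Sum.inr (Sum.inr ()))))))) v₀ v₁

variable {n} in
@[simp]
theorem eval_signedPowA (O : S.Oracle) {ω : Bits (𝒢.seedLen n)} (b : 𝒢.Carrier n ω)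
    (r₁ r₂ : 𝒢.Exp n ω) (s₂ : Bool) :
    (signedPowA 𝒢 n).eval O ((𝒢.params n ω ⧺ 𝒢.enc n ω b) ⧺ 𝒢.encExp r₁ ⧺ 𝒢.encExp r₂ ⧺
      (fun _ => s₂)) = PMF.pure (𝒢.enc n ω (𝒢.pow b (r₂ + r₁ * (-1) ^ s₂.toNat))) := by
  simp [signedPowA]
  cases s₂ <;> simp [GroupGen.pow_add, GroupGen.pow_neg, div_eq_mul_inv]

/-- What the receiver's view is made of when the sender does not abort: `r₁`, `r₂`, the public
key, `r₃`, `s₂`, the first components of the chosen and of the other ciphertext, the query that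
encrypts the chosen message, the second component of the other ciphertext, the position (`false` or
`true`) of the chosen ciphertext, and the chosen message. -/
abbrev CoreWires : Type :=
  (Fin (𝒢.expLen n) ⊕ Fin (𝒢.expLen n)) ⊕ PkWires 𝒢 n ⊕ Fin n ⊕ Unit ⊕
    Fin (𝒢.eltLen n) ⊕ Fin (𝒢.eltLen n) ⊕ Fin (𝒢.eltLen n) ⊕ Fin (ℓ + n) ⊕ Unit ⊕ Fin ℓ

/-- Wires of the receiver's view. -/
abbrev ReceiverWires : Type :=
  (Fin (𝒢.expLen n) ⊕ Fin (𝒢.expLen n)) ⊕ PkWires 𝒢 n ⊕ Fin n ⊕ Unit ⊕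
      (Unit ⊕ (Fin (𝒢.eltLen n) ⊕ Fin (ℓ + n)) ⊕ (Fin (𝒢.eltLen n) ⊕ Fin (ℓ + n))) ⊕
      (Unit ⊕ Fin ℓ)

variable {𝒢 n ℓ} in
/-- The assignment of `CoreWires`. -/
def coreInput (r₁ r₂ : Bits (𝒢.expLen n)) (pk : PkWires 𝒢 n → Bool) (r₃ : Bits n) (s₂ : Bool)
    (Y Y' κ : Bits (𝒢.eltLen n)) (u : Bits (ℓ + n)) (d : Bool) (w : Bits ℓ) :
    CoreWires 𝒢 n ℓ → Bool :=
  (r₁ ⧺ r₂) ⧺ pk ⧺ r₃ ⧺ (fun _ => s₂) ⧺ Y ⧺ Y' ⧺ κ ⧺ u ⧺ (fun _ => d) ⧺ w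

/- `wₖ` selects component `k`, counted from 0, of a long sum of wire types, and `z₃` all that
comes after the first three components. -/
local notation:max "w₁" => (Sum.inr ∘ Sum.inl)
local notation:max "w₂" => (Sum.inr ∘ w₁)
local notation:max "w₃" => (Sum.inr ∘ w₂)
local notation:max "w₄" => (Sum.inr ∘ w₃)
local notation:max "w₅" => (Sum.inr ∘ w₄)
local notation:max "w₆" => (Sum.inr ∘ w₅)
local notation:max "w₇" => (Sum.inr ∘ w₆)
local notation:max "w₈" => (Sum.inr ∘ w₇)
local notation:max "z₃" => (Sum.inr ∘ Sum.inr ∘ Sum.inr)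
local notation:max "w₉" => (z₃ ∘ z₃ ∘ z₃)

/-- The receiver's view from its ingredients: encrypt the chosen message, and put the ciphertexts
in order. -/
def coreA : Circ (roSig (ℓ + n)) (CoreWires 𝒢 n ℓ) (ReceiverWires 𝒢 n ℓ) :=
  -- The second component of the chosen ciphertext.
  bnd (queryC w₆) <|
  bnd (xorVecC v₀ (Fin.append (Sum.inl ∘ w₉) (Sum.inl ∘ w₂))) <|
  -- The first components in positions `false` and `true`, and the second ones.
  bnd (muxVecC ((Sum.inl ∘ Sum.inl ∘ w₈) ()) (Sum.inl ∘ Sum.inl ∘ w₅)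
    (Sum.inl ∘ Sum.inl ∘ w₄)) <|
  bnd (muxVecC ((Sum.inl ∘ Sum.inl ∘ Sum.inl ∘ w₈) ()) (Sum.inl ∘ Sum.inl ∘ Sum.inl ∘ w₄)
    (Sum.inl ∘ Sum.inl ∘ Sum.inl ∘ w₅)) <|
  bnd (muxVecC ((Sum.inl ∘ Sum.inl ∘ Sum.inl ∘ Sum.inl ∘ w₈) ())
    (Sum.inl ∘ Sum.inl ∘ Sum.inl ∘ Sum.inl ∘ w₇) v₂) <|
  bnd (muxVecC ((Sum.inl ∘ Sum.inl ∘ Sum.inl ∘ Sum.inl ∘ Sum.inl ∘ w₈) ()) v₃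
    (Sum.inl ∘ Sum.inl ∘ Sum.inl ∘ Sum.inl ∘ Sum.inl ∘ w₇)) <|
  -- The flags of the response and of the output, which are present.
  bnd (bitC true) <|
  -- Only the input and the last five variables are needed from here on.
  on (Sum.inl ∘ Sum.inl ∘ Sum.inl ∘ Sum.inl ∘ Sum.inl ∘ Sum.inl ∘ Sum.inl ⧺
    v₀ ⧺ v₄ ⧺ v₃ ⧺ v₂ ⧺ v₁) <|
  ret (Sum.inl ∘ Sum.inl ⧺ Sum.inl ∘ w₁ ⧺ Sum.inl ∘ w₂ ⧺ Sum.inl ∘ w₃ ⧺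
    (w₁ ⧺ (w₂ ⧺ w₄) ⧺ (w₃ ⧺ (Sum.inr ∘ Sum.inr ∘ Sum.inr ∘ Sum.inr ∘ Sum.inr))) ⧺
    (w₁ ⧺ Sum.inl ∘ w₉))

variable {𝒢 n ℓ} in
theorem eval_coreA (H : List Bool → Bits (ℓ + n)) (r₁ r₂ : Bits (𝒢.expLen n))
    (pk : PkWires 𝒢 n → Bool) (r₃ : Bits n) (s₂ : Bool)
    (Y Y' κ : Bits (𝒢.eltLen n)) (u : Bits (ℓ + n)) (d : Bool) (w : Bits ℓ) :
    (coreA 𝒢 n ℓ).eval (roOracle H) (coreInput r₁ r₂ pk r₃ s₂ Y Y' κ u d w) =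
      PMF.pure ((r₁ ⧺ r₂) ⧺ pk ⧺ r₃ ⧺ bit s₂ ⧺
        (bit true ⧺
          ((if d then Y' else Y) ⧺
            (if d then u else xorBits (H (List.ofFn κ)) (Fin.append w r₃))) ⧺
          ((if d then Y else Y') ⧺
            (if d then xorBits (H (List.ofFn κ)) (Fin.append w r₃) else u))) ⧺
        (bit true ⧺ w)) := by
  simp [coreA, coreInput]
  rfl

/-- From the group parameters, `C`, the first component of the other ciphertext and the chosen
message, all of the remaining ingredients of the receiver's view, and the other first component
raised to the receiver's exponent. The exponent of the chosen ciphertext, its position, `r₁`, `r₂`,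
`s₂`, `r₃` and the second component of the other ciphertext are drawn in this order. -/
def ingredientsA : Circ S (𝒢.ParamWires n ⊕ Fin (𝒢.eltLen n) ⊕ Fin (𝒢.eltLen n) ⊕ Fin ℓ)
    (CoreWires 𝒢 n ℓ ⊕ Fin (𝒢.eltLen n)) :=
  -- The coins.
  bnd (on Sum.inl (𝒢.expA n S)) <|
  bnd coinC <|
  bnd (on (Sum.inl ∘ Sum.inl ∘ Sum.inl) (𝒢.expA n S)) <|
  bnd (on (Sum.inl ∘ Sum.inl ∘ Sum.inl ∘ Sum.inl) (𝒢.expA n S)) <|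
  bnd coinC <|
  bnd (coinsC n) <|
  bnd (coinsC (ℓ + n)) <|
  -- The components are now: the input, `y`, `d`, the triple `r₁, r₂, s₂`, `r₃`, and `u`.
  on (Sum.inl ∘ Sum.inl ∘ Sum.inl ∘ Sum.inl ∘ Sum.inl ∘ Sum.inl ∘ Sum.inl ⧺
    v₆ ⧺ v₅ ⧺ (v₄ ⧺ v₃ ⧺ v₂) ⧺ v₁ ⧺ v₀) <|
  -- `g`, `β = g ^ x`, `β ^ y`, `g ^ y`, and `Y' ^ x` for the given first component `Y'`.
  bnd (on (Sum.inl ∘ Sum.inl) (𝒢.genA n S)) <|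
  bnd (on ((Sum.inl ∘ Sum.inl ∘ Sum.inl ⧺ v₀) ⧺ Sum.inl ∘ w₃) (signedPowA 𝒢 n)) <|
  bnd (on (Sum.inl ∘ Sum.inl ∘ Sum.inl ∘ Sum.inl ⧺ v₀ ⧺ Sum.inl ∘ Sum.inl ∘ w₁)
    (𝒢.powA n S)) <|
  bnd (on (Sum.inl ∘ Sum.inl ∘ Sum.inl ∘ Sum.inl ∘ Sum.inl ⧺ Sum.inl ∘ Sum.inl ∘ Sum.inl ∘ w₁)
    (𝒢.gpowA n S)) <|
  bnd (on ((Sum.inl ∘ Sum.inl ∘ Sum.inl ∘ Sum.inl ∘ Sum.inl ∘ Sum.inl ⧺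
      Sum.inl ∘ Sum.inl ∘ Sum.inl ∘ Sum.inl ∘ Sum.inl ∘ w₂) ⧺
      Sum.inl ∘ Sum.inl ∘ Sum.inl ∘ Sum.inl ∘ w₃) (signedPowA 𝒢 n)) <|
  on (Sum.inl ∘ Sum.inl ∘ Sum.inl ∘ Sum.inl ∘ Sum.inl ⧺ v₂ ⧺ v₁ ⧺ v₀) <|
  ret (((Sum.inl ∘ w₃ ∘ Sum.inl ⧺ Sum.inl ∘ w₃ ∘ w₁) ⧺
    (Sum.inl ∘ Sum.inl ∘ Sum.inl ⧺ Sum.inl ∘ Sum.inl ∘ w₁) ⧺ Sum.inl ∘ w₄ ⧺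
    (Sum.inl ∘ w₃ ∘ Sum.inr ∘ Sum.inr) ⧺ w₂ ⧺ (Sum.inl ∘ Sum.inl ∘ w₂) ⧺ w₁ ⧺
    (Sum.inl ∘ Sum.inr ∘ Sum.inr ∘ Sum.inr ∘ Sum.inr ∘ Sum.inr) ⧺ Sum.inl ∘ w₂ ⧺
    (Sum.inl ∘ Sum.inl ∘ Sum.inr ∘ Sum.inr ∘ Sum.inr)) ⧺ (Sum.inr ∘ Sum.inr ∘ Sum.inr))

variable {n} in
theorem eval_ingredientsA (O : S.Oracle) {ω : Bits (𝒢.seedLen n)} (C Y' : 𝒢.Carrier n ω)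
    (w : Bits ℓ) :
    (ingredientsA 𝒢 n ℓ).eval O (𝒢.params n ω ⧺ 𝒢.enc n ω C ⧺ 𝒢.enc n ω Y' ⧺ w) =
      (PMF.uniformOfFintype (𝒢.Exp n ω)).bind fun y =>
      (PMF.uniformOfFintype Bool).bind fun d =>
      (PMF.uniformOfFintype (𝒢.Exp n ω)).bind fun r₁ =>
      (PMF.uniformOfFintype (𝒢.Exp n ω)).bind fun r₂ =>
      (PMF.uniformOfFintype Bool).bind fun s₂ =>
      (PMF.uniformOfFintype (Bits n)).bind fun r₃ =>
      (PMF.uniformOfFintype (Bits (ℓ + n))).bind fun u =>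
      PMF.pure (coreInput (𝒢.encExp r₁) (𝒢.encExp r₂) (𝒢.params n ω ⧺ 𝒢.enc n ω C) r₃ s₂
        (𝒢.enc n ω (𝒢.pow (𝒢.gen n ω) y)) (𝒢.enc n ω Y')
        (𝒢.enc n ω (𝒢.pow (𝒢.pow (𝒢.gen n ω) (r₂ + r₁ * (-1) ^ s₂.toNat)) y)) u d w ⧺
        𝒢.enc n ω (𝒢.pow Y' (r₂ + r₁ * (-1) ^ s₂.toNat))) := by
  simp [ingredientsA, coreInput]

/-- The ingredients of the receiver's view for a fresh execution. -/
def freshIngredientsA : Circ S (Empty ⊕ Fin ℓ) (CoreWires 𝒢 n ℓ) :=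
  bnd (coinsC (𝒢.seedLen n)) <|
  bnd (on v₀ (𝒢.setupA n S)) <|
  bnd (on v₀ (𝒢.expA n S)) <|
  bnd (on v₁ (𝒢.expA n S)) <|
  bnd (on (v₂ ⧺ v₁) (𝒢.gpowA n S)) <|
  bnd (on (v₃ ⧺ v₁) (𝒢.gpowA n S)) <|
  bnd (on (v₄ ⧺ v₁ ⧺ v₀ ⧺
    Sum.inl ∘ Sum.inl ∘ Sum.inl ∘ Sum.inl ∘ Sum.inl ∘ Sum.inl ∘ Sum.inr)
    (ingredientsA 𝒢 n ℓ)) <|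
  ret (Sum.inr ∘ Sum.inl)

end Circuits

/-! ### Polynomial size of the receiver's simulator -/

section Sizes

variable {𝒢 : GroupGen} {σ : ℕ → ℕ}

theorem poly_coreA (hσ : PolyBounded σ) : PolyBounded fun n => (coreA 𝒢 n (σ n)).size := by
  have h := (𝒢.eltLen_poly.mul (.const 9)).add
    (((hσ.add .id).mul (.const 13)).add (PolyBounded.const 2))
  refine h.mono fun n => ?_
  simp only [coreA, size_bnd, size_on, size_ret, size_queryC, size_xorVecC, size_muxVecC,
    size_bitC]
  omega

theorem poly_ingredientsA (S : ℕ → OracleSig) (hσ : PolyBounded σ) :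
    PolyBounded fun n => (ingredientsA 𝒢 n (σ n) : Circ (S n) _ _).size := by
  have hs : PolyBounded fun n => (signedPowA 𝒢 n : Circ (S n) _ _).size := by
    refine (((𝒢.poly_powA S).mul (.const 2)).add ((𝒢.poly_mulA S).add ((𝒢.poly_divA S).add
      (𝒢.eltLen_poly.mul (.const 4))))).mono fun n => ?_
    simp only [signedPowA, size_bnd, size_on, size_muxVecC]
    omega
  refine (((𝒢.poly_expA S).mul (.const 3)).add ((PolyBounded.const 2).add ((PolyBounded.id.mul
    (.const 2)).add (hσ.add ((hs.mul (.const 2)).add ((𝒢.poly_powA S).add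
    (𝒢.poly_gpowA S))))))).mono fun n => ?_
  simp only [ingredientsA, GroupGen.genA, size_bnd, size_on, size_ret, size_coinC, size_coinsC]
  omega

theorem poly_freshIngredientsA (S : ℕ → OracleSig) (hσ : PolyBounded σ) :
    PolyBounded fun n => (freshIngredientsA 𝒢 n (σ n) : Circ (S n) _ _).size := by
  refine (𝒢.seedLen_poly.add ((𝒢.poly_setupA S).add (((𝒢.poly_expA S).mul (.const 2)).add
    (((𝒢.poly_gpowA S).mul (.const 2)).add (poly_ingredientsA (𝒢 := 𝒢) S hσ))))).mono fun n => ?_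
  simp only [freshIngredientsA, size_bnd, size_on, size_ret, size_coinsC]
  omega

end Sizes

/-! ### The law of the ingredients of the receiver's view -/

section Law

variable {𝒢 : GroupGen} {n ℓ : ℕ} {A : Type}

/-- An experiment on the ingredients of the receiver's view, when the chosen message is `w` and the
second component of the other ciphertext is uniform, and on the query that encrypts the other
message. Neither the index nor the other message matters. -/
noncomputable def coreExp (w : Bits ℓ) (f : (CoreWires 𝒢 n ℓ → Bool) → List Bool → PMF A) :
    PMF A :=
  (PMF.uniformOfFintype (Bits (𝒢.seedLen n))).bind fun ω =>
  (PMF.uniformOfFintype (𝒢.Exp n ω)).bind fun a =>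
  (PMF.uniformOfFintype (𝒢.Exp n ω)).bind fun y' =>
  (PMF.uniformOfFintype (𝒢.Exp n ω)).bind fun y =>
  (PMF.uniformOfFintype Bool).bind fun d =>
  (PMF.uniformOfFintype (𝒢.Exp n ω)).bind fun r₁ =>
  (PMF.uniformOfFintype (𝒢.Exp n ω)).bind fun r₂ =>
  (PMF.uniformOfFintype Bool).bind fun s₂ =>
  (PMF.uniformOfFintype (Bits n)).bind fun r₃ =>
  (PMF.uniformOfFintype (Bits (ℓ + n))).bind fun u =>
  f (coreInput (𝒢.encExp r₁) (𝒢.encExp r₂)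
      (𝒢.params n ω ⧺ 𝒢.enc n ω (𝒢.pow (𝒢.gen n ω) a)) r₃ s₂
      (𝒢.enc n ω (𝒢.pow (𝒢.gen n ω) y)) (𝒢.enc n ω (𝒢.pow (𝒢.gen n ω) y'))
      (𝒢.enc n ω (𝒢.pow (𝒢.pow (𝒢.gen n ω) (r₂ + r₁ * (-1) ^ s₂.toNat)) y)) u d w)
    (List.ofFn (𝒢.enc n ω (𝒢.pow
      (𝒢.pow (𝒢.gen n ω) a / 𝒢.pow (𝒢.gen n ω) (r₂ + r₁ * (-1) ^ s₂.toNat)) y')))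

theorem coreExp_bind {B : Type} (w : Bits ℓ)
    (f : (CoreWires 𝒢 n ℓ → Bool) → List Bool → PMF A) (h : A → PMF B) :
    (coreExp w f).bind h = coreExp w fun v z => (f v z).bind h := by
  simp only [coreExp, PMF.bind_bind]

theorem eval_freshIngredientsA {S : OracleSig} (O : S.Oracle) (e : Empty → Bool) (w : Bits ℓ) :
    (freshIngredientsA 𝒢 n ℓ).eval O (e ⧺ w) = coreExp w fun v _ => PMF.pure v := by
  simp [freshIngredientsA, coreExp, eval_ingredientsA]

/-- The permutation of a pair that has the entry from position `b` in position `false`. -/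
def permOf (b : Bool) : Equiv.Perm Bool := if b then Equiv.boolNot else 1

theorem permOf_apply_false (b : Bool) : permOf b false = b := by cases b <;> rfl

theorem permOf_eq (τ : Equiv.Perm Bool) : permOf (τ false) = τ := by
  ext b
  cases b
  · rw [permOf_apply_false]
  · rw [perm_bool_true, perm_bool_true τ, permOf_apply_false]

/-- The fair random permutation. -/
noncomputable def fairPerm : ℕ → PMF (Equiv.Perm Bool) := fun _ =>
  (PMF.uniformOfFintype Bool).map permOf

theorem sampleCoins_bind (π : ℕ → PMF (Equiv.Perm Bool)) (f : Coins 𝒢 n → PMF A) :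
    (sampleCoins 𝒢 π n).bind f =
      (PMF.uniformOfFintype (Bits (𝒢.seedLen n))).bind fun seed =>
      (PMF.uniformOfFintype (𝒢.Exp n seed)).bind fun a =>
      (PMF.uniformOfFintype (𝒢.Exp n seed)).bind fun y₀ =>
      (PMF.uniformOfFintype (𝒢.Exp n seed)).bind fun y₁ =>
      (π n).bind fun τ =>
      (PMF.uniformOfFintype (𝒢.Exp n seed)).bind fun r₁ =>
      (PMF.uniformOfFintype (𝒢.Exp n seed)).bind fun r₂ =>
      (PMF.uniformOfFintype Bool).bind fun s₁ =>
      (PMF.uniformOfFintype (Bits n)).bind fun r₃ =>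
      f ⟨seed, a, fun i => if i then y₁ else y₀, τ, r₁, r₂, s₁, r₃⟩ := by
  simp only [sampleCoins, pmf_bind_def, pmf_pure_def, PMF.bind_bind, PMF.pure_bind]

theorem sampleCoins_bind_true_le {π π' : ℕ → PMF (Equiv.Perm Bool)} {ε : ℝ≥0∞}
    (h : ∀ b, ((π n).map fun τ => τ false) b ≤ ((π' n).map fun τ => τ false) b + ε)
    (f : Coins 𝒢 n → PMF Bool) :
    ((sampleCoins 𝒢 π n).bind f) true ≤ ((sampleCoins 𝒢 π' n).bind f) true + ε := by
  have e : ∀ (π : PMF (Equiv.Perm Bool)) (f : Equiv.Perm Bool → PMF Bool),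
      π.bind f = (π.map fun τ => τ false).bind fun b => f (permOf b) := by
    intro π f
    simp only [PMF.bind_map_apply, permOf_eq]
  simp only [sampleCoins_bind]
  refine PMF.bind_true_le_const _ fun ω => PMF.bind_true_le_const _ fun a =>
    PMF.bind_true_le_const _ fun y₀ => PMF.bind_true_le_const _ fun y₁ => ?_
  rw [e (π n), e (π' n)]
  exact PMF.bool_bind_true_le _ _ h

theorem fairPerm_map : ((fairPerm n).map fun τ => τ false) = PMF.uniformOfFintype Bool := by
  simp only [fairPerm, PMF.map_comp, Function.comp_def, permOf_apply_false]
  exact PMF.map_id _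

/-- The ingredients of the receiver's view in an execution in which the second component of the
other ciphertext is `u`, and the chosen message is `w`. -/
def Coins.coreInput (c : Coins 𝒢 n) (s : Bool) (w : Bits ℓ) (u : Bits (ℓ + n)) :
    CoreWires 𝒢 n ℓ → Bool :=
  DUQOT.coreInput (𝒢.encExp c.r₁) (𝒢.encExp c.r₂) c.pk c.r₃ (c.s₂ s)
    (𝒢.enc n c.seed (𝒢.pow c.g (c.y s))) (𝒢.enc n c.seed (𝒢.pow c.g (c.y !s)))
    (𝒢.enc n c.seed (𝒢.pow (𝒢.pow c.g (c.x s)) (c.y s))) u (xor (c.τ false) s) w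

/-- With a fair permutation, an execution in which the second component of the other ciphertext is
uniform does not depend on the index or on the other message. -/
theorem sampleCoins_fairPerm (s : Bool) (w : Bits ℓ)
    (f : (CoreWires 𝒢 n ℓ → Bool) → List Bool → PMF A) :
    ((sampleCoins 𝒢 fairPerm n).bind fun c => (PMF.uniformOfFintype (Bits (ℓ + n))).bind fun u =>
      f (c.coreInput s w u) (c.hiddenKey s)) = coreExp w f := by
  rw [sampleCoins_bind, coreExp]
  refine PMF.bind_congr' _ fun ω => PMF.bind_congr' _ fun a => ?_
  -- `F y' y d r₁ r₂ s₂` is the rest of the experiment; it involves `τ` and `s₁` only through the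
  -- bits `d = τ false ⊕ s` and `s₂ = s₁ ⊕ s`, which are as uniform as those.
  let F : 𝒢.Exp n ω → 𝒢.Exp n ω → Bool → 𝒢.Exp n ω → 𝒢.Exp n ω → Bool → PMF A :=
    fun y' y d r₁ r₂ s₂ =>
      (PMF.uniformOfFintype (Bits n)).bind fun r₃ =>
      (PMF.uniformOfFintype (Bits (ℓ + n))).bind fun u =>
      f (DUQOT.coreInput (𝒢.encExp r₁) (𝒢.encExp r₂)
          (𝒢.params n ω ⧺ 𝒢.enc n ω (𝒢.pow (𝒢.gen n ω) a)) r₃ s₂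
          (𝒢.enc n ω (𝒢.pow (𝒢.gen n ω) y)) (𝒢.enc n ω (𝒢.pow (𝒢.gen n ω) y'))
          (𝒢.enc n ω (𝒢.pow (𝒢.pow (𝒢.gen n ω) (r₂ + r₁ * (-1) ^ s₂.toNat)) y)) u d w)
        (List.ofFn (𝒢.enc n ω (𝒢.pow
          (𝒢.pow (𝒢.gen n ω) a / 𝒢.pow (𝒢.gen n ω) (r₂ + r₁ * (-1) ^ s₂.toNat)) y')))
  let F' : 𝒢.Exp n ω → 𝒢.Exp n ω → PMF A := fun y' y =>
    (PMF.uniformOfFintype Bool).bind fun d =>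
    (PMF.uniformOfFintype (𝒢.Exp n ω)).bind fun r₁ =>
    (PMF.uniformOfFintype (𝒢.Exp n ω)).bind fun r₂ =>
    (PMF.uniformOfFintype Bool).bind fun s₂ => F y' y d r₁ r₂ s₂
  have h : ∀ y₀ y₁ : 𝒢.Exp n ω, ((fairPerm n).bind fun τ =>
      (PMF.uniformOfFintype (𝒢.Exp n ω)).bind fun r₁ =>
      (PMF.uniformOfFintype (𝒢.Exp n ω)).bind fun r₂ =>
      (PMF.uniformOfFintype Bool).bind fun s₁ =>
      F (if !s then y₁ else y₀) (if s then y₁ else y₀) (xor (τ false) s) r₁ r₂ (xor s₁ s)) =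
      F' (if !s then y₁ else y₀) (if s then y₁ else y₀) := by
    intro y₀ y₁
    simp only [fairPerm, PMF.bind_map_apply, permOf_apply_false, F']
    refine (uniform_bind_xor s (fun d => (PMF.uniformOfFintype (𝒢.Exp n ω)).bind fun r₁ =>
      (PMF.uniformOfFintype (𝒢.Exp n ω)).bind fun r₂ =>
      (PMF.uniformOfFintype Bool).bind fun s₁ =>
      F (if !s then y₁ else y₀) (if s then y₁ else y₀) d r₁ r₂ (xor s₁ s))).trans ?_
    refine PMF.bind_congr' _ fun d => PMF.bind_congr' _ fun r₁ => PMF.bind_congr' _ fun r₂ => ?_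
    exact uniform_bind_xor s _
  refine (PMF.bind_congr' _ fun y₀ => PMF.bind_congr' _ fun y₁ => h y₀ y₁).trans ?_
  -- `y₀, y₁` are drawn in this order, and `y'` is the one for the other message.
  cases s
  · exact PMF.bind_comm _ _ _
  · rfl

end Law

/-! ### A receiver who decrypts the other message solves the CDH problem -/

section Reduction

variable {𝒢 : GroupGen} {n ℓ L : ℕ} {Z : Type}

/-- The experiment of the CDH assumption. -/
noncomputable def cdhExp
    (A : Circ plainSig (𝒢.ParamWires n ⊕ Fin (𝒢.eltLen n) ⊕ Fin (𝒢.eltLen n))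
      (Fin (𝒢.eltLen n))) : PMF Bool :=
  (PMF.uniformOfFintype (Bits (𝒢.seedLen n))).bind fun ω =>
  (PMF.uniformOfFintype (𝒢.Exp n ω)).bind fun a =>
  (PMF.uniformOfFintype (𝒢.Exp n ω)).bind fun y =>
  (A.eval noOracle (𝒢.params n ω ⧺ 𝒢.enc n ω (𝒢.pow (𝒢.gen n ω) a) ⧺
    𝒢.enc n ω (𝒢.pow (𝒢.gen n ω) y))).map fun o =>
      decide (o = 𝒢.enc n ω (𝒢.pow (𝒢.gen n ω) (a * y)))

/-- Multiplying a logged query by the element encoded by `η` gives `t`. -/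
def Solved {ω : Bits (𝒢.seedLen n)} (t : 𝒢.Carrier n ω) (η : Bits (𝒢.eltLen n)) (T : Table L) :
    Prop :=
  ∃ v e, η = 𝒢.enc n ω e ∧ v * e = t ∧ Queried (List.ofFn (𝒢.enc n ω v)) T

open Classical in
/-- The experiment that the CDH solution can be read off the log of `d`. -/
noncomputable def logExp (w : Bits ℓ) (d : Circ plainSig (CoreWires 𝒢 n ℓ ⊕ Fin (𝒢.eltLen n)) Z)
    (slots : List (Slot L ((CoreWires 𝒢 n ℓ ⊕ Fin (𝒢.eltLen n)) ⊕ Z))) : PMF Bool :=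
  (PMF.uniformOfFintype (Bits (𝒢.seedLen n))).bind fun ω =>
  (PMF.uniformOfFintype (𝒢.Exp n ω)).bind fun a =>
  (PMF.uniformOfFintype (𝒢.Exp n ω)).bind fun y =>
  ((ingredientsA 𝒢 n ℓ).eval noOracle (𝒢.params n ω ⧺ 𝒢.enc n ω (𝒢.pow (𝒢.gen n ω) a) ⧺
    𝒢.enc n ω (𝒢.pow (𝒢.gen n ω) y) ⧺ w)).bind fun v =>
  (d.eval noOracle v).map fun z =>
    decide (Solved (𝒢.pow (𝒢.gen n ω) (a * y)) (v ∘ Sum.inr) (readTable slots (v ⧺ z)))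

/-- The CDH solver that hopes for the query in a given slot. -/
def solverA (w : Bits ℓ) (d : Circ plainSig (CoreWires 𝒢 n ℓ ⊕ Fin (𝒢.eltLen n)) Z)
    (slot : Slot L ((CoreWires 𝒢 n ℓ ⊕ Fin (𝒢.eltLen n)) ⊕ Z)) :
    Circ plainSig (𝒢.ParamWires n ⊕ Fin (𝒢.eltLen n) ⊕ Fin (𝒢.eltLen n)) (Fin (𝒢.eltLen n)) :=
  bnd (constC w) <|
  bnd (on (Sum.inl ∘ Sum.inl ⧺ Sum.inl ∘ Sum.inr ∘ Sum.inl ⧺ Sum.inl ∘ Sum.inr ∘ Sum.inr ⧺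
    Sum.inr) (ingredientsA 𝒢 n ℓ)) <|
  bnd (on Sum.inr d) <|
  if h : 𝒢.eltLen n = slot.len then
    on (Sum.inl ∘ Sum.inl ∘ Sum.inl ∘ Sum.inl ⧺
      ((Sum.inl ∘ Sum.inr ⧺ Sum.inr) ∘ slot.key ∘ Fin.cast h) ⧺ Sum.inl ∘ Sum.inr ∘ Sum.inr)
      (𝒢.mulA n plainSig)
  else constC fun _ => false

theorem size_solverA_le (w : Bits ℓ)
    (d : Circ plainSig (CoreWires 𝒢 n ℓ ⊕ Fin (𝒢.eltLen n)) Z)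
    (slot : Slot L ((CoreWires 𝒢 n ℓ ⊕ Fin (𝒢.eltLen n)) ⊕ Z)) :
    (solverA w d slot).size ≤ ℓ + (ingredientsA 𝒢 n ℓ : Circ plainSig _ _).size + d.size +
      (𝒢.mulA n plainSig).size + 𝒢.eltLen n := by
  unfold solverA
  split <;> simp only [size_bnd, size_on, size_constC] <;> omega

/-- A slot that holds the query gives the solution to its solver. -/
theorem logExp_cons_le (w : Bits ℓ)
    (d : Circ plainSig (CoreWires 𝒢 n ℓ ⊕ Fin (𝒢.eltLen n)) Z)
    (slot : Slot L ((CoreWires 𝒢 n ℓ ⊕ Fin (𝒢.eltLen n)) ⊕ Z))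
    (slots : List (Slot L ((CoreWires 𝒢 n ℓ ⊕ Fin (𝒢.eltLen n)) ⊕ Z))) :
    logExp w d (slot :: slots) true ≤ cdhExp (solverA w d slot) true + logExp w d slots true := by
  classical
  refine PMF.bind_true_le _ fun ω => PMF.bind_true_le _ fun a => PMF.bind_true_le _ fun y => ?_
  simp only [solverA, eval_bnd, eval_constC, PMF.pure_bind, eval_on, Sum.comp_elim,
    elim_comp_inl_comp, elim_comp_inr_comp, Sum.elim_comp_inl, Sum.elim_comp_inr, PMF.map_bind]
  refine PMF.bind_true_le _ fun v => PMF.bind_true_le _ fun z => ?_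
  by_cases hs : Solved (𝒢.pow (𝒢.gen n ω) (a * y)) (v ∘ Sum.inr) (readTable slots (v ⧺ z))
  · exact (PMF.coe_le_one _ _).trans (by simp [hs])
  by_cases hc : Solved (𝒢.pow (𝒢.gen n ω) (a * y)) (v ∘ Sum.inr)
    (readTable (slot :: slots) (v ⧺ z))
  · obtain ⟨x, e, he, hxe, hq⟩ := hc
    have hk : List.ofFn (𝒢.enc n ω x) = List.ofFn ((v ⧺ z) ∘ slot.key) := by
      rcases List.mem_cons.1 hq with h | h
      · exact h
      · exact absurd ⟨x, e, he, hxe, h⟩ hs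
    obtain ⟨len, key, val⟩ := slot
    obtain rfl : 𝒢.eltLen n = len := by simpa using congrArg List.length hk
    have hk' := List.ofFn_injective hk
    refine (PMF.coe_le_one _ _).trans (le_trans ?_ le_self_add)
    rw [dif_pos rfl]
    simp only [eval_on, Sum.comp_elim, elim_comp_inl_comp, Sum.elim_comp_inl]
    have h3 : ((((𝒢.params n ω ⧺ 𝒢.enc n ω (𝒢.pow (𝒢.gen n ω) a) ⧺
        𝒢.enc n ω (𝒢.pow (𝒢.gen n ω) y)) ⧺ w) ⧺ v) ⧺ z) ∘
        ((Sum.inl ∘ Sum.inr ⧺ Sum.inr) ∘ key ∘ Fin.cast rfl) = 𝒢.enc n ω x := by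
      rw [hk', ← Function.comp_assoc, Sum.comp_elim]
      rfl
    rw [h3, elim_comp_inr_comp, he, GroupGen.eval_mulA, PMF.pure_map, hxe]
    simp
  · simp [hc]

/-- The probability that some slot holds the query is at most the number of slots times that of
the best slot. -/
theorem exists_solver (w : Bits ℓ)
    (d : Circ plainSig (CoreWires 𝒢 n ℓ ⊕ Fin (𝒢.eltLen n)) Z)
    (slots : List (Slot L ((CoreWires 𝒢 n ℓ ⊕ Fin (𝒢.eltLen n)) ⊕ Z))) :
    ∃ A : Circ plainSig (𝒢.ParamWires n ⊕ Fin (𝒢.eltLen n) ⊕ Fin (𝒢.eltLen n)) (Fin (𝒢.eltLen n)),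
      A.size ≤ ℓ + (ingredientsA 𝒢 n ℓ : Circ plainSig _ _).size + d.size +
        (𝒢.mulA n plainSig).size + 𝒢.eltLen n ∧
      logExp w d slots true ≤ slots.length * cdhExp A true := by
  induction slots with
  | nil =>
    refine ⟨constC fun _ => false, by rw [size_constC]; omega, ?_⟩
    have h : ∀ (ω : Bits (𝒢.seedLen n)) (t : 𝒢.Carrier n ω) η,
        ¬ Solved t η ([] : Table L) := by
      rintro ω t η ⟨v, e, -, -, h⟩
      simp [Queried] at h
    have h' : logExp (L := L) w d [] true ≤ 0 := by
      refine PMF.bind_true_le_of_le _ fun ω => PMF.bind_true_le_of_le _ fun a =>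
        PMF.bind_true_le_of_le _ fun y => PMF.bind_true_le_of_le _ fun v =>
        PMF.bind_true_le_of_le _ fun z => ?_
      have h0 : readTable ([] : List (Slot L ((CoreWires 𝒢 n ℓ ⊕ Fin (𝒢.eltLen n)) ⊕ Z)))
        (v ⧺ z) = [] := rfl
      simp [h0, h]
    exact h'.trans zero_le
  | cons slot slots ih =>
    obtain ⟨A, hA, hle⟩ := ih
    have hs := logExp_cons_le w d slot slots
    simp only [List.length_cons, Nat.cast_add, Nat.cast_one, add_mul, one_mul]
    rcases le_total (cdhExp A true) (cdhExp (solverA w d slot) true) with h | h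
    · refine ⟨_, size_solverA_le w d slot, hs.trans ?_⟩
      rw [add_comm]
      exact add_le_add_left (hle.trans (by gcongr)) _
    · refine ⟨A, hA, hs.trans ?_⟩
      rw [add_comm]
      exact add_le_add hle h

/-- Querying the key of the other message is no easier than solving the CDH problem. -/
theorem exists_cdh_solver (w : Bits ℓ) {β : Type} (c : Circ (roSig L) (CoreWires 𝒢 n ℓ) β) :
    ∃ A : Circ plainSig (𝒢.ParamWires n ⊕ Fin (𝒢.eltLen n) ⊕ Fin (𝒢.eltLen n)) (Fin (𝒢.eltLen n)),
      A.size ≤ ℓ + (ingredientsA 𝒢 n ℓ : Circ plainSig _ _).size +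
        c.size * (1 + 7 * c.size) + (𝒢.mulA n plainSig).size + 𝒢.eltLen n ∧
      coreExp w (fun v z => queryExp z lazily c v) true ≤ c.size * cdhExp A true := by
  classical
  obtain ⟨Z, d, b, slots, hlen, hd, he⟩ := exists_lazy_circuit c c.size
    (Sum.inl : CoreWires 𝒢 n ℓ → CoreWires 𝒢 n ℓ ⊕ Fin (𝒢.eltLen n)) [] (by simp)
  obtain ⟨A, hA, hle⟩ := exists_solver w d slots
  refine ⟨A, hA.trans (by omega), le_trans ?_ (hle.trans ?_)⟩
  · have e : ∀ v : CoreWires 𝒢 n ℓ ⊕ Fin (𝒢.eltLen n) → Bool, ∀ z : List Bool,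
        queryExp z lazily c (v ∘ Sum.inl) =
          (d.eval noOracle v).map fun r => decide (Queried z (readTable slots (v ⧺ r))) := by
      intro v z
      have h0 : readTable ([] : List (Slot L (CoreWires 𝒢 n ℓ ⊕ Fin (𝒢.eltLen n)))) v = [] := rfl
      rw [queryExp, ← h0, ← he v, PMF.map_comp]
      rfl
    refine PMF.bind_true_mono _ fun ω => PMF.bind_true_mono _ fun a =>
      PMF.bind_true_mono _ fun y' => ?_
    simp only [eval_ingredientsA, PMF.bind_bind, PMF.pure_bind]
    refine PMF.bind_true_mono _ fun y => PMF.bind_true_mono _ fun δ =>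
      PMF.bind_true_mono _ fun r₁ => PMF.bind_true_mono _ fun r₂ =>
      PMF.bind_true_mono _ fun s₂ => PMF.bind_true_mono _ fun r₃ =>
      PMF.bind_true_mono _ fun u => ?_
    generalize r₂ + r₁ * (-1) ^ s₂.toNat = x
    generalize coreInput _ _ _ _ _ _ _ _ _ _ _ = v
    have e' := e (v ⧺ 𝒢.enc n ω (𝒢.pow (𝒢.pow (𝒢.gen n ω) y') x))
    rw [Sum.elim_comp_inl] at e'
    rw [e']
    refine PMF.map_true_mono _ fun r hr => ?_
    rw [decide_eq_true_eq] at hr ⊢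
    -- `g ^ ((a - x) * y') * g ^ (y' * x) = g ^ (a * y')`
    refine ⟨_, _, rfl, ?_, hr⟩
    simp only [← GroupGen.pow_sub, ← GroupGen.pow_mul, ← GroupGen.pow_add]
    congr 1
    ring
  · have : (slots.length : ℝ≥0∞) ≤ c.size := by exact_mod_cast (by simpa using hlen)
    gcongr

end Reduction

/-! ### Security against the receiver -/

section Receiver

variable {𝒢 : GroupGen} {n : ℕ} {σ : ℕ → ℕ}

/-- If the tag of the other message is not accepted by accident, the receiver's view is made of
its ingredients. -/
theorem partyView_R (H : List Bool → Bits (σ n + n)) (m : Bool → Bits (σ n)) (s : Bool)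
    (c : Coins 𝒢 n) (hc : c.tagCollision H s = false) :
    PMF.pure (partyView 𝒢 σ H m s c .R) = (coreA 𝒢 n (σ n)).eval (roOracle H)
      (c.coreInput s (m s) (xorBits (H (c.hiddenKey s)) (Fin.append (m !s) c.r₃))) := by
  rw [Coins.coreInput, eval_coreA]
  congr 1
  have hk : List.ofFn (𝒢.enc n c.seed (𝒢.pow (𝒢.pow c.g (c.x s)) (c.y s))) = c.chosenKey s := rfl
  simp only [partyView, Coins.out_eq c H m s hc, Coins.res_eq, encOption, encCiphers, hk]
  have h2 : (!s) ≠ s := by cases s <;> simp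
  by_cases h : c.τ false = s
  · simp [h, perm_bool_true]
    rfl
  · have hf : c.τ false = !s := by cases hs : s <;> cases hj : c.τ false <;> simp_all
    simp [hf, perm_bool_true]
    rfl

/-- The real experiment, with the view put together from its ingredients and with a permutation of
law `π`. -/
noncomputable def assembledExp (π : ℕ → PMF (Equiv.Perm Bool))
    (D : Circ (roSig (σ n + n)) (CoreWires 𝒢 n (σ n)) Unit) (m : Bool → Bits (σ n)) (s : Bool)
    (H : List Bool → Bits (σ n + n)) : PMF Bool :=
  (sampleCoins 𝒢 π n).bind fun c => decision (roOracle H) D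
    (c.coreInput s (m s) (xorBits (H (c.hiddenKey s)) (Fin.append (m !s) c.r₃)))

theorem decision_seq {L : ℕ} {α β : Type} (O : (roSig L).Oracle) (c : Circ (roSig L) α β)
    (d : Circ (roSig L) β Unit) (x : α → Bool) :
    decision O (seq c d) x = (c.eval O x).bind fun y => decision O d y := by
  simp only [decision, eval, PMF.map_bind]

theorem eval_simulator_bind {ℓ : ℕ} (H : List Bool → Bits (ℓ + n))
    (D : Circ (roSig (ℓ + n)) (ReceiverWires 𝒢 n ℓ) Unit) (e : Empty → Bool) (w : Bits ℓ) :
    ((seq (freshIngredientsA 𝒢 n ℓ) (coreA 𝒢 n ℓ)).eval (roOracle H) (e ⧺ w)).bind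
        (fun v => (D.eval (roOracle H) v).bind fun b => PMF.pure (b ())) =
      coreExp w fun v _ => decision (roOracle H) (seq (coreA 𝒢 n ℓ) D) v := by
  simp only [eval, eval_freshIngredientsA, coreExp_bind, PMF.pure_bind, decision_seq]
  rfl

/-- Putting the view together from its ingredients makes a difference only if the tag of the other
message is accepted by accident. -/
theorem real_assembled (π : ℕ → PMF (Equiv.Perm Bool))
    (D : Circ (roSig (σ n + n)) (ReceiverWires 𝒢 n (σ n)) Unit) (m : Bool → Bits (σ n)) (s : Bool)
    (H : List Bool → Bits (σ n + n)) :
    ((sampleCoins 𝒢 π n).bind fun c => decision (roOracle H) D (partyView 𝒢 σ H m s c .R)) true ≤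
        assembledExp π (seq (coreA 𝒢 n (σ n)) D) m s H true +
          ((sampleCoins 𝒢 π n).map fun c => c.tagCollision H s) true ∧
      assembledExp π (seq (coreA 𝒢 n (σ n)) D) m s H true ≤
        ((sampleCoins 𝒢 π n).bind fun c =>
          decision (roOracle H) D (partyView 𝒢 σ H m s c .R)) true +
          ((sampleCoins 𝒢 π n).map fun c => c.tagCollision H s) true := by
  have key : ∀ c : Coins 𝒢 n, c.tagCollision H s = false →
      decision (roOracle H) D (partyView 𝒢 σ H m s c .R) =
      decision (roOracle H) (seq (coreA 𝒢 n (σ n)) D)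
        (c.coreInput s (m s) (xorBits (H (c.hiddenKey s)) (Fin.append (m !s) c.r₃))) := by
    intro c hc
    rw [decision_seq, ← partyView_R H m s c hc]
    exact (PMF.pure_bind _ _).symm
  constructor
  · refine PMF.bind_true_le _ fun c => ?_
    cases hc : c.tagCollision H s
    · rw [key c hc]; exact le_self_add
    · exact (PMF.coe_le_one _ _).trans (by simp [hc])
  · refine PMF.bind_true_le _ fun c => ?_
    cases hc : c.tagCollision H s
    · rw [key c hc]; exact le_self_add
    · exact (PMF.coe_le_one _ _).trans (by simp [hc])

/-- A message `w` encrypted with the oracle's value at `z` is as good as uniform bits `u`, unless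
`z` is queried. The oracle's value at `z` may be resampled as `u ⊕ w`, and reprogramming the oracle
to this value is noticed by a query of `z` only. -/
theorem one_time_pad {L K : ℕ} {α : Type} {z : List Bool} (hz : z.length ≤ K)
    (c : Circ (roSig L) α Unit) (hc : c.size ≤ K) (w : Bits L) (x : Bits L → α → Bool) :
    ((shortOracle K L).bind fun h =>
        decision (roOracle h) c (x (xorBits (h z) w))) true ≤
        ((shortOracle K L).bind fun h => (PMF.uniformOfFintype (Bits L)).bind fun u =>
          decision (roOracle h) c (x u)) true +
        ((PMF.uniformOfFintype (Bits L)).bind fun u => queryExp z lazily c (x u)) true ∧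
      ((shortOracle K L).bind fun h => (PMF.uniformOfFintype (Bits L)).bind fun u =>
          decision (roOracle h) c (x u)) true ≤
        ((shortOracle K L).bind fun h => decision (roOracle h) c (x (xorBits (h z) w))) true +
        ((PMF.uniformOfFintype (Bits L)).bind fun u => queryExp z lazily c (x u)) true := by
  have hxor : ∀ u : Bits L, xorBits (xorBits u w) w = u := fun u => by funext i; simp [xorBits]
  let e : Bits L ≃ Bits L := ⟨fun u => xorBits u w, fun u => xorBits u w, hxor, hxor⟩
  have h1 : ((shortOracle K L).bind fun h => decision (roOracle h) c (x (xorBits (h z) w))) =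
      (shortOracle K L).bind fun h => (PMF.uniformOfFintype (Bits L)).bind fun u =>
        decision (roOracle (Function.update h z (xorBits u w))) c (x u) := by
    rw [← shortOracle_resample hz]
    refine PMF.bind_congr' _ fun h => ?_
    simp only [Function.update_self]
    rw [← uniform_bind_equiv e]
    refine PMF.bind_congr' _ fun u => ?_
    have : xorBits (e u) w = u := hxor u
    rw [this]
    rfl
  have h2 : ((PMF.uniformOfFintype (Bits L)).bind fun u => queryExp z lazily c (x u)) =
      (shortOracle K L).bind fun h => (PMF.uniformOfFintype (Bits L)).bind fun u =>
        queryExp z (honest h) c (x u) := by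
    rw [PMF.bind_comm]
    exact PMF.bind_congr' _ fun u => (queryExp_honest_eq_lazily z c hc (x u)).symm
  have off : ∀ (h : List Bool → Bits L) v l, l ≠ z → Function.update h z v l = h l :=
    fun h v l hl => Function.update_of_ne hl _ _
  rw [h1, h2]
  constructor
  · refine PMF.bind_true_le _ fun h => PMF.bind_true_le _ fun u => ?_
    rw [← queryExp_congr (off h (xorBits u w))]
    exact decision_le_of_eq_off (off h _) c (x u)
  · refine PMF.bind_true_le _ fun h => PMF.bind_true_le _ fun u => ?_
    exact decision_le_of_eq_off (fun l hl => (off h _ l hl).symm) c (x u)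

/-- Replacing the second component of the other ciphertext by uniform bits makes a difference only
if the hidden key is queried. -/
theorem assembled_fresh {K : ℕ} (hK : 𝒢.eltLen n ≤ K)
    (D : Circ (roSig (σ n + n)) (CoreWires 𝒢 n (σ n)) Unit) (hD : D.size ≤ K)
    (m : Bool → Bits (σ n)) (s : Bool) :
    ((shortOracle K (σ n + n)).bind (assembledExp fairPerm D m s)) true ≤
        ((shortOracle K (σ n + n)).bind fun h =>
          coreExp (m s) fun v _ => decision (roOracle h) D v) true +
        coreExp (m s) (fun v z => queryExp z lazily D v) true ∧
      ((shortOracle K (σ n + n)).bind fun h =>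
          coreExp (m s) fun v _ => decision (roOracle h) D v) true ≤
        ((shortOracle K (σ n + n)).bind (assembledExp fairPerm D m s)) true +
        coreExp (m s) (fun v z => queryExp z lazily D v) true := by
  have h1 : ((shortOracle K (σ n + n)).bind (assembledExp fairPerm D m s)) =
      (sampleCoins 𝒢 fairPerm n).bind fun c => (shortOracle K (σ n + n)).bind fun h =>
        decision (roOracle h) D
          (c.coreInput s (m s) (xorBits (h (c.hiddenKey s)) (Fin.append (m !s) c.r₃))) :=
    PMF.bind_comm _ _ _
  have h2 : ((shortOracle K (σ n + n)).bind fun h =>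
          coreExp (m s) fun v _ => decision (roOracle h) D v) =
      (sampleCoins 𝒢 fairPerm n).bind fun c => (shortOracle K (σ n + n)).bind fun h =>
        (PMF.uniformOfFintype (Bits (σ n + n))).bind fun u =>
          decision (roOracle h) D (c.coreInput s (m s) u) := by
    rw [PMF.bind_comm]
    exact PMF.bind_congr' _ fun h => (sampleCoins_fairPerm s (m s) _).symm
  rw [h1, h2, ← sampleCoins_fairPerm s (m s)]
  have hz : ∀ c : Coins 𝒢 n, (c.hiddenKey s).length ≤ K := fun c => by
    rwa [Coins.hiddenKey, List.length_ofFn]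
  exact ⟨PMF.bind_true_le _ fun c => (one_time_pad (hz c) D hD _ (c.coreInput s (m s))).1,
    PMF.bind_true_le _ fun c => (one_time_pad (hz c) D hD _ (c.coreInput s (m s))).2⟩

/-- The probability that the hidden key is queried is negligible, uniformly in the chosen message:
the solver has the worst message for each `n` built in. -/
theorem exists_negligible_query (hCDH : 𝒢.CDHHard) (hσ : PolyBounded σ)
    (D : ∀ n, Circ (roSig (σ n + n)) (CoreWires 𝒢 n (σ n)) Unit)
    (hD : PolyBounded fun n => (D n).size) :
    ∃ ν : ℕ → ℝ, Negligible ν ∧ ∀ n, 0 ≤ ν n ∧ ∀ w : Bits (σ n),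
      coreExp w (fun v z => queryExp z lazily (D n) v) true ≤ ENNReal.ofReal (ν n) := by
  have hmax : ∀ n, ∃ w₀ : Bits (σ n), ∀ w : Bits (σ n),
      coreExp w (fun v z => queryExp z lazily (D n) v) true ≤
        coreExp w₀ (fun v z => queryExp z lazily (D n) v) true := fun n => Finite.exists_max _
  choose w₀ hw₀ using hmax
  choose A hA hle using fun n => exists_cdh_solver (w₀ n) (D n)
  have hpoly : PolyBounded fun n => (A n).size := by
    refine ((((hσ.add (poly_ingredientsA (𝒢 := 𝒢) _ hσ)).add (hD.mul
      ((PolyBounded.const 1).add ((PolyBounded.const 7).mul hD)))).add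
      (𝒢.poly_mulA fun _ => plainSig)).add 𝒢.eltLen_poly).mono hA
  have hadv : ∀ n, 𝒢.cdhAdvantage ⟨A, hpoly⟩ n = (cdhExp (A n) true).toReal := fun n => rfl
  refine ⟨fun n => (D n).size * 𝒢.cdhAdvantage ⟨A, hpoly⟩ n, (hCDH _).polyBounded_mul hD,
    fun n => ⟨?_, fun w => ?_⟩⟩
  · beta_reduce; rw [hadv]; positivity
  · refine ((hw₀ n w).trans (hle n)).trans_eq ?_
    beta_reduce
    rw [hadv, ENNReal.ofReal_mul (by positivity), ENNReal.ofReal_natCast,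
      ENNReal.ofReal_toReal (PMF.apply_ne_top _ _)]

theorem abs_toReal_sub_le {a b : ℝ≥0∞} {ε : ℝ} (ha : a ≠ ∞) (hb : b ≠ ∞) (hε : 0 ≤ ε)
    (h : a ≤ b + ENNReal.ofReal ε) (h' : b ≤ a + ENNReal.ofReal ε) :
    |a.toReal - b.toReal| ≤ ε := by
  have h1 := ENNReal.toReal_mono (ENNReal.add_ne_top.2 ⟨hb, ENNReal.ofReal_ne_top⟩) h
  have h2 := ENNReal.toReal_mono (ENNReal.add_ne_top.2 ⟨ha, ENNReal.ofReal_ne_top⟩) h'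
  rw [ENNReal.toReal_add hb ENNReal.ofReal_ne_top, ENNReal.toReal_ofReal hε] at h1
  rw [ENNReal.toReal_add ha ENNReal.ofReal_ne_top, ENNReal.toReal_ofReal hε] at h2
  exact abs_sub_le_iff.2 ⟨by linarith, by linarith⟩

end Receiver

/-- The hybrids are: the real view, the real view assembled from its ingredients, the same with a
fair permutation, and the same with uniform bits in place of the ciphertext of the other message.
The last one is the simulated view. -/
theorem simulator_R (𝒢 : GroupGen) (hDL : 𝒢.DLHard) (hCDH : 𝒢.CDHHard) {σ : ℕ → ℕ}
    (hσ : PolyBounded σ) {π : ℕ → PMF (Equiv.Perm Bool)} (hπ : SecurePermutation π) :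
    ∃ Sim : (duqOT 𝒢 σ π).Simulator .R, ∀ D : (duqOT 𝒢 σ π).Distinguisher .R,
      ∃ μ, Negligible μ ∧ ∀ n m s,
      |(duqOT 𝒢 σ π).idealProb .R Sim D n m s - (duqOT 𝒢 σ π).realProb .R D n m s| ≤ μ n := by
  refine ⟨⟨fun n => seq (freshIngredientsA 𝒢 n (σ n)) (coreA 𝒢 n (σ n)),
    (poly_freshIngredientsA _ hσ).add (poly_coreA hσ)⟩, fun D => ?_⟩
  obtain ⟨μ, hμ, hμ0, hclose⟩ := hπ.exists_close
  let D' : ∀ n, Circ (roSig (σ n + n)) (CoreWires 𝒢 n (σ n)) Unit := fun n =>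
    seq (coreA 𝒢 n (σ n)) (D.circ n)
  have hD' : PolyBounded fun n => (D' n).size := (poly_coreA hσ).add D.poly
  obtain ⟨ν, hν, hν'⟩ := exists_negligible_query hCDH hσ D' hD'
  refine ⟨fun n => ν n + μ n + collisionBound 𝒢 n,
    (hν.add hμ).add (negligible_collisionBound hDL), fun n m s => ?_⟩
  have hν0 := (hν' n).1
  have hq := (hν' n).2 (m s)
  -- No string longer than `K` is queried by the protocol or by a distinguisher.
  let K := 𝒢.eltLen n + (D' n).size
  have hK : 𝒢.eltLen n ≤ K := Nat.le_add_right _ _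
  have hDK : (D' n).size ≤ K := Nat.le_add_left _ _
  have hDK' : (D.circ n).size ≤ K := le_trans (Nat.le_add_left _ _) hDK
  let real : (List Bool → Bits (σ n + n)) → PMF Bool := fun H =>
    (sampleCoins 𝒢 π n).bind fun c =>
      decision (roOracle H) (D.circ n) (partyView 𝒢 σ H m s c .R)
  let ideal : (List Bool → Bits (σ n + n)) → PMF Bool := fun H =>
    coreExp (m s) fun v _ => decision (roOracle H) (D' n) v
  have hreal : (duqOT 𝒢 σ π).realProb .R D n m s =
      (((shortOracle K (σ n + n)).bind real) true).toReal := by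
    rw [← roProb_eq]
    · unfold Protocol.realProb
      congr 1
      funext H
      exact PMF.bind_map_apply _ _ _
    · intro H H' h
      have hout : ∀ c : Coins 𝒢 n, partyView 𝒢 σ H m s c .R = partyView 𝒢 σ H' m s c .R := by
        intro c
        have h' : ∀ l : List Bool, l.length ≤ 𝒢.eltLen n → H l = H' l :=
          fun l hl => h l (hl.trans hK)
        simp only [partyView, out_congr c h' m s, res_congr c h' m s]
        rfl
      refine PMF.bind_congr' _ fun c => ?_
      rw [hout c]
      exact congrArg (PMF.map fun b => b ()) (eval_congr h (D.circ n) hDK' _)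
  have hideal : (duqOT 𝒢 σ π).idealProb .R
      ⟨fun n => seq (freshIngredientsA 𝒢 n (σ n)) (coreA 𝒢 n (σ n)),
        (poly_freshIngredientsA _ hσ).add (poly_coreA hσ)⟩ D n m s =
      (((shortOracle K (σ n + n)).bind ideal) true).toReal := by
    rw [← roProb_eq]
    · unfold Protocol.idealProb
      congr 1
      funext H
      exact eval_simulator_bind H (D.circ n) _ (m s)
    · intro H H' h
      simp only [ideal, decision, eval_congr h (D' n) hDK]
  rw [hreal, hideal]
  let M : PMF Bool := (shortOracle K (σ n + n)).bind (assembledExp π (D' n) m s)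
  let M' : PMF Bool := (shortOracle K (σ n + n)).bind (assembledExp fairPerm (D' n) m s)
  have hcol : collisionExp 𝒢 σ π n K s true ≤ ENNReal.ofReal (collisionBound 𝒢 n) := by
    rw [ENNReal.le_ofReal_iff_toReal_le (PMF.apply_ne_top _ _) collisionBound_nonneg]
    exact collisionExp_toReal_le σ π hK s
  have hε : ENNReal.ofReal (ν n + μ n + collisionBound 𝒢 n) =
      ENNReal.ofReal (ν n) + ENNReal.ofReal (μ n) + ENNReal.ofReal (collisionBound 𝒢 n) := by
    rw [ENNReal.ofReal_add (add_nonneg hν0 (hμ0 n)) collisionBound_nonneg,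
      ENNReal.ofReal_add hν0 (hμ0 n)]
  have hmap : ((fairPerm n).map fun τ => τ false) = PMF.uniformOfFintype Bool := fairPerm_map
  have a1 : ((shortOracle K (σ n + n)).bind real) true ≤ M true + _ :=
    (PMF.bind_true_le _ fun H => (real_assembled π (D.circ n) m s H).1).trans
      (add_le_add_right hcol _)
  have a2 : M true ≤ ((shortOracle K (σ n + n)).bind real) true + _ :=
    (PMF.bind_true_le _ fun H => (real_assembled π (D.circ n) m s H).2).trans
      (add_le_add_right hcol _)
  have b1 : M true ≤ M' true + ENNReal.ofReal (μ n) := PMF.bind_true_le_const _ fun H =>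
    sampleCoins_bind_true_le (fun b => by rw [hmap]; exact (hclose n b).1) _
  have b2 : M' true ≤ M true + ENNReal.ofReal (μ n) := PMF.bind_true_le_const _ fun H =>
    sampleCoins_bind_true_le (fun b => by rw [hmap]; exact (hclose n b).2) _
  have c1 := ((assembled_fresh hK (D' n) hDK m s).1).trans (add_le_add_right hq _)
  have c2 := ((assembled_fresh hK (D' n) hDK m s).2).trans (add_le_add_right hq _)
  refine abs_toReal_sub_le (PMF.apply_ne_top _ _) (PMF.apply_ne_top _ _)
    (add_nonneg (add_nonneg hν0 (hμ0 n)) collisionBound_nonneg) ?_ ?_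
  · rw [hε]
    calc _ ≤ M' true + ENNReal.ofReal (ν n) := c2
      _ ≤ ((((shortOracle K (σ n + n)).bind real) true + ENNReal.ofReal (collisionBound 𝒢 n)) +
          ENNReal.ofReal (μ n)) + ENNReal.ofReal (ν n) := by
        gcongr; exact b2.trans (by gcongr)
      _ = _ := by ring
  · rw [hε]
    calc _ ≤ M true + ENNReal.ofReal (collisionBound 𝒢 n) := a1
      _ ≤ ((((shortOracle K (σ n + n)).bind ideal) true + ENNReal.ofReal (ν n)) +
          ENNReal.ofReal (μ n)) + ENNReal.ofReal (collisionBound 𝒢 n) := by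
        gcongr; exact b1.trans (by gcongr)
      _ = _ := by ring

end DUQOT

/-- Under the DL and CDH assumptions, in the random-oracle model and for a secure random
permutation, DUQ-OT securely computes the delegated-unknown-query OT functionality in the presence
of passive adversaries. -/
theorem mainTheorem3 (𝒢 : GroupGen) (hDL : 𝒢.DLHard) (hCDH : 𝒢.CDHHard)
    (σ : ℕ → ℕ) (hσ : PolyBounded σ)
    (π : ℕ → PMF (Equiv.Perm Bool)) (hπ : SecurePermutation π) :
    (duqOT 𝒢 σ π).Realizes ∧ (duqOT 𝒢 σ π).Correct := by
  refine ⟨fun i => ?_, DUQOT.correct hDL σ π⟩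
  cases i with
  | S => exact DUQOT.simulator_S 𝒢 hπ
  | P₁ => exact DUQOT.simulator_P₁ 𝒢 π
  | P₂ => exact DUQOT.simulator_P₂ 𝒢 π
  | R => exact DUQOT.simulator_R 𝒢 hDL hCDH hσ hπ
  | T => exact DUQOT.simulator_T 𝒢 π
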